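/- Let $\mathsf{RCA}^*_0$ be the theory in the language of second-order arithmetic with a symbol for exponentiation whose axioms are the basic arithmetical axioms, the recursion equations for exponentiation, induction for bounded formulas with set parameters ($\Delta^0_0$ formulas, exponentiation allowed), and $\Delta^0_1$ comprehension. Then there is a $\Delta_0$ formula $\Xi(x)$ of first-order arithmetic (a bounded formula in the language $0,1,+,\cdot,<$) with the following properties. (a) The set of natural numbers defined by $\Xi$ is recognizable in polynomial time. (b) $\mathsf{RCA}^*_0$ proves that every $\xi$ with $\Xi(\xi)$ is (the code of) a $\Sigma^1_1\wedge\Pi^1_1$ sentence, i.e. the conjunction of a $\Sigma^1_1$ and a $\Pi^1_1$ sentence, of second-order logic in the language with one unary function symbol $f$ and one constant symbol $c$. These sentences may have nonstandard length when considered in a nonstandard model, but the arities of their relation variables and the numbers of alternating blocks of first-order quantifiers in their prenex first-order parts are bounded by a fixed standard number, so that the satisfaction relation for them is definable. (c) $\mathsf{RCA}^*_0$ proves: for every structure $\mathbb A=\langle A,f,c\rangle$ with a unary function $f\colon A\to A$ and an element $c\in A$, $\mathbb A$ is isomorphic to $\langle\mathbb N,S,0\rangle$ if and only if $\mathbb A\models\xi$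 for all $\xi$ such that $\Xi(\xi)$. Here second-order quantifiers have the standard semantics, that is, they range over all relations on $A$. (d) $\mathsf{RCA}^*_0$ proves: for every $x\in\mathbb N$ there is a $\xi$ with $\Xi(\xi)$ such that every $\langle A,f,c\rangle$ satisfies $\xi$ if and only if $f^x(c)$ exists, that is, if and only if there is a finite sequence $\langle a_0,\dots,a_x\rangle$ with $a_0=c$ and $a_{z+1}=f(a_z)$ for all $z<x$. -/

import Mathlib

/-!
Second-order arithmetic with a symbol for exponentiation, the theory RCA*_0, and, inside an
arbitrary model of that theory, codes of second-order sentences in the language with one unary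
function symbol `f` and one constant symbol `c`, together with their satisfaction relation.

A model is a first-order structure `M` together with a family `𝒳` of subsets of `M`.
"RCA*_0 proves" is rendered as "holds in all models of RCA*_0".  Every notion that is used
inside a model is given by quantifying over elements of `M` (numbers) and members of `𝒳` (sets)
only, so that it is a formula of second-order arithmetic.  In particular codes of sentences are
elements of `M`, which may be nonstandard.
-/

universe u

namespace RCAStar

/-! ## The language of second-order arithmetic with exponentiation -/

/-- The first-order part of a structure for the language `0, 1, +, ·, exp, <`. -/
class Arith (M : Type u) extends Zero M, One M, Add M, Mul M, Pow M M, LT M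

/-- The standard natural numbers. -/
instance : Arith ℕ where

/-- Number terms in the number variables `0, …, n - 1`. -/
inductive Trm (n : ℕ) : Type
  | var (i : Fin n) : Trm n
  | zero : Trm n
  | one : Trm n
  | add (s t : Trm n) : Trm n
  | mul (s t : Trm n) : Trm n
  | exp (s t : Trm n) : Trm n

/-- Value of a term. -/
def Trm.val {M : Type u} [Arith M] {n : ℕ} (e : Fin n → M) : Trm n → M
  | .var i => e i
  | .zero => 0
  | .one => 1
  | .add s t => s.val e + t.val e
  | .mul s t => s.val e * t.val e
  | .exp s t => s.val e ^ t.val e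

/-- The term does not contain the symbol for exponentiation. -/
def Trm.NoExp {n : ℕ} : Trm n → Prop
  | .var _ => True
  | .zero => True
  | .one => True
  | .add s t => s.NoExp ∧ t.NoExp
  | .mul s t => s.NoExp ∧ t.NoExp
  | .exp _ _ => False

/-- Bounded formulas with set variables `0, …, m - 1` and free number variables `0, …, n - 1`.
The formula `ball t φ` is `∀ x < t, φ`, where `x` is variable `0` of `φ` and the variables of `t`
are shifted by one in `φ`. -/
inductive Bdd (m : ℕ) : ℕ → Type
  | eq {n : ℕ} (s t : Trm n) : Bdd m n
  | lt {n : ℕ} (s t : Trm n) : Bdd m n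
  | mem {n : ℕ} (t : Trm n) (X : Fin m) : Bdd m n
  | not {n : ℕ} (φ : Bdd m n) : Bdd m n
  | and {n : ℕ} (φ ψ : Bdd m n) : Bdd m n
  | ball {n : ℕ} (t : Trm n) (φ : Bdd m (n + 1)) : Bdd m n

/-- Truth of a bounded formula when the set variables denote `S` and the number variables
denote `e`. -/
def Bdd.Holds {M : Type u} [Arith M] {m : ℕ} (S : Fin m → Set M) :
    {n : ℕ} → Bdd m n → (Fin n → M) → Prop
  | _, .eq s t, e => s.val e = t.val e
  | _, .lt s t, e => s.val e < t.val e
  | _, .mem t X, e => t.val e ∈ S X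
  | _, .not φ, e => ¬ φ.Holds S e
  | _, .and φ ψ, e => φ.Holds S e ∧ ψ.Holds S e
  | _, .ball t φ, e => ∀ a : M, a < t.val e → φ.Holds S (Fin.cons a e)

/-- The bounded formula does not contain the symbol for exponentiation. -/
def Bdd.NoExp {m : ℕ} : {n : ℕ} → Bdd m n → Prop
  | _, .eq s t => s.NoExp ∧ t.NoExp
  | _, .lt s t => s.NoExp ∧ t.NoExp
  | _, .mem t _ => t.NoExp
  | _, .not φ => φ.NoExp
  | _, .and φ ψ => φ.NoExp ∧ ψ.NoExp
  | _, .ball t φ => t.NoExp ∧ φ.NoExp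

/-- A `Δ₀` formula `Ξ(x)` of first-order arithmetic with the single free variable `x`: a bounded
formula in the language `0, 1, +, ·, <`, without set variables. -/
def Delta0 : Type := {φ : Bdd 0 1 // φ.NoExp}

/-- `Ξ(x)` holds in `M` at `x`. -/
def Delta0.Holds {M : Type u} [Arith M] (Ξ : Delta0) (x : M) : Prop :=
  Bdd.Holds (fun _ => ∅) Ξ.1 (fun _ => x)

/-- `⟨M, 𝒳⟩` is a model of RCA*_0: basic axioms, recursive definition of exponentiation,
induction for bounded formulas (with exponentiation and with set parameters), and `Δ⁰₁`
comprehension. -/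
structure IsModel (M : Type u) [Arith M] (𝒳 : Set (Set M)) : Prop where
  add_one_ne_zero : ∀ x : M, x + 1 ≠ 0
  add_one_inj : ∀ x y : M, x + 1 = y + 1 → x = y
  add_zero : ∀ x : M, x + 0 = x
  add_succ : ∀ x y : M, x + (y + 1) = (x + y) + 1
  mul_zero : ∀ x : M, x * 0 = 0
  mul_succ : ∀ x y : M, x * (y + 1) = x * y + x
  exp_zero : ∀ x : M, x ^ (0 : M) = 1
  exp_succ : ∀ x y : M, x ^ (y + 1) = x ^ y * x
  not_lt_zero : ∀ x : M, ¬ x < 0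
  lt_succ : ∀ x y : M, x < y + 1 ↔ x < y ∨ x = y
  induction : ∀ (m n : ℕ) (φ : Bdd m (n + 1)) (S : Fin m → Set M) (e : Fin n → M),
    (∀ i, S i ∈ 𝒳) →
    φ.Holds S (Fin.cons 0 e) →
    (∀ x : M, φ.Holds S (Fin.cons x e) → φ.Holds S (Fin.cons (x + 1) e)) →
    ∀ x : M, φ.Holds S (Fin.cons x e)
  comprehension : ∀ (m n : ℕ) (φ ψ : Bdd m (n + 2)) (S : Fin m → Set M) (e : Fin n → M),
    (∀ i, S i ∈ 𝒳) →
    (∀ x : M, (∃ y : M, φ.Holds S (Fin.cons y (Fin.cons x e))) ↔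
      (∀ y : M, ψ.Holds S (Fin.cons y (Fin.cons x e)))) →
    {x : M | ∃ y : M, φ.Holds S (Fin.cons y (Fin.cons x e))} ∈ 𝒳

section Coding

variable {M : Type u} [Arith M]

/-! ## Pairs, finite sequences and strings in a model -/

/-- The standard natural number `k` as an element of `M`. -/
def nat : ℕ → M
  | 0 => 0
  | k + 1 => nat k + 1

/-- The pairing function. -/
def pair (x y : M) : M := (x + y) * (x + y) + x

/-- Tuples of standard length, by iterated pairing. -/
def tuple : List M → M
  | [] => 0
  | a :: l => pair a (tuple l)

/-- `a` is the digit with index `i` in the base `b` expansion of `s`.  The numbers `b, s` together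
code finite sequences: `a` is the entry with index `i` of the sequence. -/
def Entry (b s i a : M) : Prop :=
  a < b ∧ ∃ q r : M, r < b ^ i ∧ s = (q * b + a) * b ^ i + r

/-- Strings are coded in base 16, the first symbol being the least significant digit; the last
symbol of a nonempty string is always nonzero.  This is the statement that `w` has length `l`. -/
def Len (w l : M) : Prop :=
  w < (nat 16 : M) ^ l ∧ ∀ k : M, k < l → ¬ w < (nat 16 : M) ^ k

/-- `w` is the concatenation of `u` and `v`. -/
def Cat (u v w : M) : Prop := ∃ l : M, Len u l ∧ w = u + v * (nat 16 : M) ^ l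

/-- `w` is the concatenation of the (standardly many) strings in the list. -/
def Concat : List M → M → Prop
  | [], w => w = 0
  | u :: us, w => ∃ v : M, Concat us v ∧ Cat u v w

/-- `w` consists of `k` repetitions of the symbol `a`, that is, `w = a * (16 ^ k - 1) / 15`. -/
def Repeat (a k w : M) : Prop := w * nat 15 + a = a * (nat 16 : M) ^ k

/-- `w` is the concatenation of an `M`-finite sequence of strings with property `P`, as witnessed
by the coded sequence of initial parts. -/
def Built (P : M → Prop) (w : M) : Prop :=
  ∃ b s l : M, Entry b s 0 0 ∧ Entry b s l w ∧
    ∀ i : M, i < l → ∃ u v x : M, Entry b s i u ∧ Entry b s (i + 1) v ∧ P x ∧ Cat u x v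

/-! ## Codes of sentences

The symbols are:
`0` tally, `2` end of an index, `3` positive literal, `4` negative literal, `5` equality of
variables, `6` equality with `c`, `7` value of `f`, `8` relation variable, `9` beginning of a
clause, `10` first-order `∃`, `11` first-order `∀`, `12` second-order `∃`, `13` second-order `∀`,
`14` conjunction of the two parts of a sentence.

An index `i` (of a variable) is the string of `i` tallies followed by the symbol `2`. -/

/-- The string for the index `i`. -/
def index (i : M) : M := nat 2 * (nat 16 : M) ^ i

/-- Atomic formulas: `vᵢ = vⱼ`, `vᵢ = c`, `f(vᵢ) = vⱼ`, and `X(v_{i₁}, …, v_{i_d})` where `X` is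
a relation variable.  The indices are elements of `M`. -/
inductive Atom (M : Type u) : Type u
  | eq (i j : M) : Atom M
  | const (i : M) : Atom M
  | fn (i j : M) : Atom M
  | rel (X : M) (args : List M) : Atom M

/-- The relation variables have index `< r` and arity `d`, the first-order variables have
index `< k`. -/
def Atom.Fits (r k : M) (d : ℕ) : Atom M → Prop
  | .eq i j => i < k ∧ j < k
  | .const i => i < k
  | .fn i j => i < k ∧ j < k
  | .rel X args => X < r ∧ args.length = d ∧ ∀ i ∈ args, i < k

/-- The strings that make up an atomic formula. -/
def Atom.pieces : Atom M → List M
  | .eq i j => [nat 5, index i, index j]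
  | .const i => [nat 6, index i]
  | .fn i j => [nat 7, index i, index j]
  | .rel X args => nat 8 :: index X :: args.map index

/-- `w` is the literal given by the sign `p` and the atomic formula `α`. -/
def IsLiteralOf (p : Bool) (α : Atom M) (w : M) : Prop :=
  Concat ((if p then nat 3 else nat 4) :: α.pieces) w

/-- `w` is a literal. -/
def IsLiteral (r k : M) (d : ℕ) (w : M) : Prop :=
  ∃ (p : Bool) (α : Atom M), α.Fits r k d ∧ IsLiteralOf p α w

/-- `w` is a clause: the disjunction of an `M`-finite sequence of literals. -/
def IsClause (r k : M) (d : ℕ) (w : M) : Prop :=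
  ∃ v : M, Built (IsLiteral r k d) v ∧ Concat [nat 9, v] w

/-- `w` is a quantifier-free formula in conjunctive normal form: the conjunction of an `M`-finite
sequence of clauses. -/
def IsMatrix (r k : M) (d : ℕ) (w : M) : Prop :=
  Built (IsClause r k d) w

/-- A second-order formula in prenex form: a block of `rels` many second-order quantifiers of one
kind; then standardly many blocks of first-order quantifiers, where `(true, k)` stands for `k` many
existential and `(false, k)` for `k` many universal quantifiers; then a quantifier-free part.
First-order variables are numbered in the order in which they are quantified. -/
structure Prenex (M : Type u) : Type u where
  rels : M
  blocks : List (Bool × M)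
  matrix : M

/-- The number of variables quantified in the blocks, added to `i`. -/
def width : List (Bool × M) → M → M
  | [], i => i
  | p :: L, i => width L (i + p.2)

/-- `φ` is a sentence, its relation variables have arity `d`, and its first-order quantifiers form
at most `n` alternating nonempty blocks. -/
def Prenex.IsWF (n d : ℕ) (φ : Prenex M) : Prop :=
  φ.blocks.length ≤ n ∧ φ.blocks.IsChain (fun p q => p.1 ≠ q.1) ∧ (∀ p ∈ φ.blocks, p.2 ≠ 0) ∧
    IsMatrix φ.rels (width φ.blocks 0) d φ.matrix

/-- `w` is the string for `φ`, where the second-order quantifiers are written as `Q`. -/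
def Prenex.IsCode (Q : M) (φ : Prenex M) (w : M) : Prop :=
  ∃ (x : M) (us : List M), Repeat Q φ.rels x ∧
    List.Forall₂ (fun (p : Bool × M) (y : M) => Repeat (if p.1 then nat 10 else nat 11) p.2 y)
      φ.blocks us ∧
    Concat (x :: us ++ [φ.matrix]) w

/-- `ξ` is the code of the conjunction of the `Σ¹₁` sentence `σ` and the `Π¹₁` sentence `π`. -/
def IsConjCode (n d : ℕ) (σ π : Prenex M) (ξ : M) : Prop :=
  σ.IsWF n d ∧ π.IsWF n d ∧
    ∃ u v : M, σ.IsCode (nat 12) u ∧ π.IsCode (nat 13) v ∧ Concat [u, nat 14, v] ξ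

/-- `ξ` is the code of a `Σ¹₁ ∧ Π¹₁` sentence (with at most `n` blocks of first-order quantifiers
in each of its parts and with relation variables of arity `d`). -/
def IsSentence (n d : ℕ) (ξ : M) : Prop := ∃ σ π : Prenex M, IsConjCode n d σ π ξ

/-! ## Structures with a unary function and a constant -/

/-- A structure `⟨A, f, c⟩` in the sense of `⟨M, 𝒳⟩`: `A` and the graph `F` of `f : A → A` are
sets of the model. -/
structure Struct (M : Type u) [Arith M] (𝒳 : Set (Set M)) where
  A : Set M
  F : Set M
  c : M
  A_mem : A ∈ 𝒳
  F_mem : F ∈ 𝒳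
  c_mem : c ∈ A
  F_sub : ∀ z ∈ F, ∃ a ∈ A, ∃ b ∈ A, z = pair a b
  F_fun : ∀ a ∈ A, ∃! b : M, pair a b ∈ F

namespace Struct

variable {𝒳 : Set (Set M)} (𝔸 : Struct M 𝒳)

/-- In the sense of `⟨M, 𝒳⟩`, there is an isomorphism from `⟨ℕ, S, 0⟩` onto `⟨A, f, c⟩`. -/
def IsoNat : Prop :=
  ∃ G ∈ 𝒳, (∀ z ∈ G, ∃ x : M, ∃ a ∈ 𝔸.A, z = pair x a) ∧
    (∀ x : M, ∃! a : M, pair x a ∈ G) ∧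
    (∀ a ∈ 𝔸.A, ∃! x : M, pair x a ∈ G) ∧
    pair 0 𝔸.c ∈ G ∧
    (∀ x a b : M, pair x a ∈ G → pair a b ∈ 𝔸.F → pair (x + 1) b ∈ G)

/-- `f^x(c)` exists: there is a coded sequence `⟨c, f(c), …, f^x(c)⟩`. -/
def IterExists (x : M) : Prop :=
  ∃ b s : M, Entry b s 0 𝔸.c ∧
    ∀ i : M, i < x → ∃ a a' : M, Entry b s i a ∧ Entry b s (i + 1) a' ∧ pair a a' ∈ 𝔸.F

/-- Truth of an atomic formula.  The variable `vᵢ` denotes the entry with index `i` of the sequence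
coded by `b, s`, and the relation variable with index `X` denotes the relation
`{(a₁, …, a_d) : pair X (a₁, …, a_d) ∈ Z}`. -/
def AtomTrue (Z : Set M) (b s : M) : Atom M → Prop
  | .eq i j => ∃ a : M, Entry b s i a ∧ Entry b s j a
  | .const i => Entry b s i 𝔸.c
  | .fn i j => ∃ a a' : M, Entry b s i a ∧ Entry b s j a' ∧ pair a a' ∈ 𝔸.F
  | .rel X args => ∃ as : List M, List.Forall₂ (Entry b s) args as ∧ pair X (tuple as) ∈ Z

/-- `w` is a true literal. -/
def LiteralTrue (r k : M) (d : ℕ) (Z : Set M) (b s w : M) : Prop :=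
  ∃ (p : Bool) (α : Atom M), α.Fits r k d ∧ IsLiteralOf p α w ∧
    (p = true ↔ 𝔸.AtomTrue Z b s α)

/-- `w` is a clause with a true literal. -/
def ClauseTrue (r k : M) (d : ℕ) (Z : Set M) (b s w : M) : Prop :=
  ∃ u x v : M, Built (IsLiteral r k d) u ∧ 𝔸.LiteralTrue r k d Z b s x ∧
    Built (IsLiteral r k d) v ∧ Concat [nat 9, u, x, v] w

/-- `w` is a conjunction of true clauses. -/
def MatrixTrue (r k : M) (d : ℕ) (Z : Set M) (b s w : M) : Prop :=
  Built (𝔸.ClauseTrue r k d Z b s) w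

/-- The sequence coded by `b', s'` has entries in `A` at all indices `< j`, and it agrees with the
one coded by `b, s` at all indices `< i`. -/
def Extends (b s i b' s' j : M) : Prop :=
  (∀ l : M, l < j → ∃ a ∈ 𝔸.A, Entry b' s' l a) ∧
    ∀ l : M, l < i → ∀ a : M, Entry b s l a → Entry b' s' l a

/-- Truth of a first-order formula in prenex form when its free variables are `v₀, …, v_{i-1}`, with
values given by `b, s`. -/
def FirstOrderTrue (r : M) (d : ℕ) (Z : Set M) (w : M) : List (Bool × M) → M → M → M → Prop
  | [], i, b, s => 𝔸.MatrixTrue r i d Z b s w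
  | (true, k) :: L, i, b, s =>
      ∃ b' s' : M, 𝔸.Extends b s i b' s' (i + k) ∧ FirstOrderTrue r d Z w L (i + k) b' s'
  | (false, k) :: L, i, b, s =>
      ∀ b' s' : M, 𝔸.Extends b s i b' s' (i + k) → FirstOrderTrue r d Z w L (i + k) b' s'

/-- The first-order part of `φ` is true when the relation variables have the values given
by `Z`. -/
def KernelTrue (d : ℕ) (Z : Set M) (φ : Prenex M) : Prop :=
  𝔸.FirstOrderTrue φ.rels d Z φ.matrix φ.blocks 0 0 0

/-- `⟨A, f, c⟩` satisfies the `Σ¹₁ ∧ Π¹₁` sentence with code `ξ`.  Second-order quantifiers range over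
all finite sequences of relations on `A` that exist in `⟨M, 𝒳⟩`. -/
def Sat (n d : ℕ) (ξ : M) : Prop :=
  ∃ σ π : Prenex M, IsConjCode n d σ π ξ ∧
    (∃ Z ∈ 𝒳, 𝔸.KernelTrue d Z σ) ∧ (∀ Z ∈ 𝒳, 𝔸.KernelTrue d Z π)

end Struct

end Coding

/-- The set of natural numbers defined by `Ξ` in the standard model can be recognized by a Turing
machine in time polynomial in the length of the binary expansion. -/
def Delta0.PolyTime (Ξ : Delta0) : Prop :=
  ∃ χ : ℕ → Bool, (∀ k : ℕ, χ k = true ↔ Ξ.Holds k) ∧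
    Nonempty (Turing.TM2ComputableInPolyTime Computability.encodeNat Computability.encodeBool χ)

end RCAStar

/-! For each number `x` of a model, standard or not, let `ψ_x` be the first-order sentence "there
are `v₀, …, v_x` with `v₀ = c` and `f(vᵢ) = vᵢ₊₁` for `i < x`". It says that `f^x(c)` exists. One
more sentence, of standard length, is added. Its `Σ¹₁` part provides a relation `R` on `A` that is
irreflexive, has `c` as least element and `f(b)` as immediate successor of `b` (`orderMatrix`). Its
`Π¹₁` part says: if nothing is `R`-below `c` and the `R`-predecessors of `f(b)` are among `b` and
its predecessors, then no `H` maps `A` injectively into the `R`-predecessors of a single element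
(`boundCases`).

Suppose that all these sentences hold. By the `ψ_x`, the map `g : x ↦ f^x(c)` is total, and its
graph is `Δ⁰₁` because coded iterations are unique. Induction along `R` gives `g i R g x` for `i <
x`, so `g` is injective, and it puts any `a` outside the range above every `g x`. The range is only
`Σ⁰₁` and need not be a set, so the second-order induction axiom would not help here. Instead, the
elements of `A` are themselves numbers, so `x ↦ g x` restricted to `A` injects `A` into the
predecessors of `a`, against the `Π¹₁` part (`Struct.exists_iso`). Conversely, in a copy of the
natural numbers the usual order serves as `R`. Any `R` as in the `Π¹₁` part is contained in that
order, so `H` would map all numbers injectively below some `n`. This contradicts the pigeonhole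
principle, which needs only bounded induction because finite sequences have codes below an
exponential bound (`pigeonhole`, `Struct.IsIso.boundSentence`).

Codes can be nonstandard, so unique readability has to be proved inside the model. Literals and
clauses begin with a symbol that occurs nowhere else in them, and this determines all decompositions
(`Marked.unique`, `Built.of_piece`, `IsConjCode.unique`). For the sentence of standard length,
satisfaction then reduces to truth in the metatheory (`Struct.firstOrderTrue_std`).

The formula may not use exponentiation. Powers of sixteen are defined through divisibility, and the
codes of the `ψ_x` by the local condition that every clause is followed by the correct next one
(`powTwo_iff`, `iterShape_iff`). In the standard model the same codes are accepted by an automaton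
with three counters, which a stack machine simulates in linear time (`CodeAutomaton.accepts_start`,
`CodeAutomaton.reach_answer`).

Throughout, definability by a bounded formula with parameters is a class on predicates, so the side
conditions of induction and comprehension are found by instance search. Witnesses in induction
hypotheses carry explicit bounds for this reason. -/

namespace RCAStar

/-! ## Models as a class -/

/-- A model of RCA*_0, bundled with its family of sets. -/
class Model (M : Type u) extends Arith M where
  sets : Set (Set M)
  isModel : IsModel M sets

/-! ## Renaming of variables -/

/-- Renaming of number variables in a term. -/
def Trm.rename {n n' : ℕ} (g : Fin n → Fin n') : Trm n → Trm n'
  | .var i => .var (g i)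
  | .zero => .zero
  | .one => .one
  | .add s t => .add (s.rename g) (t.rename g)
  | .mul s t => .mul (s.rename g) (t.rename g)
  | .exp s t => .exp (s.rename g) (t.rename g)

theorem Trm.val_rename {M : Type u} [Arith M] {n n' : ℕ} (g : Fin n → Fin n') (t : Trm n)
    (e : Fin n' → M) : (t.rename g).val e = t.val (e ∘ g) := by
  induction t <;> simp_all [Trm.rename, Trm.val]

/-- A renaming of number variables, extended by a new variable `0`. -/
def liftVar {n n' : ℕ} (g : Fin n → Fin n') : Fin (n + 1) → Fin (n' + 1) :=
  Fin.cons 0 (fun i => (g i).succ)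

/-- Renaming of set and number variables in a bounded formula. -/
def Bdd.rename {m m' : ℕ} (f : Fin m → Fin m') :
    {n n' : ℕ} → (Fin n → Fin n') → Bdd m n → Bdd m' n'
  | _, _, g, .eq s t => .eq (s.rename g) (t.rename g)
  | _, _, g, .lt s t => .lt (s.rename g) (t.rename g)
  | _, _, g, .mem t X => .mem (t.rename g) (f X)
  | _, _, g, .not φ => .not (φ.rename f g)
  | _, _, g, .and φ ψ => .and (φ.rename f g) (ψ.rename f g)
  | _, _, g, .ball t φ => .ball (t.rename g) (φ.rename f (liftVar g))

theorem cons_comp_liftVar {α : Type*} {n n' : ℕ} (g : Fin n → Fin n') (a : α) (e : Fin n' → α) :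
    (Fin.cons a e : Fin (n' + 1) → α) ∘ liftVar g = (Fin.cons a (e ∘ g) : Fin (n + 1) → α) := by
  funext i
  refine Fin.cases ?_ (fun i => ?_) i <;> simp [liftVar]

theorem Bdd.holds_rename {M : Type u} [Arith M] {m m' : ℕ} (f : Fin m → Fin m')
    (S : Fin m' → Set M) {n : ℕ} (φ : Bdd m n) : ∀ {n' : ℕ} (g : Fin n → Fin n') (e : Fin n' → M),
    (φ.rename f g).Holds S e ↔ φ.Holds (S ∘ f) (e ∘ g) := by
  induction φ with
  | eq s t => intros; simp [Bdd.rename, Bdd.Holds, Trm.val_rename]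
  | lt s t => intros; simp [Bdd.rename, Bdd.Holds, Trm.val_rename]
  | mem t X => intros; simp [Bdd.rename, Bdd.Holds, Trm.val_rename]
  | not φ ih => intros; simp [Bdd.rename, Bdd.Holds, ih]
  | and φ ψ ih₁ ih₂ => intros; simp [Bdd.rename, Bdd.Holds, ih₁, ih₂]
  | ball t φ ih => intros; simp [Bdd.rename, Bdd.Holds, ih, Trm.val_rename, cons_comp_liftVar]

/-! ## Definability by bounded formulas with parameters -/

variable {M : Type u} [Model M]

/-- The set `X` belongs to the model. -/
class IsSet (X : Set M) : Prop where
  mem : X ∈ Model.sets (M := M)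

/-- The function is the value of a term with parameters. -/
class IsTerm {n : ℕ} (t : (Fin n → M) → M) : Prop where
  out : ∃ (k : ℕ) (τ : Trm k) (v : Fin k → Fin n ⊕ M), ∀ e, τ.val (Sum.elim e id ∘ v) = t e

/-- The predicate is defined by a bounded formula with parameters. -/
class IsBdd {n : ℕ} (P : (Fin n → M) → Prop) : Prop where
  out : ∃ (m k : ℕ) (φ : Bdd m k) (S : Fin m → Set M) (v : Fin k → Fin n ⊕ M),
    (∀ i, IsSet (S i)) ∧ ∀ e, φ.Holds S (Sum.elim e id ∘ v) ↔ P e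

/-! ### Closure properties of functions given by terms -/

section Terms

variable {n : ℕ}

instance IsTerm.var (i : Fin n) : IsTerm (fun e : Fin n → M => e i) :=
  ⟨1, .var 0, fun _ => .inl i, fun _ => rfl⟩

instance IsTerm.const (c : M) : IsTerm (fun _ : Fin n → M => c) :=
  ⟨1, .var 0, fun _ => .inr c, fun _ => rfl⟩

/-- The two terms come with separate lists of variables and parameters. The lists are put side by
side by renaming, so `op` has to be evaluated over one common list only. -/
theorem IsTerm.binary (op : ∀ {k}, Trm k → Trm k → Trm k)
    (s t : (Fin n → M) → M)
    [hs : IsTerm s] [ht : IsTerm t] (r : (Fin n → M) → M)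
    (h : ∀ {k} (σ τ : Trm k) (v : Fin k → Fin n ⊕ M),
      (∀ e, σ.val (Sum.elim e id ∘ v) = s e) → (∀ e, τ.val (Sum.elim e id ∘ v) = t e) →
        ∀ e, (op σ τ).val (Sum.elim e id ∘ v) = r e) : IsTerm r := by
  obtain ⟨k, σ, v, hs⟩ := hs
  obtain ⟨l, τ, w, ht⟩ := ht
  refine ⟨k + l, op (σ.rename (Fin.castAdd l)) (τ.rename (Fin.natAdd k)), Fin.append v w, ?_⟩
  refine h _ _ _ (fun e => ?_) (fun e => ?_)
  · rw [Trm.val_rename, ← hs e]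
    congr 1; funext i; simp
  · rw [Trm.val_rename, ← ht e]
    congr 1; funext i; simp

instance IsTerm.add (s t : (Fin n → M) → M) [IsTerm s] [IsTerm t] :
    IsTerm (fun e => s e + t e) :=
  IsTerm.binary .add s t _ (fun σ τ v hs ht e => by simp [Trm.val, hs, ht])

instance IsTerm.mul (s t : (Fin n → M) → M) [IsTerm s] [IsTerm t] :
    IsTerm (fun e => s e * t e) :=
  IsTerm.binary .mul s t _ (fun σ τ v hs ht e => by simp [Trm.val, hs, ht])

instance IsTerm.exp (s t : (Fin n → M) → M) [IsTerm s] [IsTerm t] :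
    IsTerm (fun e => s e ^ t e) :=
  IsTerm.binary .exp s t _ (fun σ τ v hs ht e => by simp [Trm.val, hs, ht])

end Terms

/-! ### Closure properties of bounded definability -/

section Formulas

variable {n : ℕ}

theorem IsTerm.lift_pair (s t : (Fin n → M) → M) [hs : IsTerm s] [ht : IsTerm t] :
    ∃ (k : ℕ) (σ τ : Trm k) (v : Fin k → Fin n ⊕ M),
      (∀ e, σ.val (Sum.elim e id ∘ v) = s e) ∧ ∀ e, τ.val (Sum.elim e id ∘ v) = t e := by
  obtain ⟨k, σ, v, hs⟩ := hs
  obtain ⟨l, τ, w, ht⟩ := ht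
  refine ⟨k + l, σ.rename (Fin.castAdd l), τ.rename (Fin.natAdd k), Fin.append v w,
    fun e => ?_, fun e => ?_⟩
  · rw [Trm.val_rename, ← hs e]
    congr 1; funext i; simp
  · rw [Trm.val_rename, ← ht e]
    congr 1; funext i; simp

/-- The lemmas for genuine terms are instances only locally. Later `IsBdd.eq`, `IsBdd.lt`,
`IsBdd.mem` and `IsBdd.ball` subsume them for all functions with a bounded graph. -/
theorem IsBdd.eq_term (s t : (Fin n → M) → M) [IsTerm s] [IsTerm t] :
    IsBdd (fun e => s e = t e) := by
  obtain ⟨k, σ, τ, v, hs, ht⟩ := IsTerm.lift_pair s t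
  exact ⟨0, k, .eq σ τ, fun _ => ∅, v, fun i => i.elim0, fun e => by simp [Bdd.Holds, hs, ht]⟩

theorem IsBdd.lt_term (s t : (Fin n → M) → M) [IsTerm s] [IsTerm t] :
    IsBdd (fun e => s e < t e) := by
  obtain ⟨k, σ, τ, v, hs, ht⟩ := IsTerm.lift_pair s t
  exact ⟨0, k, .lt σ τ, fun _ => ∅, v, fun i => i.elim0, fun e => by simp [Bdd.Holds, hs, ht]⟩

theorem IsBdd.mem_term (t : (Fin n → M) → M) (X : Set M) [ht : IsTerm t] [hX : IsSet X] :
    IsBdd (fun e => t e ∈ X) := by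
  obtain ⟨k, τ, v, ht⟩ := ht
  exact ⟨1, k, .mem τ 0, fun _ => X, v, fun _ => hX, fun e => by simp [Bdd.Holds, ht]⟩

instance IsBdd.not (P : (Fin n → M) → Prop) [hP : IsBdd P] : IsBdd (fun e => ¬ P e) := by
  obtain ⟨m, k, φ, S, v, hS, h⟩ := hP
  exact ⟨m, k, .not φ, S, v, hS, fun e => by simp [Bdd.Holds, h]⟩

instance IsBdd.and (P Q : (Fin n → M) → Prop) [hP : IsBdd P] [hQ : IsBdd Q] :
    IsBdd (fun e => P e ∧ Q e) := by
  obtain ⟨m, k, φ, S, v, hS, h⟩ := hP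
  obtain ⟨m', k', ψ, S', v', hS', h'⟩ := hQ
  refine ⟨m + m', k + k', .and (φ.rename (Fin.castAdd m') (Fin.castAdd k'))
    (ψ.rename (Fin.natAdd m) (Fin.natAdd k)), Fin.append S S', Fin.append v v', fun i => ?_,
    fun e => ?_⟩
  · refine Fin.addCases (fun i => ?_) (fun i => ?_) i <;> simp [hS, hS']
  · simp only [Bdd.Holds, Bdd.holds_rename, ← h, ← h']
    have h1 : Fin.append S S' ∘ Fin.castAdd m' = S := by funext i; simp
    have h2 : Fin.append S S' ∘ Fin.natAdd m = S' := by funext i; simp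
    have h3 : (Sum.elim e id ∘ Fin.append v v') ∘ Fin.castAdd k' = Sum.elim e id ∘ v := by
      funext i; simp
    have h4 : (Sum.elim e id ∘ Fin.append v v') ∘ Fin.natAdd k = Sum.elim e id ∘ v' := by
      funext i; simp
    rw [h1, h2, h3, h4]

theorem IsBdd.congr {P Q : (Fin n → M) → Prop} (hP : IsBdd P) (h : ∀ e, Q e ↔ P e) :
    IsBdd Q := by
  have : Q = P := funext fun e => propext (h e)
  exact this ▸ hP

instance IsBdd.or (P Q : (Fin n → M) → Prop) [hP : IsBdd P] [hQ : IsBdd Q] :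
    IsBdd (fun e => P e ∨ Q e) :=
  IsBdd.congr (inferInstance : IsBdd fun e => ¬ (¬ P e ∧ ¬ Q e)) (fun e => by tauto)

instance IsBdd.imp (P Q : (Fin n → M) → Prop) [hP : IsBdd P] [hQ : IsBdd Q] :
    IsBdd (fun e => P e → Q e) :=
  IsBdd.congr (inferInstance : IsBdd fun e => ¬ P e ∨ Q e) (fun e => by tauto)

theorem IsBdd.rename {k : ℕ} (P : (Fin k → M) → Prop) [hP : IsBdd P] (w : Fin k → Fin n ⊕ M) :
    IsBdd (fun e : Fin n → M => P (Sum.elim e id ∘ w)) := by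
  obtain ⟨m, l, φ, S, v, hS, h⟩ := hP
  refine ⟨m, l, φ, S, fun i => Sum.elim w .inr (v i), hS, fun e => ?_⟩
  rw [← h]
  apply iff_of_eq; congr 1; funext i
  simp only [Function.comp]
  rcases v i with j | c <;> simp

-- The variables of `φ` that stand for the quantified variable may occur several times in the list
-- `v`. All of them are identified with the new variable `0`, and the remaining ones stay free or
-- are parameters.
open Classical in
theorem IsBdd.ball_term (t : (Fin n → M) → M) (P : (Fin n → M) → M → Prop) [ht : IsTerm t]
    [hP : IsBdd (fun e : Fin (n + 1) → M => P (fun i => e i.succ) (e 0))] :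
    IsBdd (fun e => ∀ a, a < t e → P e a) := by
  obtain ⟨l, τ, w, ht⟩ := ht
  obtain ⟨m, k, φ, S, v, hS, h⟩ := hP
  -- A dummy value for the slots of the quantified variable. It is never read, since `g` sends these
  -- slots to variable `0`.
  let z : M := 0
  let g : Fin k → Fin (l + k + 1) := fun i =>
    if v i = .inl 0 then 0 else (Fin.natAdd l i).succ
  let v' : Fin k → Fin n ⊕ M := fun i =>
    Sum.elim (fun j => Fin.cases (motive := fun _ => Fin n ⊕ M) (.inr z) .inl j) .inr (v i)
  refine ⟨m, l + k, .ball (τ.rename (Fin.castAdd k)) (φ.rename id g), S, Fin.append w v', hS,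
    fun e => ?_⟩
  simp only [Bdd.Holds, Trm.val_rename, Bdd.holds_rename]
  have h1 : (Sum.elim e id ∘ Fin.append w v') ∘ Fin.castAdd k = Sum.elim e id ∘ w := by
    funext i; simp
  rw [h1, ht]
  refine forall_congr' fun a => imp_congr_right fun _ => ?_
  have := h (Fin.cons a e)
  simp only [Fin.cons_succ, Fin.cons_zero] at this
  rw [← this]
  apply iff_of_eq; congr 1; funext i
  simp only [Function.comp, g]
  split_ifs with hv
  · simp [hv]
  · simp only [Fin.cons_succ, v']
    rcases hvi : v i with j | c
    · refine Fin.cases (fun hvi => absurd hvi hv) (fun j hvi => ?_) j hvi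
      simp [hvi]
    · simp [hvi]

end Formulas

/-! ## Induction and comprehension -/

/-- The induction axiom in semantic form. All slots of the defining formula that refer to the
variable are merged into one, and the other slots become number parameters. -/
theorem induct {P : M → Prop} [hP : IsBdd (fun e : Fin 1 → M => P (e 0))] (h0 : P 0)
    (hs : ∀ x, P x → P (x + 1)) (x : M) : P x := by
  obtain ⟨m, k, φ, S, v, hS, h⟩ := hP
  let g : Fin k → Fin (k + 1) := fun i => Sum.elim (fun _ => 0) (fun _ => i.succ) (v i)
  let p : Fin k → M := fun i => Sum.elim (fun _ => 0) id (v i)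
  have key : ∀ x : M, (φ.rename id g).Holds S (Fin.cons x p) ↔ P x := fun x => by
    rw [Bdd.holds_rename, ← h (fun _ => x)]
    apply iff_of_eq; congr 1; funext i
    simp only [Function.comp, g]
    rcases hv : v i with j | c <;> simp [p, hv]
  have := (Model.isModel (M := M)).induction m k (φ.rename id g) S p (fun i => (hS i).mem)
    ((key 0).2 h0) (fun x hx => (key _).2 (hs x ((key x).1 hx)))
  exact (key x).1 (this x)

theorem IsBdd.exists_formula {P : M → M → Prop}
    (hP : IsBdd (fun e : Fin 2 → M => P (e 1) (e 0))) :
    ∃ (m k : ℕ) (φ : Bdd m (k + 2)) (S : Fin m → Set M) (p : Fin k → M), (∀ i, S i ∈ Model.sets) ∧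
      ∀ x y, φ.Holds S (Fin.cons y (Fin.cons x p)) ↔ P x y := by
  obtain ⟨m, k, φ, S, v, hS, h⟩ := hP
  let g : Fin k → Fin (k + 2) := fun i =>
    Sum.elim (fun j => if j = 0 then 0 else 1) (fun _ => i.succ.succ) (v i)
  let p : Fin k → M := fun i => Sum.elim (fun _ => 0) id (v i)
  refine ⟨m, k, φ.rename id g, S, p, fun i => (hS i).mem, fun x y => ?_⟩
  rw [Bdd.holds_rename, show P x y ↔ _ from (h ![y, x]).symm]
  apply iff_of_eq; congr 1; funext i
  simp only [Function.comp, g]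
  rcases hv : v i with j | c
  · fin_cases j
    · simp
    · simp only [Sum.elim_inl]; rfl
  · simp [p, hv]

/-- The two descriptions may use different set and number parameters. The axiom wants one common
list, which is obtained by appending the lists and renaming both formulas. -/
theorem isSet_of_delta {P : M → Prop} (φ ψ : M → M → Prop)
    [hφ : IsBdd (fun e : Fin 2 → M => φ (e 1) (e 0))]
    [hψ : IsBdd (fun e : Fin 2 → M => ψ (e 1) (e 0))]
    (h1 : ∀ x, P x ↔ ∃ y, φ x y) (h2 : ∀ x, P x ↔ ∀ y, ψ x y) : IsSet {x | P x} := by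
  obtain ⟨m, k, φ', S, p, hS, h⟩ := hφ.exists_formula
  obtain ⟨m', k', ψ', S', p', hS', h'⟩ := hψ.exists_formula
  let gk : Fin (k + 2) → Fin (k + k' + 2) := liftVar (liftVar (Fin.castAdd k'))
  let gk' : Fin (k' + 2) → Fin (k + k' + 2) := liftVar (liftVar (Fin.natAdd k))
  have a1 : ∀ x y : M, (φ'.rename (Fin.castAdd m') gk).Holds (Fin.append S S')
      (Fin.cons y (Fin.cons x (Fin.append p p'))) ↔ φ x y := fun x y => by
    rw [Bdd.holds_rename, ← h]
    apply iff_of_eq; congr 1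
    · funext i; simp
    · simp only [gk, cons_comp_liftVar]; congr 2; funext i; simp
  have a2 : ∀ x y : M, (ψ'.rename (Fin.natAdd m) gk').Holds (Fin.append S S')
      (Fin.cons y (Fin.cons x (Fin.append p p'))) ↔ ψ x y := fun x y => by
    rw [Bdd.holds_rename, ← h']
    apply iff_of_eq; congr 1
    · funext i; simp
    · simp only [gk', cons_comp_liftVar]; congr 2; funext i; simp
  have := (Model.isModel (M := M)).comprehension (m + m') (k + k')
    (φ'.rename (Fin.castAdd m') gk) (ψ'.rename (Fin.natAdd m) gk') (Fin.append S S')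
    (Fin.append p p')
    (fun i => by refine Fin.addCases (fun i => ?_) (fun i => ?_) i <;> simp [hS, hS'])
    (fun x => by simp only [a1, a2, ← h1, ← h2])
  refine ⟨?_⟩
  simpa only [a1, ← h1] using this

theorem isSet_of_bdd {P : M → Prop} [hP : IsBdd (fun e : Fin 1 → M => P (e 0))] :
    IsSet {x | P x} := by
  have : IsBdd (fun e : Fin 2 → M => P (e 1)) :=
    IsBdd.rename (fun e : Fin 1 → M => P (e 0)) (fun _ => .inl 1)
  exact isSet_of_delta (fun x _ => P x) (fun x _ => P x) (fun x => ⟨fun h => ⟨0, h⟩, fun ⟨_, h⟩ => h⟩)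
    (fun x => ⟨fun h _ => h, fun h => h 0⟩)

end RCAStar

namespace RCAStar

variable {M : Type u} [Model M]

/-! ## Addition, multiplication and order -/

namespace Basic

attribute [local instance] IsBdd.eq_term IsBdd.lt_term IsBdd.ball_term

instance bex_term {n : ℕ} (t : (Fin n → M) → M) (P : (Fin n → M) → M → Prop) [IsTerm t]
    [hP : IsBdd (fun e : Fin (n + 1) → M => P (fun i => e i.succ) (e 0))] :
    IsBdd (fun e => ∃ a, a < t e ∧ P e a) :=
  IsBdd.congr (inferInstance : IsBdd fun e => ¬ ∀ a, a < t e → ¬ P e a) (fun e => by push Not; rfl)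

variable (x y : M)

theorem add_zero : x + 0 = x := Model.isModel.add_zero x
theorem add_succ : x + (y + 1) = (x + y) + 1 := Model.isModel.add_succ x y
theorem mul_zero : x * 0 = 0 := Model.isModel.mul_zero x
theorem mul_succ : x * (y + 1) = x * y + x := Model.isModel.mul_succ x y
theorem not_lt_zero : ¬ x < 0 := Model.isModel.not_lt_zero x
theorem lt_succ : x < y + 1 ↔ x < y ∨ x = y := Model.isModel.lt_succ x y

theorem zero_add : 0 + x = x :=
  induct (P := fun x : M => 0 + x = x) (add_zero _) (fun x hx => by rw [add_succ, hx]) x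

theorem succ_add : (x + 1) + y = (x + y) + 1 :=
  induct (P := fun y : M => (x + 1) + y = (x + y) + 1) (by simp only [add_zero])
    (fun y hy => by rw [add_succ, hy, add_succ]) y

theorem add_comm : x + y = y + x :=
  induct (P := fun y : M => x + y = y + x) (by rw [add_zero, zero_add])
    (fun y hy => by rw [add_succ, hy, succ_add]) y

theorem add_assoc (z : M) : x + y + z = x + (y + z) :=
  induct (P := fun z : M => x + y + z = x + (y + z)) (by simp only [add_zero])
    (fun z hz => by simp only [add_succ, hz]) z

theorem zero_mul : 0 * x = 0 :=
  induct (P := fun x : M => 0 * x = 0) (mul_zero _) (fun x hx => by rw [mul_succ, hx, add_zero]) x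

theorem mul_one : x * 1 = x := by
  rw [← zero_add 1, mul_succ, mul_zero, zero_add]

theorem mul_add (z : M) : x * (y + z) = x * y + x * z :=
  induct (P := fun z : M => x * (y + z) = x * y + x * z) (by simp only [add_zero, mul_zero])
    (fun z hz => by rw [add_succ, mul_succ, hz, mul_succ, add_assoc]) z

theorem succ_mul : (x + 1) * y = x * y + y :=
  induct (P := fun y : M => (x + 1) * y = x * y + y) (by simp only [add_zero, mul_zero])
    (fun y hy => by
      rw [mul_succ, hy, mul_succ, add_assoc, add_assoc, add_succ y, add_succ x, add_comm y x]) y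

theorem mul_comm : x * y = y * x :=
  induct (P := fun y : M => x * y = y * x) (by rw [mul_zero, zero_mul])
    (fun y hy => by rw [mul_succ, hy, succ_mul]) y

theorem mul_assoc (z : M) : x * y * z = x * (y * z) :=
  induct (P := fun z : M => x * y * z = x * (y * z)) (by simp only [mul_zero])
    (fun z hz => by rw [mul_succ, hz, mul_succ, mul_add]) z

theorem lt_trans {x y z : M} (h : x < y) (h' : y < z) : x < z :=
  induct (P := fun z : M => y < z → x < z) (fun h => (not_lt_zero _ h).elim)
    (fun _ ih hz => (lt_succ _ _).2 (.inl (((lt_succ _ _).1 hz).elim ih (fun e => e ▸ h)))) z h'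

theorem lt_add_one : x < x + 1 := (lt_succ _ _).2 (.inr rfl)

theorem add_one_lt {x y : M} (h : x < y) : x + 1 < y + 1 :=
  induct (P := fun y : M => x < y → x + 1 < y + 1) (fun h => (not_lt_zero _ h).elim)
    (fun y ih hy => by
      rcases (lt_succ _ _).1 hy with hy | rfl
      · exact (lt_succ _ _).2 (.inl (ih hy))
      · exact lt_add_one _) y h

theorem zero_lt_succ : 0 < x + 1 :=
  induct (P := fun x : M => 0 < x + 1) ((lt_succ _ _).2 (.inr rfl))
    (fun _ hx => (lt_succ _ _).2 (.inl hx)) x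

theorem lt_add_succ (x z : M) : x < x + (z + 1) := by
  exact induct (P := fun z : M => x < x + (z + 1)) (by rw [add_succ, add_zero]; exact lt_add_one _)
    (fun z hz => by rw [add_succ]; exact (lt_succ _ _).2 (.inl hz)) z

theorem exists_of_lt {x y : M} (h : x < y) : ∃ z, y = x + (z + 1) := by
  -- The conjunct `z < y` only serves to keep the induction formula bounded.
  have := induct (P := fun y : M => x < y → ∃ z, z < y ∧ y = x + (z + 1))
    (fun h => (not_lt_zero _ h).elim) (fun y ih hy => by
      rcases (lt_succ _ _).1 hy with hy | rfl
      · obtain ⟨z, hz, e⟩ := ih hy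
        exact ⟨z + 1, add_one_lt hz, by rw [add_succ x, ← e]⟩
      · exact ⟨0, zero_lt_succ _, by rw [add_succ, add_zero]⟩) y h
  obtain ⟨z, -, e⟩ := this
  exact ⟨z, e⟩

theorem lt_irrefl : ¬ x < x :=
  induct (P := fun x : M => ¬ x < x) (not_lt_zero _) (fun x hx h => by
    rcases (lt_succ _ _).1 h with h | h
    · exact hx (lt_trans (lt_add_one _) h)
    · have := lt_add_one x
      rw [h] at this
      exact hx this) x

theorem trichotomy : x < y ∨ x = y ∨ y < x :=
  induct (P := fun y : M => x < y ∨ x = y ∨ y < x)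
    (induct (P := fun x : M => x < 0 ∨ x = 0 ∨ 0 < x) (.inr (.inl rfl))
      (fun x _ => .inr (.inr (zero_lt_succ _))) x)
    (fun y hy => by
      rcases hy with h | rfl | h
      · exact .inl ((lt_succ _ _).2 (.inl h))
      · exact .inl (lt_add_one _)
      · obtain ⟨z, rfl⟩ := exists_of_lt h
        have : z = 0 ∨ ∃ w, z = w + 1 := by
          have := induct (P := fun z : M => z = 0 ∨ ∃ w, w < z ∧ z = w + 1) (.inl rfl)
            (fun z _ => .inr ⟨z, lt_add_one _, rfl⟩) z
          exact this.imp id (fun ⟨w, _, e⟩ => ⟨w, e⟩)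
        rcases this with rfl | ⟨w, rfl⟩
        · exact .inr (.inl (congrArg (y + ·) (zero_add 1)))
        · refine .inr (.inr ?_)
          rw [add_succ y (w + 1), ← succ_add]
          exact lt_add_succ _ _) y

end Basic

/-- With `x ≤ y` defined as `x < y + 1`, weak inequalities unfold to atomic formulas, and
quantifiers bounded by `≤` are special cases of those bounded by `<`. -/
noncomputable instance : LinearOrder M where
  __ := (Arith.toLT : LT M)
  le x y := x < y + 1
  le_refl x := Basic.lt_add_one x
  le_trans x y z h h' := by
    rcases (Basic.lt_succ _ _).1 h with h | rfl
    · exact Basic.lt_trans h h'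
    · exact h'
  lt_iff_le_not_ge x y := by
    constructor
    · intro h
      refine ⟨(Basic.lt_succ _ _).2 (.inl h), fun h' => ?_⟩
      rcases (Basic.lt_succ _ _).1 h' with h' | rfl
      · exact Basic.lt_irrefl _ (Basic.lt_trans h h')
      · exact Basic.lt_irrefl _ h
    · rintro ⟨h, h'⟩
      rcases (Basic.lt_succ _ _).1 h with h | rfl
      · exact h
      · exact (h' (Basic.lt_add_one _)).elim
  le_antisymm x y h h' := by
    rcases (Basic.lt_succ _ _).1 h with h | rfl
    · rcases (Basic.lt_succ _ _).1 h' with h' | rfl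
      · exact (Basic.lt_irrefl _ (Basic.lt_trans h h')).elim
      · rfl
    · rfl
  le_total x y := by
    rcases Basic.trichotomy x y with h | rfl | h
    · exact .inl ((Basic.lt_succ _ _).2 (.inl h))
    · exact .inl (Basic.lt_add_one _)
    · exact .inr ((Basic.lt_succ _ _).2 (.inl h))
  toDecidableLE := Classical.decRel _

/-- The monoid power with exponent in `ℕ` is kept apart from the exponentiation of the model, whose
exponents lie in `M`. -/
noncomputable instance : CommSemiring M where
  __ := (Arith.toAdd : Add M)
  __ := (Arith.toMul : Mul M)
  __ := (Arith.toZero : Zero M)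
  __ := (Arith.toOne : One M)
  add_assoc := Basic.add_assoc
  zero_add := Basic.zero_add
  add_zero := Basic.add_zero
  add_comm := Basic.add_comm
  mul_assoc := Basic.mul_assoc
  one_mul x := by rw [Basic.mul_comm]; exact Basic.mul_one x
  mul_one := Basic.mul_one
  zero_mul := Basic.zero_mul
  mul_zero := Basic.mul_zero
  mul_comm := Basic.mul_comm
  left_distrib := Basic.mul_add
  right_distrib x y z := by
    rw [Basic.mul_comm, Basic.mul_add, Basic.mul_comm z x, Basic.mul_comm z y]
  nsmul := nsmulRec
  npow := npowRec

theorem lt_iff_exists_add_one {x y : M} : x < y ↔ ∃ z, y = x + (z + 1) :=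
  ⟨Basic.exists_of_lt, fun ⟨_, h⟩ => h ▸ Basic.lt_add_succ _ _⟩

theorem lt_add_one_iff' {x y : M} : x < y + 1 ↔ x ≤ y := Iff.rfl

theorem exists_add_of_le' {x y : M} (h : x ≤ y) : ∃ z, y = x + z := by
  rcases (Basic.lt_succ _ _).1 h with h | rfl
  · obtain ⟨z, h⟩ := lt_iff_exists_add_one.1 h
    exact ⟨_, h⟩
  · exact ⟨0, (add_zero _).symm⟩

theorem le_add_self' (x z : M) : x ≤ x + z := by
  change x < x + z + 1
  rw [add_assoc]
  exact Basic.lt_add_succ _ _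

instance : CanonicallyOrderedAdd M where
  exists_add_of_le := exists_add_of_le'
  le_self_add := le_add_self'
  le_add_self x y := by rw [add_comm]; exact le_add_self' x y

instance : IsOrderedCancelAddMonoid M where
  add_le_add_left x y h z := by
    obtain ⟨w, rfl⟩ := exists_add_of_le' h
    rw [add_right_comm]
    exact le_add_self' _ _
  le_of_add_le_add_left x y z h := by
    by_contra hlt
    obtain ⟨w, rfl⟩ := lt_iff_exists_add_one.1 (not_le.1 hlt)
    rw [← add_assoc] at h
    exact absurd (lt_iff_exists_add_one.2 ⟨w, rfl⟩) (not_lt.2 h)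

instance : IsStrictOrderedRing M where
  zero_le_one := by simp
  exists_pair_ne := ⟨0, 1, fun h => Model.isModel.add_one_ne_zero (0 : M) (by rw [zero_add, ← h])⟩
  mul_lt_mul_of_pos_left x hx y z h := by
    obtain ⟨w, rfl⟩ := lt_iff_exists_add_one.1 h
    obtain ⟨v, rfl⟩ := lt_iff_exists_add_one.1 hx
    rw [lt_iff_exists_add_one]
    exact ⟨v * w + w + v, by ring⟩
  mul_lt_mul_of_pos_right x hx y z h := by
    obtain ⟨w, rfl⟩ := lt_iff_exists_add_one.1 h
    obtain ⟨v, rfl⟩ := lt_iff_exists_add_one.1 hx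
    rw [lt_iff_exists_add_one]
    exact ⟨v * w + w + v, by ring⟩

noncomputable instance : SuccOrder M :=
  SuccOrder.ofSuccLeIff (· + 1) (fun {x y} => by
    rw [lt_iff_exists_add_one, le_iff_exists_add]
    refine exists_congr fun z => ?_
    rw [add_assoc, add_comm 1 z])

noncomputable instance : SuccAddOrder M := ⟨fun _ => rfl⟩

theorem one_le_of_pos {x : M} (h : 0 < x) : 1 ≤ x := Order.one_le_iff_pos.2 h

end RCAStar

namespace RCAStar

variable {M : Type u} [Model M]

/-! ## Exponentiation -/

section Exp

attribute [local instance] IsBdd.eq_term IsBdd.lt_term IsBdd.ball_term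

variable (x y z : M)

theorem exp_zero : x ^ (0 : M) = 1 := Model.isModel.exp_zero x
theorem exp_succ : x ^ (y + 1) = x ^ y * x := Model.isModel.exp_succ x y

theorem exp_one : x ^ (1 : M) = x := by
  rw [← zero_add (1 : M), exp_succ, exp_zero, one_mul]

theorem exp_add : x ^ (y + z) = x ^ y * x ^ z :=
  induct (P := fun z : M => x ^ (y + z) = x ^ y * x ^ z) (by rw [add_zero, exp_zero, mul_one])
    (fun z hz => by rw [← add_assoc, exp_succ, hz, exp_succ, mul_assoc]) z

theorem mul_exp : (x * y) ^ z = x ^ z * y ^ z :=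
  induct (P := fun z : M => (x * y) ^ z = x ^ z * y ^ z) (by simp only [exp_zero, mul_one])
    (fun z hz => by simp only [exp_succ, hz]; ring) z

variable {x y z}

theorem exp_pos (h : 0 < x) : 0 < x ^ y :=
  induct (P := fun y : M => 0 < x ^ y) (by rw [exp_zero]; exact zero_lt_one)
    (fun y hy => by rw [exp_succ]; exact mul_pos hy h) y

theorem exp_le_exp (h : 0 < x) (hyz : y ≤ z) : x ^ y ≤ x ^ z := by
  obtain ⟨w, rfl⟩ := exists_add_of_le' hyz
  rw [exp_add]
  exact le_mul_of_one_le_right' (one_le_of_pos (exp_pos h))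

theorem exp_lt_exp (h : 1 < x) (hyz : y < z) : x ^ y < x ^ z := by
  refine lt_of_lt_of_le ?_ (exp_le_exp (zero_lt_one.trans h) (Order.add_one_le_of_lt hyz))
  rw [exp_succ]
  exact lt_mul_of_one_lt_right (exp_pos (zero_lt_one.trans h)) h

theorem exp_lt_exp_iff (h : 1 < x) : x ^ y < x ^ z ↔ y < z :=
  ⟨fun h' => not_le.1 fun hle => absurd h' (not_lt.2 (exp_le_exp (zero_lt_one.trans h) hle)),
    exp_lt_exp h⟩

theorem exp_le_exp_iff (h : 1 < x) : x ^ y ≤ x ^ z ↔ y ≤ z := by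
  rw [← not_lt, exp_lt_exp_iff h, not_lt]

theorem exp_inj (h : 1 < x) : x ^ y = x ^ z ↔ y = z := by
  rw [le_antisymm_iff, exp_le_exp_iff h, exp_le_exp_iff h, ← le_antisymm_iff]

theorem exp_le_exp_left (h : x ≤ y) : x ^ z ≤ y ^ z :=
  induct (P := fun z : M => x ^ z < y ^ z + 1) (by simp [exp_zero])
    (fun z hz => by
      rw [lt_add_one_iff'] at hz ⊢
      rw [exp_succ, exp_succ]
      exact mul_le_mul' hz h) z

theorem lt_exp_self (h : 1 < x) (y : M) : y < x ^ y :=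
  induct (P := fun y : M => y < x ^ y) (by simp [exp_zero]) (fun y hy => by
    refine lt_of_le_of_lt (Order.add_one_le_of_lt hy) (exp_lt_exp h ?_)
    exact lt_add_one _) y

end Exp

/-! ## Bounded definable functions -/

/-- The function is defined by a bounded formula and dominated by a term. -/
class IsFn {n : ℕ} (t : (Fin n → M) → M) : Prop where
  graph : IsBdd (fun e : Fin (n + 1) → M => e 0 = t (fun i => e i.succ))
  bound : ∃ b : (Fin n → M) → M, IsTerm b ∧ ∀ e, t e ≤ b e

section IsFn

variable {n : ℕ}

theorem IsTerm.weaken (t : (Fin n → M) → M) [ht : IsTerm t] :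
    IsTerm (fun e : Fin (n + 1) → M => t (fun i => e i.succ)) := by
  obtain ⟨k, τ, v, h⟩ := ht
  refine ⟨k, τ, fun i => (v i).map Fin.succ id, fun e => ?_⟩
  rw [← h]
  congr 1; funext i
  simp only [Function.comp]
  rcases v i with j | c <;> simp

instance (priority := 100) IsFn.of_term (t : (Fin n → M) → M) [ht : IsTerm t] : IsFn t :=
  have := ht.weaken
  ⟨IsBdd.eq_term (fun e : Fin (n + 1) → M => e 0) (fun e : Fin (n + 1) → M => t (fun i => e i.succ)),
    t, ht, fun _ => le_rfl⟩

theorem IsFn.weaken (t : (Fin n → M) → M) [ht : IsFn t] :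
    IsFn (fun e : Fin (n + 1) → M => t (fun i => e i.succ)) := by
  obtain ⟨h, b, hb, hle⟩ := ht
  refine ⟨?_, _, hb.weaken, fun e => hle _⟩
  refine (IsBdd.rename (n := n + 2) _ (hP := h) (Fin.cons (.inl 0) fun i => .inl i.succ.succ)).congr
    fun e => ?_
  rfl

/-- The function `t` has no term, only a bounded graph. So `Q (t e)` is expressed by quantifying
over the value of `t`, and the dominating term bounds that quantifier. -/
theorem IsBdd.subst (Q : M → (Fin n → M) → Prop) (t : (Fin n → M) → M) [ht : IsFn t]
    [hQ : IsBdd (fun e : Fin (n + 1) → M => Q (e 0) (fun i => e i.succ))] :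
    IsBdd (fun e => Q (t e) e) := by
  obtain ⟨h, b, hb, hle⟩ := ht
  have := IsBdd.ball_term (fun e => b e + (1 : M)) (fun e a => ¬ (a = t e ∧ Q a e))
  refine (IsBdd.not _ (hP := this)).congr fun e => ?_
  constructor
  · exact fun hq hall => hall (t e) (lt_add_one_iff'.2 (hle e)) ⟨rfl, hq⟩
  · intro hne
    push Not at hne
    obtain ⟨a, -, rfl, hq⟩ := hne
    exact hq

instance IsBdd.eq (s t : (Fin n → M) → M) [hs : IsFn s] [ht : IsFn t] :
    IsBdd (fun e => s e = t e) :=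
  have := ht.graph
  IsBdd.subst (fun y e => y = t e) s

instance IsBdd.lt (s t : (Fin n → M) → M) [hs : IsFn s] [ht : IsFn t] :
    IsBdd (fun e => s e < t e) := by
  have := hs.weaken
  have h := IsBdd.lt_term (fun e : Fin (n + 1 + 1) → M => e 0) (fun e : Fin (n + 1 + 1) → M => e 1)
  have := IsBdd.subst (hQ := h) (fun y (e : Fin (n + 1) → M) => y < e 0)
    (fun e => s (fun i => e i.succ))
  exact IsBdd.subst (fun y e => s e < y) t

instance IsBdd.mem (t : (Fin n → M) → M) (X : Set M) [ht : IsFn t] [hX : IsSet X] :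
    IsBdd (fun e => t e ∈ X) :=
  have := IsBdd.mem_term (fun e : Fin (n + 1) → M => e 0) X
  IsBdd.subst (fun y _ => y ∈ X) t

instance IsBdd.le (s t : (Fin n → M) → M) [hs : IsFn s] [ht : IsFn t] :
    IsBdd (fun e => s e ≤ t e) :=
  IsBdd.congr (inferInstance : IsBdd fun e => ¬ t e < s e) (fun _ => not_lt.symm)

instance IsBdd.ball (t : (Fin n → M) → M) (P : (Fin n → M) → M → Prop) [ht : IsFn t]
    [hP : IsBdd (fun e : Fin (n + 1) → M => P (fun i => e i.succ) (e 0))] :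
    IsBdd (fun e => ∀ a, a < t e → P e a) := by
  obtain ⟨b, hb, hle⟩ := ht.bound
  have := ht.weaken
  have := IsBdd.ball_term b (fun e a => a < t e → P e a)
  exact this.congr fun e => ⟨fun h a _ ha => h a ha, fun h a ha => h a (ha.trans_le (hle e)) ha⟩

theorem IsFn.binary_graph (op : M → M → M)
    (hop : ∀ k, IsBdd (fun e : Fin (k + 3) → M => e 2 = op (e 1) (e 0)))
    (s t : (Fin n → M) → M) [hs : IsFn s] [ht : IsFn t] :
    IsBdd (fun e : Fin (n + 1) → M => e 0 = op (s (fun i => e i.succ)) (t (fun i => e i.succ))) := by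
  have := hs.weaken
  have := ht.weaken
  have := IsFn.weaken (fun e : Fin (n + 1) → M => t (fun i => e i.succ))
  have h := IsBdd.subst (hQ := hop n) (fun y (e : Fin (n + 2) → M) => e 1 = op (e 0) y)
    (fun e => t (fun i => e i.succ.succ))
  exact IsBdd.subst (hQ := h) (fun y (e : Fin (n + 1) → M) => e 0 = op y (t (fun i => e i.succ)))
    (fun e => s (fun i => e i.succ))

instance IsFn.add (s t : (Fin n → M) → M) [hs : IsFn s] [ht : IsFn t] :
    IsFn (fun e => s e + t e) := by
  obtain ⟨b, hb, hle⟩ := hs.bound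
  obtain ⟨c, hc, hle'⟩ := ht.bound
  exact ⟨IsFn.binary_graph (· + ·) (fun _ => IsBdd.eq_term _ _) s t, fun e => b e + c e, inferInstance,
    fun e => add_le_add (hle e) (hle' e)⟩

instance IsFn.mul (s t : (Fin n → M) → M) [hs : IsFn s] [ht : IsFn t] :
    IsFn (fun e => s e * t e) := by
  obtain ⟨b, hb, hle⟩ := hs.bound
  obtain ⟨c, hc, hle'⟩ := ht.bound
  exact ⟨IsFn.binary_graph (· * ·) (fun _ => IsBdd.eq_term _ _) s t, fun e => b e * c e, inferInstance,
    fun e => mul_le_mul' (hle e) (hle' e)⟩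

instance IsFn.exp (s t : (Fin n → M) → M) [hs : IsFn s] [ht : IsFn t] :
    IsFn (fun e => s e ^ t e) := by
  obtain ⟨b, hb, hle⟩ := hs.bound
  obtain ⟨c, hc, hle'⟩ := ht.bound
  -- The base is increased by one because powers are monotone in the exponent only for positive
  -- base.
  exact ⟨IsFn.binary_graph (· ^ ·) (fun _ => IsBdd.eq_term _ _) s t, fun e => (b e + (1 : M)) ^ c e, inferInstance,
    fun e => (exp_le_exp_left ((hle e).trans le_self_add)).trans (exp_le_exp (by simp) (hle' e))⟩

instance IsBdd.ball_le (t : (Fin n → M) → M) (P : (Fin n → M) → M → Prop) [ht : IsFn t]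
    [hP : IsBdd (fun e : Fin (n + 1) → M => P (fun i => e i.succ) (e 0))] :
    IsBdd (fun e => ∀ a, a ≤ t e → P e a) :=
  IsBdd.ball (fun e => t e + (1 : M)) P

instance IsBdd.bex (t : (Fin n → M) → M) (P : (Fin n → M) → M → Prop) [ht : IsFn t]
    [hP : IsBdd (fun e : Fin (n + 1) → M => P (fun i => e i.succ) (e 0))] :
    IsBdd (fun e => ∃ a, a < t e ∧ P e a) :=
  IsBdd.congr (inferInstance : IsBdd fun e => ¬ ∀ a, a < t e → ¬ P e a)
    (fun e => by push Not; rfl)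

instance IsBdd.bex_le (t : (Fin n → M) → M) (P : (Fin n → M) → M → Prop) [ht : IsFn t]
    [hP : IsBdd (fun e : Fin (n + 1) → M => P (fun i => e i.succ) (e 0))] :
    IsBdd (fun e => ∃ a, a ≤ t e ∧ P e a) :=
  IsBdd.bex (fun e => t e + (1 : M)) P

theorem IsFn.of_graph (t : (Fin n → M) → M) (R : M → (Fin n → M) → Prop)
    (b : (Fin n → M) → M) [hb : IsFn b]
    [hR : IsBdd (fun e : Fin (n + 1) → M => R (e 0) (fun i => e i.succ))]
    (h : ∀ e y, y = t e ↔ R y e) (hle : ∀ e, t e ≤ b e) : IsFn t := by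
  obtain ⟨c, hc, hle'⟩ := hb.bound
  exact ⟨hR.congr fun e => h _ _, c, hc, fun e => (hle e).trans (hle' e)⟩

end IsFn

/-! ## Least elements -/

theorem strong_induct {P : M → Prop} [hP : IsBdd (fun e : Fin 1 → M => P (e 0))]
    (h : ∀ x, (∀ y, y < x → P y) → P x) (x : M) : P x := by
  have : IsBdd (fun e : Fin 2 → M => P (e 0)) :=
    IsBdd.rename (fun e : Fin 1 → M => P (e 0)) (fun _ => .inl 0)
  refine h x (induct (P := fun x : M => ∀ y, y < x → P y) (fun y hy => absurd hy not_lt_zero)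
    (fun x hx y hy => ?_) x)
  rcases (lt_add_one_iff'.1 hy).lt_or_eq with hy | rfl
  · exact hx y hy
  · exact h y hx

theorem exists_least {P : M → Prop} [hP : IsBdd (fun e : Fin 1 → M => P (e 0))]
    (h : ∃ x, P x) : ∃ x, P x ∧ ∀ y, y < x → ¬ P y := by
  by_contra hne
  push Not at hne
  obtain ⟨x, hx⟩ := h
  refine strong_induct (P := fun x => ¬ P x) (fun x ih hx => ?_) x hx
  obtain ⟨y, hy, hPy⟩ := hne x hx
  exact ih y hy hPy

instance IsFn.pair {n} (s t : (Fin n → M) → M) [IsFn s] [IsFn t] : IsFn (fun e => pair (s e) (t e)) := by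
  unfold RCAStar.pair; infer_instance
end RCAStar

namespace RCAStar

variable {M : Type u} [Model M]

/-! ## Definable predicates and relations -/

/-- A unary predicate defined by a bounded formula. -/
class IsPred (P : M → Prop) : Prop where
  out : IsBdd (fun e : Fin 1 → M => P (e 0))

/-- A binary relation defined by a bounded formula. -/
class IsRel (R : M → M → Prop) : Prop where
  out : IsBdd (fun e : Fin 2 → M => R (e 0) (e 1))

/-- Allows a predicate that is known only through `IsPred` to be applied to any bounded function.
The low priority lets the structural instances be tried before it. -/
instance (priority := 50) IsBdd.pred {n : ℕ} (P : M → Prop) (t : (Fin n → M) → M) [hP : IsPred P]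
    [ht : IsFn t] : IsBdd (fun e => P (t e)) :=
  IsBdd.subst (fun y _ => P y) t
    (hQ := IsBdd.rename (fun e : Fin 1 → M => P (e 0)) (hP := hP.out) (fun _ => .inl 0))

instance (priority := 50) IsBdd.rel {n : ℕ} (R : M → M → Prop) (s t : (Fin n → M) → M)
    [hR : IsRel R] [hs : IsFn s] [ht : IsFn t] : IsBdd (fun e => R (s e) (t e)) := by
  have := hs.weaken
  have h := IsBdd.subst (fun y (e : Fin (n + 1) → M) => R y (e 0)) (fun e => s (fun i => e i.succ))
    (hQ := IsBdd.rename (fun e : Fin 2 → M => R (e 0) (e 1)) (hP := hR.out) ![.inl 0, .inl 1])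
  exact IsBdd.subst (fun y e => R (s e) y) t (hQ := h)

theorem pos_add_one (x : M) : 0 < x + 1 := Basic.zero_lt_succ x

/-! ## Division with remainder -/

theorem exists_div (x : M) {b : M} (hb : 0 < b) : ∃ q r, r < b ∧ x = b * q + r := by
  have := induct (P := fun x : M => ∃ q, q ≤ x ∧ ∃ r, r < b ∧ x = b * q + r)
    ⟨0, le_rfl, 0, hb, by simp⟩ (fun x ⟨q, hq, r, hr, hx⟩ => by
      rcases (Order.add_one_le_of_lt hr).lt_or_eq with h | h
      · exact ⟨q, hq.trans le_self_add, r + 1, h, by rw [hx]; ring⟩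
      · exact ⟨q + 1, by gcongr, 0, hb, by rw [hx]; grind⟩) x
  obtain ⟨q, -, h⟩ := this
  exact ⟨q, h⟩

theorem div_unique {b q q' r r' : M} (hr : r < b) (hr' : r' < b) (h : b * q + r = b * q' + r') :
    q = q' ∧ r = r' := by
  have key : ∀ {q q' r r' : M}, r < b → r' < b → b * q + r = b * q' + r' → ¬ q < q' := by
    intro q q' r r' hr hr' h hlt
    obtain ⟨z, rfl⟩ := lt_iff_exists_add_one.1 hlt
    have : b * q + r < b * (q + (z + 1)) + r' := by
      calc b * q + r < b * q + b := by gcongr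
        _ ≤ b * (q + (z + 1)) + r' := by
          rw [show b * (q + (z + 1)) + r' = b * q + b + (b * z + r') by ring]
          exact le_self_add
    exact this.ne h
  have hq : q = q' := le_antisymm (not_lt.1 (key hr' hr h.symm)) (not_lt.1 (key hr hr' h))
  subst hq
  exact ⟨rfl, add_left_cancel h⟩

-- The values for divisor zero, quotient `0` and remainder `x`, are such that `div_add_mod` holds
-- without a hypothesis on the divisor.
open Classical in
noncomputable instance : Div M :=
  ⟨fun x b => if hb : 0 < b then (exists_div x hb).choose else 0⟩

open Classical in
noncomputable instance : Mod M :=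
  ⟨fun x b => if hb : 0 < b then (exists_div x hb).choose_spec.choose else x⟩

theorem mod_lt (x : M) {b : M} (hb : 0 < b) : x % b < b := by
  change (if hb : 0 < b then _ else _) < b
  rw [dif_pos hb]
  exact (exists_div x hb).choose_spec.choose_spec.1

theorem div_zero' (x : M) : x / 0 = 0 := dif_neg (lt_irrefl (0 : M))

theorem mod_zero' (x : M) : x % 0 = x := dif_neg (lt_irrefl (0 : M))

theorem div_add_mod (x b : M) : b * (x / b) + x % b = x := by
  rcases (zero_le : 0 ≤ b).eq_or_lt with rfl | hb
  · rw [mod_zero', zero_mul, zero_add]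
  · change b * (if hb : 0 < b then _ else _) + (if hb : 0 < b then _ else _) = x
    rw [dif_pos hb, dif_pos hb]
    exact (exists_div x hb).choose_spec.choose_spec.2.symm

theorem div_eq_and_mod_eq {x b q r : M} (hr : r < b) (h : x = b * q + r) : x / b = q ∧ x % b = r :=
  div_unique (mod_lt _ (zero_le.trans_lt hr)) hr ((div_add_mod x b).trans h)

theorem div_eq {x b q r : M} (hr : r < b) (h : x = b * q + r) : x / b = q :=
  (div_eq_and_mod_eq hr h).1

theorem mod_eq {x b q r : M} (hr : r < b) (h : x = b * q + r) : x % b = r :=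
  (div_eq_and_mod_eq hr h).2

theorem mul_div_le (x b : M) : b * (x / b) ≤ x :=
  le_self_add.trans_eq (div_add_mod x b)

theorem div_le (x b : M) : x / b ≤ x := by
  rcases (zero_le : 0 ≤ b).eq_or_lt with rfl | hb
  · rw [div_zero']; exact zero_le
  · exact (le_mul_of_one_le_left' (one_le_of_pos hb)).trans (mul_div_le x b)

theorem mod_le (x b : M) : x % b ≤ x :=
  le_add_self.trans_eq (div_add_mod x b)

theorem div_of_lt {x b : M} (h : x < b) : x / b = 0 := div_eq h (by simp)

theorem mod_of_lt {x b : M} (h : x < b) : x % b = x := mod_eq (q := 0) h (by simp)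

theorem add_mul_div (x q : M) {b : M} (hb : 0 < b) : (x + b * q) / b = x / b + q :=
  div_eq (mod_lt x hb) (by conv_lhs => rw [← div_add_mod x b]
                           ring)

theorem add_mul_mod (x q b : M) : (x + b * q) % b = x % b := by
  rcases (zero_le : 0 ≤ b).eq_or_lt with rfl | hb
  · simp
  · exact mod_eq (q := x / b + q) (mod_lt x hb) (by
      conv_lhs => rw [← div_add_mod x b]
      ring)

theorem div_div (x b c : M) : x / b / c = x / (b * c) := by
  rcases (zero_le : 0 ≤ b).eq_or_lt with rfl | hb
  · rw [div_zero', zero_mul, div_zero']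
    exact le_antisymm (div_le _ _) zero_le
  rcases (zero_le : 0 ≤ c).eq_or_lt with rfl | hc
  · rw [div_zero', mul_zero, div_zero']
  refine (div_eq (r := b * (x / b % c) + x % b) ?_ ?_).symm
  · calc b * (x / b % c) + x % b < b * (x / b % c) + b := by gcongr; exact mod_lt _ hb
      _ = b * (x / b % c + 1) := by ring
      _ ≤ b * c := by gcongr; exact Order.add_one_le_of_lt (mod_lt _ hc)
  · conv_lhs => rw [← div_add_mod x b, ← div_add_mod (x / b) c]
    ring

theorem div_one' (x : M) : x / 1 = x := div_eq (r := 0) zero_lt_one (by simp)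

instance IsFn.div {n : ℕ} (s t : (Fin n → M) → M) [hs : IsFn s] [ht : IsFn t] :
    IsFn (fun e => s e / t e) := by
  have := hs.weaken
  have := ht.weaken
  have := IsFn.weaken (fun e : Fin (n + 1) → M => s (fun i => e i.succ))
  have := IsFn.weaken (fun e : Fin (n + 1) → M => t (fun i => e i.succ))
  refine IsFn.of_graph _ (fun y e => (t e = 0 ∧ y = 0) ∨ ∃ r, r < t e ∧ s e = t e * y + r) s
    (fun e y => ?_) (fun e => div_le _ _)
  rcases (zero_le : 0 ≤ t e).eq_or_lt with h | h
  · rw [← h, div_zero']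
    simp
  · constructor
    · rintro rfl
      exact .inr ⟨_, mod_lt _ h, (div_add_mod _ _).symm⟩
    · rintro (⟨h', -⟩ | ⟨r, hr, hs⟩)
      · exact absurd h' h.ne'
      · exact (div_eq hr hs).symm

instance IsFn.mod {n : ℕ} (s t : (Fin n → M) → M) [hs : IsFn s] [ht : IsFn t] :
    IsFn (fun e => s e % t e) := by
  have := hs.weaken
  have := ht.weaken
  refine IsFn.of_graph _ (fun y e => s e = t e * (s e / t e) + y) s
    (fun e y => ?_) (fun e => mod_le _ _)
  constructor
  · rintro rfl
    exact (div_add_mod _ _).symm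
  · intro h
    exact add_left_cancel (h.symm.trans (div_add_mod _ _).symm)

/-! ## Digits and coded sequences -/

/-- The digit with index `i` of `s` in base `b`. -/
noncomputable def digit (b s i : M) : M := s / b ^ i % b

instance IsFn.digit {n : ℕ} (b s i : (Fin n → M) → M) [IsFn b] [IsFn s] [IsFn i] :
    IsFn (fun e => digit (b e) (s e) (i e)) := by
  unfold RCAStar.digit; infer_instance

theorem digit_lt {b : M} (hb : 0 < b) (s i : M) : digit b s i < b := mod_lt _ hb

/-- Replaces the relation `Entry` by an equation for a bounded function, so that statements on coded
sequences fall under bounded induction. In base `0` there are no entries at all. -/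
theorem entry_iff {b s i a : M} : Entry b s i a ↔ 0 < b ∧ digit b s i = a := by
  constructor
  · rintro ⟨ha, q, r, hr, h⟩
    refine ⟨zero_le.trans_lt ha, ?_⟩
    rw [digit, div_eq (q := q * b + a) hr (h.trans (by ring)), mod_eq (q := q) ha (by ring)]
  · rintro ⟨hb, rfl⟩
    refine ⟨mod_lt _ hb, s / b ^ i / b, s % b ^ i, mod_lt _ (exp_pos hb), ?_⟩
    conv_lhs => rw [← div_add_mod s (b ^ i), ← div_add_mod (s / b ^ i) b]
    rw [digit]; ring

theorem Entry.unique {b s i a a' : M} (h : Entry b s i a) (h' : Entry b s i a') : a = a' :=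
  (entry_iff.1 h).2.symm.trans (entry_iff.1 h').2

theorem entry_digit {b : M} (hb : 0 < b) (s i : M) : Entry b s i (digit b s i) :=
  entry_iff.2 ⟨hb, rfl⟩

theorem Entry.pos {b s i a : M} (h : Entry b s i a) : 0 < b := (entry_iff.1 h).1

theorem digit_add_lt {b l k : M} (u v : M) (hk : k < l) :
    digit b (u + v * b ^ l) k = digit b u k := by
  rcases (zero_le : 0 ≤ b).eq_or_lt with rfl | hb
  · obtain ⟨z, rfl⟩ := lt_iff_exists_add_one.1 (zero_le.trans_lt hk)
    simp [exp_add, exp_one]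
  obtain ⟨z, rfl⟩ := lt_iff_exists_add_one.1 hk
  rw [digit, show u + v * b ^ (k + (z + 1)) = u + b ^ k * (b * (v * b ^ z)) by
    rw [exp_add, exp_succ]; ring, add_mul_div _ _ (exp_pos hb), add_mul_mod, digit]

theorem digit_add_ge {b l u : M} (v k : M) (hu : u < b ^ l) :
    digit b (u + v * b ^ l) (l + k) = digit b v k := by
  have : 0 < b ^ l := zero_le.trans_lt hu
  rw [digit, exp_add, ← div_div, mul_comm v, add_mul_div _ _ this, div_of_lt hu, zero_add, digit]

theorem digit_of_lt {b s k : M} (h : s < b ^ k) : digit b s k = 0 := by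
  rw [digit, div_of_lt h]
  exact le_antisymm (mod_le _ _) zero_le

theorem digit_zero {b a : M} (h : a < b) : digit b a 0 = a := by
  rw [digit, exp_zero, div_one', mod_of_lt h]

/-- Coded sequences exist for definable relations. -/
theorem exists_code (R : M → M → Prop) [IsRel R] (b l : M) (h : ∀ i, i < l → ∃ a, a < b ∧ R i a) :
    ∃ s, s < b ^ l ∧ ∀ i, i < l → R i (digit b s i) := by
  -- The bound `s < b ^ l` makes this a bounded formula. The totality of exponentiation thus takes
  -- the place of `Σ⁰₁` induction.
  refine induct (P := fun l : M => (∀ i, i < l → ∃ a, a < b ∧ R i a) →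
    ∃ s, s < b ^ l ∧ ∀ i, i < l → R i (digit b s i)) (fun _ => ⟨0, ?_, ?_⟩) (fun l ih h => ?_) l h
  · rw [exp_zero]; exact zero_lt_one
  · exact fun i hi => absurd hi not_lt_zero
  · obtain ⟨s, hs, hR⟩ := ih fun i hi => h i (hi.trans (lt_add_one _))
    obtain ⟨a, ha, hRa⟩ := h l (lt_add_one _)
    refine ⟨s + a * b ^ l, ?_, fun i hi => ?_⟩
    · calc s + a * b ^ l < b ^ l + a * b ^ l := by gcongr
        _ = (a + 1) * b ^ l := by ring
        _ ≤ b * b ^ l := by gcongr; exact Order.add_one_le_of_lt ha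
        _ = b ^ (l + 1) := by rw [exp_succ, mul_comm]
    · rcases (lt_add_one_iff'.1 hi).lt_or_eq with hi | rfl
      · rw [digit_add_lt _ _ hi]; exact hR i hi
      · have := digit_add_ge a 0 hs
        rw [add_zero, digit_zero ha] at this
        rw [this]; exact hRa

/-- Appending an entry to a coded sequence. -/
theorem exists_append (b s l a : M) : ∃ b' s', 0 < b' ∧ digit b' s' l = a ∧
    ∀ i, i < l → ∀ c, Entry b s i c → digit b' s' i = c := by
  have : IsRel (fun i y : M => (i < l ∧ y = digit b s i) ∨ (i = l ∧ y = a)) := ⟨inferInstance⟩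
  -- The new base `s + a + 1` exceeds `a` and every digit of `s`, so the old entries can be coded
  -- again together with the new one.
  obtain ⟨s', -, hs'⟩ := exists_code (fun i y : M => (i < l ∧ y = digit b s i) ∨ (i = l ∧ y = a))
    (s + a + 1) (l + 1) (fun i hi => by
      rcases (lt_add_one_iff'.1 hi).lt_or_eq with hi | rfl
      · refine ⟨digit b s i, ?_, .inl ⟨hi, rfl⟩⟩
        have : digit b s i ≤ s := (mod_le _ _).trans (div_le _ _)
        refine lt_add_one_iff'.2 (this.trans le_self_add)
      · exact ⟨a, lt_add_one_iff'.2 le_add_self, .inr ⟨rfl, rfl⟩⟩)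
  refine ⟨s + a + 1, s', pos_add_one _, ?_, fun i hi c hc => ?_⟩
  · rcases hs' l (lt_add_one _) with h | h
    · exact absurd h.1 (lt_irrefl _)
    · exact h.2
  · rcases hs' i (hi.trans (lt_add_one _)) with h | h
    · rw [h.2]; exact (entry_iff.1 hc).2
    · exact absurd h.1 hi.ne

/-! ## The pigeonhole principle -/

/-- Induction on `v` for all sequences at once, in a fixed base `b`. Quantification over functions
is quantification over codes below `b ^ (v + 1)`, hence bounded. For the step, the largest value is
redirected to the value at the last argument, and the last argument is dropped. -/
theorem pigeonhole_code (b v : M) (hb : v < b) :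
    ∀ s, s < b ^ (v + 1) → ¬ ((∀ i, i ≤ v → digit b s i < v) ∧
      ∀ i, i ≤ v → ∀ j, j < i → digit b s i ≠ digit b s j) := by
  refine induct (P := fun v => v < b → ∀ s, s < b ^ (v + 1) → ¬ ((∀ i, i ≤ v → digit b s i < v) ∧
      ∀ i, i ≤ v → ∀ j, j < i → digit b s i ≠ digit b s j)) ?_ ?_ v hb
  · rintro - s - ⟨h, -⟩
    exact not_lt_zero (h 0 le_rfl)
  · rintro v ih hb s - ⟨h1, h2⟩
    have hvb : v < b := (lt_add_one v).trans hb
    have inj : ∀ i, i ≤ v + 1 → ∀ j, j ≤ v + 1 → digit b s i = digit b s j → i = j := by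
      intro i hi j hj hij
      rcases lt_trichotomy i j with h | h | h
      · exact absurd hij.symm (h2 j hj i h)
      · exact h
      · exact absurd hij (h2 i hi j h)
    -- the entry `v`, if present, is replaced by the last entry
    have : IsRel (fun i y : M => (digit b s i = v ∧ y = digit b s (v + 1)) ∨
      (digit b s i ≠ v ∧ y = digit b s i)) := ⟨inferInstance⟩
    have b0 : 0 < b := zero_le.trans_lt hb
    obtain ⟨s', hs', hR⟩ := exists_code (fun i y : M => (digit b s i = v ∧ y = digit b s (v + 1)) ∨
      (digit b s i ≠ v ∧ y = digit b s i)) b (v + 1) (fun i _ => by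
        by_cases h : digit b s i = v
        · exact ⟨_, digit_lt b0 _ _, .inl ⟨h, rfl⟩⟩
        · exact ⟨_, digit_lt b0 _ _, .inr ⟨h, rfl⟩⟩)
    refine ih hvb s' hs' ⟨fun i hi => ?_, fun i hi j hj => ?_⟩
    · have hi' : i < v + 1 := lt_add_one_iff'.2 hi
      rcases hR i hi' with ⟨h, e⟩ | ⟨h, e⟩
      · rw [e]
        refine lt_of_le_of_ne (lt_add_one_iff'.1 (h1 _ le_rfl)) fun h' => ?_
        exact hi'.ne' (inj _ le_rfl _ hi'.le (h'.trans h.symm))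
      · rw [e]
        exact lt_of_le_of_ne (lt_add_one_iff'.1 (h1 _ hi'.le)) h
    · have hi' : i < v + 1 := lt_add_one_iff'.2 hi
      have hj' : j < v + 1 := hj.trans hi'
      intro heq
      rcases hR i hi' with ⟨h, e⟩ | ⟨h, e⟩ <;> rcases hR j hj' with ⟨h', e'⟩ | ⟨h', e'⟩
      · exact hj.ne' (inj _ hi'.le _ hj'.le (h.trans h'.symm))
      · exact hj'.ne' (inj _ le_rfl _ hj'.le (by rw [← e, ← e', heq]))
      · exact hi'.ne (inj _ hi'.le _ le_rfl (by rw [← e, ← e', heq]))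
      · exact hj.ne' (inj _ hi'.le _ hj'.le (by rw [← e, ← e', heq]))

/-- No definable relation contains an injection of the model into a proper initial segment. -/
theorem pigeonhole (R : M → M → Prop) [IsRel R] (v : M) (h : ∀ i, ∃ a, a < v ∧ R i a)
    (inj : ∀ i j a, R i a → R j a → i = j) : False := by
  have : IsRel (fun i y : M => y < v ∧ R i y) := ⟨inferInstance⟩
  -- Finitely many arguments suffice: the values at the `v + 1` arguments `i ≤ v` are already too
  -- many.
  obtain ⟨s, hs, hR⟩ := exists_code (fun i y : M => y < v ∧ R i y) (v + 1) (v + 1)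
    (fun i _ => by
      obtain ⟨a, ha, hr⟩ := h i
      exact ⟨a, ha.trans (lt_add_one _), ha, hr⟩)
  refine pigeonhole_code (v + 1) v (lt_add_one _) s hs ⟨fun i hi => ?_, fun i hi j hj heq => ?_⟩
  · exact (hR i (lt_add_one_iff'.2 hi)).1
  · have h1 := (hR i (lt_add_one_iff'.2 hi)).2
    have h2 := (hR j (hj.trans (lt_add_one_iff'.2 hi))).2
    rw [heq] at h1
    exact hj.ne' (inj _ _ _ h1 h2)

end RCAStar

namespace RCAStar

variable {M : Type u} [Model M]

/-! ## Strings -/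

theorem nat_eq_cast (k : ℕ) : (nat k : M) = k := by
  induction k with
  | zero => simp [nat]
  | succ k ih => rw [nat, ih, Nat.cast_succ]

theorem one_lt_sixteen : (1 : M) < 16 := by norm_num

theorem sixteen_pos : (0 : M) < 16 := by norm_num

theorem exp_sixteen_pos (k : M) : (0 : M) < 16 ^ k := exp_pos sixteen_pos

theorem exists_len (w : M) : ∃ l : M, w < (16 : M) ^ l ∧ ∀ k, k < l → ¬ w < (16 : M) ^ k :=
  exists_least (P := fun l => w < (16 : M) ^ l) ⟨w, lt_exp_self one_lt_sixteen w⟩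

/-- The length of a string. -/
noncomputable def len (w : M) : M := (exists_len w).choose

theorem lt_exp_len (w : M) : w < 16 ^ len w := (exists_len w).choose_spec.1

theorem len_le_iff {w k : M} : len w ≤ k ↔ w < 16 ^ k :=
  ⟨fun h => (lt_exp_len w).trans_le (exp_le_exp sixteen_pos h),
    fun h => not_lt.1 fun h' => (exists_len w).choose_spec.2 k h' h⟩

theorem lt_len_iff {w k : M} : k < len w ↔ 16 ^ k ≤ w := by
  rw [← not_le, len_le_iff, not_lt]

theorem len_eq_iff {w l : M} : l = len w ↔ w < 16 ^ l ∧ ∀ k, k < l → ¬ w < 16 ^ k := by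
  constructor
  · rintro rfl
    exact (exists_len w).choose_spec
  · rintro ⟨h1, h2⟩
    exact le_antisymm (not_lt.1 fun h => h2 _ h (lt_exp_len w)) (len_le_iff.2 h1)

theorem len_iff {w l : M} : Len w l ↔ l = len w := by
  rw [len_eq_iff, Len, nat_eq_cast]; rfl

theorem len_eq {w k : M} (h : 16 ^ k ≤ w) (h' : w < 16 ^ (k + 1)) : len w = k + 1 :=
  le_antisymm (len_le_iff.2 h') (Order.add_one_le_of_lt (lt_len_iff.2 h))

theorem len_le_self (w : M) : len w ≤ w := len_le_iff.2 (lt_exp_self one_lt_sixteen w)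

instance IsFn.len {n : ℕ} (w : (Fin n → M) → M) [hw : IsFn w] : IsFn (fun e => len (w e)) := by
  have := hw.weaken
  have := IsFn.weaken (fun e : Fin (n + 1) → M => w (fun i => e i.succ))
  exact IsFn.of_graph _ (fun y e => w e < 16 ^ y ∧ ∀ k, k < y → ¬ w e < 16 ^ k) w
    (fun e y => len_eq_iff) (fun e => len_le_self _)

theorem len_zero : len (0 : M) = 0 :=
  le_antisymm (len_le_iff.2 (exp_sixteen_pos _)) zero_le

theorem len_eq_zero {w : M} : len w = 0 ↔ w = 0 := by
  constructor
  · intro h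
    have := lt_exp_len w
    rw [h, exp_zero] at this
    exact le_antisymm (lt_add_one_iff'.1 (by simpa using this)) zero_le
  · rintro rfl
    exact len_zero

theorem len_pos {w : M} : 0 < len w ↔ w ≠ 0 := by
  rw [pos_iff_ne_zero, ne_eq, len_eq_zero]

/-- Concatenation of strings. -/
noncomputable def cat (u v : M) : M := u + v * 16 ^ len u

instance IsFn.cat {n : ℕ} (u v : (Fin n → M) → M) [IsFn u] [IsFn v] :
    IsFn (fun e => cat (u e) (v e)) := by
  unfold RCAStar.cat; infer_instance

theorem cat_iff {u v w : M} : Cat u v w ↔ w = cat u v := by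
  simp [Cat, len_iff, cat, nat_eq_cast]

theorem cat_zero (u : M) : cat u 0 = u := by simp [cat]

theorem zero_cat (v : M) : cat 0 v = v := by simp [cat, len_zero, exp_zero]

theorem len_cat (u v : M) : len (cat u v) = len u + len v := by
  rcases eq_or_ne v 0 with rfl | hv
  · rw [cat_zero, len_zero, add_zero]
  obtain ⟨k, hk⟩ := lt_iff_exists_add_one.1 (len_pos.2 hv)
  rw [zero_add] at hk
  rw [hk, ← add_assoc]
  refine len_eq ?_ ?_
  · rw [exp_add, cat, mul_comm]
    refine le_trans ?_ le_add_self
    gcongr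
    exact lt_len_iff.1 (by rw [hk]; exact lt_add_one _)
  · have h := lt_exp_len v
    rw [hk] at h
    calc cat u v < 16 ^ len u + v * 16 ^ len u := by
          rw [cat]; gcongr; exact lt_exp_len u
      _ = (v + 1) * 16 ^ len u := by ring
      _ ≤ 16 ^ (k + 1) * 16 ^ len u := by gcongr; exact Order.add_one_le_of_lt h
      _ = 16 ^ (len u + k + 1) := by rw [← exp_add]; congr 1; ring

theorem le_cat_right (u v : M) : v ≤ cat u v :=
  le_trans (le_mul_of_one_le_right' (one_le_of_pos (exp_sixteen_pos _))) le_add_self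

theorem cat_assoc (u v w : M) : cat (cat u v) w = cat u (cat v w) := by
  rw [cat, len_cat, exp_add, cat, cat, cat]
  ring

theorem cat_inj {u u' v v' : M} (hl : len u = len u') (h : cat u v = cat u' v') :
    u = u' ∧ v = v' := by
  rw [cat, cat, ← hl] at h
  have := div_unique (b := 16 ^ len u) (lt_exp_len u) (hl ▸ lt_exp_len u')
    (show 16 ^ len u * v + u = 16 ^ len u * v' + u' by grind)
  exact ⟨this.2, this.1⟩

theorem cat_left_cancel {u v v' : M} (h : cat u v = cat u v') : v = v' := (cat_inj rfl h).2

theorem cat_eq_zero {u v : M} : cat u v = 0 ↔ u = 0 ∧ v = 0 := by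
  rw [← len_eq_zero, len_cat, add_eq_zero, len_eq_zero, len_eq_zero]

/-- Concatenation of a list of strings. -/
noncomputable def concat (l : List M) : M := l.foldr cat 0

theorem concat_nil : concat ([] : List M) = 0 := rfl

theorem concat_cons (u : M) (l : List M) : concat (u :: l) = cat u (concat l) := rfl

theorem concat_append (l l' : List M) : concat (l ++ l') = cat (concat l) (concat l') := by
  induction l with
  | nil => rw [concat_nil, zero_cat, List.nil_append]
  | cons u l ih => rw [List.cons_append, concat_cons, ih, concat_cons, cat_assoc]

theorem concat_iff {l : List M} {w : M} : Concat l w ↔ w = concat l := by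
  induction l generalizing w with
  | nil => exact Iff.rfl
  | cons u l ih => simp [Concat, ih, cat_iff, concat_cons]

/-- Levi's lemma for strings. Dividing `u` by `16 ^ len a` splits off its first `len a` symbols, and
uniqueness of division with remainder identifies them with `a`. -/
theorem cat_prefix {u v a b : M} (h : cat u v = cat a b) (hl : len a ≤ len u) :
    ∃ u', u = cat a u' ∧ b = cat u' v := by
  obtain ⟨z, hz⟩ := exists_add_of_le' hl
  have hu := div_add_mod u (16 ^ len a)
  rw [cat, hz, exp_add, ← hu] at h
  rw [cat] at h
  have := div_unique (b := 16 ^ len a) (q := u / 16 ^ len a + v * 16 ^ z) (q' := b)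
    (mod_lt u (exp_sixteen_pos _)) (lt_exp_len a) (by
      rw [mul_comm _ b, add_comm _ a, ← h]
      ring)
  rw [this.2] at hu
  have hu' : u = cat a (u / 16 ^ len a) := by rw [cat, mul_comm, add_comm, hu]
  refine ⟨_, hu', ?_⟩
  have hlen := congrArg len hu'
  rw [len_cat, hz] at hlen
  rw [← this.1, cat, ← add_left_cancel hlen]

/-! ## Symbols -/

/-- The symbol with index `k` in a string. -/
noncomputable abbrev sym (w k : M) : M := digit 16 w k

theorem sym_cat_lt {u k : M} (v : M) (h : k < len u) : sym (cat u v) k = sym u k :=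
  digit_add_lt _ _ h

theorem sym_cat_ge (u v k : M) : sym (cat u v) (len u + k) = sym v k :=
  digit_add_ge _ _ (lt_exp_len u)

theorem sym_cat_len (u v : M) : sym (cat u v) (len u) = sym v 0 := by
  simpa using sym_cat_ge u v 0

theorem sym_cat_zero {u : M} (v : M) (h : u ≠ 0) : sym (cat u v) 0 = sym u 0 :=
  sym_cat_lt v (len_pos.2 h)

theorem sym_of_len_le {w k : M} (h : len w ≤ k) : sym w k = 0 := digit_of_lt (len_le_iff.1 h)

theorem sym_zero (k : M) : sym 0 k = 0 := sym_of_len_le (by rw [len_zero]; exact zero_le)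

theorem len_symbol {a : M} (h : 0 < a) (h' : a < 16) : len a = 1 := by
  have := len_eq (w := a) (k := 0) (by rw [exp_zero]; exact one_le_of_pos h)
    (by rwa [zero_add, exp_one])
  rwa [zero_add] at this

theorem sym_symbol {a : M} (h : a < 16) : sym a 0 = a := digit_zero h

/-- All symbols of the string have the property. -/
def AllSym (Q : M → Prop) (w : M) : Prop := ∀ k, k < len w → Q (sym w k)

instance AllSym.isPred (Q : M → Prop) [IsPred Q] : IsPred (AllSym Q) :=
  ⟨by unfold AllSym; infer_instance⟩

theorem AllSym.zero (Q : M → Prop) : AllSym Q 0 := fun k hk => by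
  rw [len_zero] at hk; exact absurd hk not_lt_zero

theorem allSym_cat {Q : M → Prop} {u v : M} : AllSym Q (cat u v) ↔ AllSym Q u ∧ AllSym Q v := by
  constructor
  · intro h
    refine ⟨fun k hk => ?_, fun k hk => ?_⟩
    · rw [← sym_cat_lt v hk]
      exact h k (by rw [len_cat]; exact hk.trans_le le_self_add)
    · rw [← sym_cat_ge u]
      exact h _ (by rw [len_cat]; gcongr)
  · rintro ⟨hu, hv⟩ k hk
    rcases lt_or_ge k (len u) with h | h
    · rw [sym_cat_lt v h]; exact hu k h
    · obtain ⟨z, rfl⟩ := exists_add_of_le' h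
      rw [sym_cat_ge]
      rw [len_cat] at hk
      exact hv z (lt_of_add_lt_add_left hk)

theorem allSym_symbol {Q : M → Prop} {a : M} (h : 0 < a) (h' : a < 16) (hQ : Q a) : AllSym Q a := by
  intro k hk
  rw [len_symbol h h', ← zero_add (1 : M), lt_add_one_iff'] at hk
  rw [le_antisymm hk zero_le, sym_symbol h']
  exact hQ

theorem AllSym.mono {Q Q' : M → Prop} (h : ∀ a, Q a → Q' a) {w : M} (hw : AllSym Q w) :
    AllSym Q' w := fun k hk => h _ (hw k hk)

theorem AllSym.concat {Q : M → Prop} {l : List M} (h : ∀ w ∈ l, AllSym Q w) :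
    AllSym Q (concat l) := by
  induction l with
  | nil => exact AllSym.zero Q
  | cons u l ih =>
    rw [concat_cons, allSym_cat]
    exact ⟨h u (by simp), ih fun w hw => h w (by simp [hw])⟩

/-- The first symbol of the string has the property, and no other symbol has it. -/
def Marked (Q : M → Prop) (x : M) : Prop :=
  x ≠ 0 ∧ Q (sym x 0) ∧ ∀ k, 0 < k → k < len x → ¬ Q (sym x k)

/-- The string is empty or its first symbol has the property. -/
def Starts (Q : M → Prop) (v : M) : Prop := v = 0 ∨ Q (sym v 0)

theorem Marked.cat_symbol {Q : M → Prop} {a v : M} (h : 0 < a) (h' : a < 16) (hQ : Q a)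
    (hv : AllSym (fun b => ¬ Q b) v) : Marked Q (cat a v) := by
  refine ⟨fun h0 => h.ne' (cat_eq_zero.1 h0).1, ?_, fun k hk hkl => ?_⟩
  · rw [sym_cat_zero v h.ne', sym_symbol h']; exact hQ
  · obtain ⟨j, rfl⟩ := lt_iff_exists_add_one.1 hk
    rw [len_cat, len_symbol h h'] at hkl
    rw [zero_add, add_comm, ← len_symbol h h', sym_cat_ge]
    exact hv j (by grind)

theorem Marked.starts_cat {Q : M → Prop} {x : M} (h : Marked Q x) (v : M) : Starts Q (cat x v) :=
  .inr (by rw [sym_cat_zero v h.1]; exact h.2.1)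

theorem Marked.not_len_lt {Q : M → Prop} {x x' v v' : M} (hx : Marked Q x) (hx' : Marked Q x')
    (hv : Starts Q v) (h : cat x v = cat x' v') : ¬ len x < len x' := by
  intro hl
  rcases hv with rfl | hv
  · have := congrArg len h
    rw [cat_zero, len_cat] at this
    exact absurd (this ▸ hl) (not_lt.2 le_self_add)
  · rw [← sym_cat_len x v, h, sym_cat_lt v' hl] at hv
    exact hx'.2.2 _ (len_pos.2 hx.1) hl hv

/-- A marked piece reaches up to the next marker or to the end of the string, so its length can be
read off from the string. -/
theorem Marked.unique {Q : M → Prop} {x x' v v' : M} (hx : Marked Q x) (hx' : Marked Q x')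
    (hv : Starts Q v) (hv' : Starts Q v') (h : cat x v = cat x' v') : x = x' ∧ v = v' :=
  cat_inj (le_antisymm (not_lt.1 (hx'.not_len_lt hx hv' h.symm)) (not_lt.1 (hx.not_len_lt hx' hv h)))
    h

/-! ## Concatenations of coded sequences of strings -/

section Built

variable {P : M → Prop}

theorem built_iff {w : M} : Built P w ↔ ∃ b s l : M, 0 < b ∧ digit b s 0 = 0 ∧ digit b s l = w ∧
    ∀ i, i < l → ∃ x, P x ∧ digit b s (i + 1) = cat (digit b s i) x := by
  constructor
  · rintro ⟨b, s, l, h0, hl, h⟩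
    refine ⟨b, s, l, h0.pos, (entry_iff.1 h0).2, (entry_iff.1 hl).2, fun i hi => ?_⟩
    obtain ⟨u, v, x, hu, hv, hx, hc⟩ := h i hi
    exact ⟨x, hx, by rw [(entry_iff.1 hu).2, (entry_iff.1 hv).2, cat_iff.1 hc]⟩
  · rintro ⟨b, s, l, hb, h0, hl, h⟩
    refine ⟨b, s, l, entry_iff.2 ⟨hb, h0⟩, entry_iff.2 ⟨hb, hl⟩, fun i hi => ?_⟩
    obtain ⟨x, hx, hc⟩ := h i hi
    exact ⟨_, _, x, entry_digit hb _ _, entry_digit hb _ _, hx, cat_iff.2 hc⟩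

/-- Induction on the index in the coded sequence of initial parts. Only `Q` enters the induction
formula, so `P` need not be definable. -/
theorem Built.induct {w : M} (hw : Built P w) (Q : M → Prop) [IsPred Q] (h0 : Q 0)
    (hs : ∀ u x, Q u → P x → Q (cat u x)) : Q w := by
  obtain ⟨b, s, l, -, hd, rfl, h⟩ := built_iff.1 hw
  have := RCAStar.induct (P := fun i : M => i ≤ l → Q (digit b s i)) (fun _ => by rwa [hd])
    (fun i ih hi => by
      have hi : i < l := (lt_add_one i).trans_le hi
      obtain ⟨x, hx, hc⟩ := h i hi
      rw [hc]
      exact hs _ _ (ih hi.le) hx) l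
  exact this le_rfl

theorem Built.allSym {w : M} (hw : Built P w) (Q : M → Prop) [IsPred Q]
    (h : ∀ x, P x → AllSym Q x) : AllSym Q w :=
  hw.induct (AllSym Q) (AllSym.zero Q) fun _ x hu hx => allSym_cat.2 ⟨hu, h x hx⟩

/-- Consider the first initial part that reaches beyond position `k`. The piece added there contains
the position, and a marker inside a piece can only be its first symbol. -/
theorem Built.piece_at (Q : M → Prop) [IsPred Q] (hP : ∀ x, P x → Marked Q x) {w k : M}
    (hw : Built P w) (hk : k < len w) (hQ : Q (sym w k)) :
    ∃ u x v, w = cat u (cat x v) ∧ len u = k ∧ P x ∧ Starts Q v := by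
  obtain ⟨b, s, l, hb, hd, rfl, h⟩ := built_iff.1 hw
  set w := digit b s l with hwdef
  -- Downward induction on the index `i`, organized by `j = l - i`: what follows an initial part is
  -- empty or begins with a marker.
  have hsplit : ∀ j, ∀ i, i ≤ l → i + j = l → ∃ v, v ≤ w ∧ w = cat (digit b s i) v ∧
      (v = 0 ∨ Q (sym v 0)) := by
    intro j
    refine RCAStar.induct (P := fun j => ∀ i, i ≤ l → i + j = l → ∃ v, v ≤ w ∧
      w = cat (digit b s i) v ∧ (v = 0 ∨ Q (sym v 0))) ?_ ?_ j
    · rintro i - hi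
      rw [add_zero] at hi
      exact ⟨0, zero_le, by rw [cat_zero, hi], .inl rfl⟩
    · rintro j ih i - hi
      have hil : i < l := lt_iff_exists_add_one.2 ⟨j, hi.symm⟩
      obtain ⟨v, hv, hw', hs⟩ := ih (i + 1) (Order.add_one_le_of_lt hil) (by rw [← hi]; ring)
      obtain ⟨x, hx, hc⟩ := h i hil
      have hw2 : w = cat (digit b s i) (cat x v) := by rw [hw', hc, cat_assoc]
      refine ⟨cat x v, ?_, hw2, (hP x hx).starts_cat v⟩
      rw [hw2]
      exact le_cat_right _ _
  obtain ⟨i, hi, hmin⟩ := exists_least (P := fun i => i ≤ l ∧ k < len (digit b s i)) ⟨l, le_rfl, hk⟩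
  have hi0 : 0 < i := by
    rw [pos_iff_ne_zero]
    rintro rfl
    rw [hd, len_zero] at hi
    exact not_lt_zero hi.2
  obtain ⟨j, rfl⟩ := lt_iff_exists_add_one.1 hi0
  rw [zero_add] at hi hmin
  have hjl : j < l := (lt_add_one j).trans_le hi.1
  have hj : len (digit b s j) ≤ k := not_lt.1 fun h' => hmin j (lt_add_one j) ⟨hjl.le, h'⟩
  obtain ⟨z, hz⟩ := exists_add_of_le' hi.1
  obtain ⟨v, -, hw', hs⟩ := hsplit z _ hi.1 hz.symm
  obtain ⟨x, hx, hc⟩ := h j hjl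
  rw [hc, cat_assoc] at hw'
  refine ⟨_, x, v, hw', ?_, hx, hs⟩
  obtain ⟨d, rfl⟩ := exists_add_of_le' hj
  have hd : d < len x := by
    have := hi.2
    rw [hc, len_cat] at this
    exact lt_of_add_lt_add_left this
  rw [hw', sym_cat_ge, sym_cat_lt v hd] at hQ
  rcases (zero_le : 0 ≤ d).eq_or_lt with rfl | hd0
  · rw [add_zero]
  · exact absurd hQ ((hP x hx).2.2 d hd0 hd)

/-- `Built` only asserts that some decomposition exists. By uniqueness, a segment that looks like a
piece in the given string is a piece of that decomposition. This is how the truth of a single clause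
is extracted from the truth of a matrix. -/
theorem Built.of_piece (Q : M → Prop) [IsPred Q] (hP : ∀ x, P x → Marked Q x) {u x v : M}
    (hw : Built P (cat u (cat x v))) (hx : Marked Q x) (hv : Starts Q v) : P x := by
  obtain ⟨u', x', v', h, hl, hPx, hv'⟩ := hw.piece_at Q hP (k := len u)
    (by rw [len_cat, len_cat]
        exact (lt_add_of_pos_right _ (len_pos.2 hx.1)).trans_le (by rw [← add_assoc]; exact le_self_add))
    (by rw [sym_cat_len, sym_cat_zero v hx.1]; exact hx.2.1)
  obtain ⟨-, h⟩ := cat_inj hl.symm h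
  obtain ⟨rfl, -⟩ := hx.unique (hP _ hPx) hv hv' h
  exact hPx

theorem Built.nil : Built P 0 :=
  built_iff.2 ⟨1, 0, 0, zero_lt_one, digit_zero zero_lt_one, digit_zero zero_lt_one,
    fun _ hi => absurd hi not_lt_zero⟩

theorem Built.snoc {u x : M} (hu : Built P u) (hx : P x) : Built P (cat u x) := by
  obtain ⟨b, s, l, hb, hd, rfl, h⟩ := built_iff.1 hu
  obtain ⟨b', s', hb', hl, hlt⟩ := exists_append b s (l + 1) (cat (digit b s l) x)
  have key : ∀ i, i < l + 1 → digit b' s' i = digit b s i :=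
    fun i hi => hlt i hi _ (entry_digit hb _ _)
  refine built_iff.2 ⟨b', s', l + 1, hb', by rw [key 0 (pos_add_one _), hd], hl, fun i hi => ?_⟩
  rcases (lt_add_one_iff'.1 hi).lt_or_eq with hi' | rfl
  · obtain ⟨y, hy, hc⟩ := h i hi'
    exact ⟨y, hy, by rw [key _ hi, key _ (by gcongr), hc]⟩
  · exact ⟨x, hx, by rw [key _ hi, hl]⟩

theorem Built.concat {l : List M} (h : ∀ x ∈ l, P x) : Built P (concat l) := by
  induction l using List.reverseRecOn with
  | nil => exact .nil
  | append_singleton l x ih =>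
    rw [concat_append, concat_cons, concat_nil, cat_zero]
    exact (ih fun y hy => h y (by simp [hy])).snoc (h x (by simp))

/-- For a nonstandard number of pieces, where no external list is available. The initial parts are
the values of a definable function, and their common bound `c` supplies the base of a code. -/
theorem Built.of_fun (u : M → M) [IsRel (fun i y => y = u i)] (l c : M) (hc : ∀ i, i ≤ l → u i ≤ c)
    (h0 : u 0 = 0) (h : ∀ i, i < l → ∃ x, P x ∧ u (i + 1) = cat (u i) x) : Built P (u l) := by
  obtain ⟨s, -, hs⟩ := exists_code (fun i y => y = u i) (c + 1) (l + 1)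
    (fun i hi => ⟨u i, lt_add_one_iff'.2 (hc i (lt_add_one_iff'.1 hi)), rfl⟩)
  refine built_iff.2 ⟨c + 1, s, l, pos_add_one _, ?_, hs l (lt_add_one _), fun i hi => ?_⟩
  · rw [hs 0 (pos_add_one _), h0]
  · rw [hs i (hi.trans (lt_add_one _)), hs (i + 1) (by gcongr)]
    exact h i hi

end Built

/-! ## Repeated symbols and indices -/

theorem repeat_iff {a k w : M} : Repeat a k w ↔ w * 15 + a = a * 16 ^ k := by
  rw [Repeat, nat_eq_cast, nat_eq_cast]; rfl

theorem Repeat.unique {a k w w' : M} (h : Repeat a k w) (h' : Repeat a k w') : w = w' := by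
  rw [repeat_iff] at h h'
  grind

theorem exists_repeat {a : M} (ha : 0 < a) (ha' : a < 16) (k : M) :
    ∃ w, Repeat a k w ∧ len w = k ∧ AllSym (· = a) w := by
  have : IsPred (fun b : M => b = a) := ⟨inferInstance⟩
  have := induct (P := fun k : M => ∃ w, w < 16 ^ k ∧ w * 15 + a = a * 16 ^ k ∧ len w = k ∧
    AllSym (fun b => b = a) w) ⟨0, exp_sixteen_pos _, by simp [exp_zero], len_zero, AllSym.zero _⟩
    (fun k ⟨w, _, h1, h2, h3⟩ => by
      have hl : len (cat w a) = k + 1 := by rw [len_cat, h2, len_symbol ha ha']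
      refine ⟨cat w a, len_le_iff.1 hl.le, ?_, hl, allSym_cat.2 ⟨h3, allSym_symbol ha ha' rfl⟩⟩
      rw [cat, h2, exp_succ]
      grind) k
  obtain ⟨w, -, h1, h2⟩ := this
  exact ⟨w, repeat_iff.2 h1, h2⟩

theorem Repeat.len {a k w : M} (ha : 0 < a) (ha' : a < 16) (h : Repeat a k w) : len w = k := by
  obtain ⟨w', h1, h2, -⟩ := exists_repeat ha ha' k
  rw [h.unique h1, h2]

theorem Repeat.allSym {a k w : M} (ha : 0 < a) (ha' : a < 16) (h : Repeat a k w) :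
    AllSym (· = a) w := by
  obtain ⟨w', h1, -, h2⟩ := exists_repeat ha ha' k
  rw [h.unique h1]; exact h2

theorem Repeat.sym_zero {a k w : M} (ha : 0 < a) (ha' : a < 16) (h : Repeat a k w) (hk : k ≠ 0) :
    sym w 0 = a :=
  h.allSym ha ha' 0 (by rw [h.len ha ha']; exact pos_iff_ne_zero.2 hk)

theorem Repeat.count_not_lt {a k k' w w' v v' : M} (ha : 0 < a) (ha' : a < 16) (h : Repeat a k w)
    (h' : Repeat a k' w') (hv : sym v 0 ≠ a) (he : cat w v = cat w' v') : ¬ k < k' := by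
  intro hlt
  have h1 := h.len ha ha'
  have h2 := h'.len ha ha'
  apply hv
  rw [← sym_cat_len w v, he, h1, sym_cat_lt v' (by rw [h2]; exact hlt)]
  exact h'.allSym ha ha' k (by rw [h2]; exact hlt)

/-- The block is the maximal run of `a` at the beginning of the string, since a different symbol
follows it. -/
theorem Repeat.cat_inj {a k k' w w' v v' : M} (ha : 0 < a) (ha' : a < 16) (h : Repeat a k w)
    (h' : Repeat a k' w') (hv : sym v 0 ≠ a) (hv' : sym v' 0 ≠ a) (he : cat w v = cat w' v') :
    k = k' ∧ w = w' ∧ v = v' := by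
  have hk : k = k' := le_antisymm (not_lt.1 (h'.count_not_lt ha ha' h hv' he.symm))
    (not_lt.1 (h.count_not_lt ha ha' h' hv he))
  subst hk
  obtain rfl := h.unique h'
  exact ⟨rfl, rfl, cat_left_cancel he⟩

theorem index_eq (i : M) : index i = 2 * 16 ^ i := by
  rw [index, nat_eq_cast, nat_eq_cast]; rfl

theorem len_index (i : M) : len (index i) = i + 1 := by
  rw [index_eq]
  refine len_eq (le_mul_of_one_le_left' (by norm_num)) ?_
  rw [exp_succ, mul_comm]
  exact mul_lt_mul_of_pos_left (by norm_num) (exp_sixteen_pos _)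

theorem sym_index_self (i : M) : sym (index i) i = 2 := by
  have := digit_add_ge (b := 16) (l := i) (u := 0) 2 0 (exp_sixteen_pos _)
  rwa [zero_add, add_zero, digit_zero (by norm_num), ← index_eq] at this

theorem sym_index_lt {i k : M} (h : k < i) : sym (index i) k = 0 := by
  have := digit_add_lt (b := 16) 0 2 h
  rw [zero_add, ← index_eq] at this
  rw [sym, this]
  exact sym_zero k

theorem allSym_index (i : M) : AllSym (fun a => a = 0 ∨ a = 2) (index i) := by
  intro k hk
  rw [len_index] at hk
  rcases (lt_add_one_iff'.1 hk).lt_or_eq with h | rfl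
  · exact .inl (sym_index_lt h)
  · exact .inr (sym_index_self _)

theorem index_not_lt {i i' v v' : M} (h : cat (index i) v = cat (index i') v') : ¬ i < i' := by
  intro hlt
  have h1 : sym (cat (index i) v) i = 2 := by
    rw [sym_cat_lt v (by rw [len_index]; exact lt_add_one _), sym_index_self]
  rw [h, sym_cat_lt v' (by rw [len_index]; exact hlt.trans (lt_add_one _)), sym_index_lt hlt] at h1
  exact absurd h1 (by norm_num)

/-- Indices are self-delimiting: the first symbol `2` ends the index. -/
theorem index_cat_inj {i i' v v' : M} (h : cat (index i) v = cat (index i') v') :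
    i = i' ∧ v = v' := by
  have hi : i = i' := le_antisymm (not_lt.1 (index_not_lt h.symm)) (not_lt.1 (index_not_lt h))
  subst hi
  exact ⟨rfl, cat_left_cancel h⟩

end RCAStar

namespace RCAStar

variable {M : Type u} [Model M]

/-! ## Unique readability -/

/-- The symbol that begins an atomic formula. -/
noncomputable def Atom.tag : Atom M → M
  | .eq _ _ => 5
  | .const _ => 6
  | .fn _ _ => 7
  | .rel _ _ => 8

/-- The indices in an atomic formula. -/
def Atom.indices : Atom M → List M
  | .eq i j => [i, j]
  | .const i => [i]
  | .fn i j => [i, j]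
  | .rel X args => X :: args

theorem Atom.pieces_eq (α : Atom M) : α.pieces = α.tag :: α.indices.map index := by
  cases α <;> simp [Atom.pieces, Atom.tag, Atom.indices, nat_eq_cast]

theorem Atom.tag_bounds (α : Atom M) : 5 ≤ α.tag ∧ α.tag ≤ 8 := by
  cases α <;> simp only [Atom.tag] <;> norm_num

theorem Atom.tag_pos (α : Atom M) : 0 < α.tag := lt_of_lt_of_le (by norm_num) α.tag_bounds.1

theorem Atom.tag_lt (α : Atom M) : α.tag < 16 := lt_of_le_of_lt α.tag_bounds.2 (by norm_num)

/-- The tag fixes the number of indices, for relation atoms through the common arity `d`. The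
indices can then be read one after the other. -/
theorem Atom.eq_of_tag_of_indices {r k r' k' : M} {d : ℕ} {α β : Atom M} (hα : α.Fits r k d)
    (hβ : β.Fits r' k' d) (ht : α.tag = β.tag)
    (hi : concat (α.indices.map index) = concat (β.indices.map index)) : α = β := by
  have key : ∀ l l' : List M, l.length = l'.length →
      concat (l.map index) = concat (l'.map index) → l = l' := by
    intro l
    induction l with
    | nil => intro l' hl _; exact (List.length_eq_zero_iff.1 hl.symm).symm
    | cons i l ih =>
      intro l' hl h
      obtain _ | ⟨i', l'⟩ := l'
      · simp at hl
      · rw [List.map_cons, List.map_cons, concat_cons, concat_cons] at h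
        obtain ⟨rfl, h'⟩ := index_cat_inj h
        rw [ih l' (by simpa using hl) h']
  have hl : α.indices.length = β.indices.length := by
    cases α <;> cases β <;> simp only [Atom.tag] at ht <;>
      first
      | rfl
      | (simp only [Atom.Fits] at hα hβ; simp [Atom.indices, hα.2.1, hβ.2.1])
      | norm_num at ht
  have h := key _ _ hl hi
  cases α <;> cases β <;> simp only [Atom.tag] at ht <;>
    first
    | (exfalso; revert ht; norm_num; done)
    | (simp only [Atom.indices, List.cons.injEq, and_true] at h; simp [h])

/-- The symbol for the sign of a literal. -/
noncomputable def signSym (p : Bool) : M := if p then 3 else 4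

/-- The symbol is a sign. -/
def IsSign (a : M) : Prop := a = 3 ∨ a = 4

instance : IsPred (IsSign : M → Prop) := ⟨by unfold IsSign; infer_instance⟩

theorem isSign_signSym (p : Bool) : IsSign (signSym p : M) := by
  cases p <;> simp [signSym, IsSign]

theorem signSym_pos (p : Bool) : (0 : M) < signSym p := by
  cases p <;> simp [signSym]

theorem signSym_lt (p : Bool) : (signSym p : M) < 16 := by
  cases p <;> simp only [signSym] <;> norm_num

theorem isLiteralOf_iff {p : Bool} {α : Atom M} {w : M} : IsLiteralOf p α w ↔
    w = cat (signSym p) (cat α.tag (concat (α.indices.map index))) := by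
  rw [IsLiteralOf, concat_iff, concat_cons, Atom.pieces_eq, concat_cons, nat_eq_cast, nat_eq_cast]
  rfl

theorem symbol_cat_inj {a a' v v' : M} (ha : 0 < a) (ha' : a < 16) (hb : 0 < a') (hb' : a' < 16)
    (h : cat a v = cat a' v') : a = a' ∧ v = v' :=
  cat_inj ((len_symbol ha ha').trans (len_symbol hb hb').symm) h

theorem IsLiteralOf.unique {r k r' k' : M} {d : ℕ} {p p' : Bool} {α α' : Atom M} {w : M}
    (hα : α.Fits r k d) (hα' : α'.Fits r' k' d) (h : IsLiteralOf p α w)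
    (h' : IsLiteralOf p' α' w) : p = p' ∧ α = α' := by
  rw [isLiteralOf_iff] at h h'
  obtain ⟨hp, h1⟩ := symbol_cat_inj (signSym_pos _) (signSym_lt _) (signSym_pos _) (signSym_lt _)
    (h.symm.trans h')
  obtain ⟨ht, h2⟩ := symbol_cat_inj α.tag_pos α.tag_lt α'.tag_pos α'.tag_lt h1
  refine ⟨?_, Atom.eq_of_tag_of_indices hα hα' ht h2⟩
  cases p <;> cases p' <;> simp only [signSym] at hp <;> first | rfl | norm_num at hp

theorem Atom.allSym_pieces (Q : M → Prop) (h0 : Q 0) (h2 : Q 2) (hQ : ∀ a, 5 ≤ a → a ≤ 8 → Q a)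
    (α : Atom M) : AllSym Q (cat α.tag (concat (α.indices.map index))) := by
  rw [allSym_cat]
  refine ⟨allSym_symbol α.tag_pos α.tag_lt (hQ _ α.tag_bounds.1 α.tag_bounds.2),
    AllSym.concat fun w hw => ?_⟩
  obtain ⟨i, -, rfl⟩ := List.mem_map.1 hw
  exact (allSym_index i).mono fun a ha => by rcases ha with rfl | rfl <;> assumption

theorem IsLiteralOf.marked {p : Bool} {α : Atom M} {w : M} (h : IsLiteralOf p α w) :
    Marked IsSign w := by
  rw [isLiteralOf_iff] at h
  subst h
  refine Marked.cat_symbol (signSym_pos _) (signSym_lt _) (isSign_signSym p)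
    (α.allSym_pieces _ ?_ ?_ ?_)
  · simp [IsSign]
  · simp only [IsSign]; norm_num
  · rintro a ha - (rfl | rfl)
    · exact absurd ha (not_le.2 (by norm_num))
    · exact absurd ha (not_le.2 (by norm_num))

theorem IsLiteralOf.allSym {p : Bool} {α : Atom M} {w : M} (h : IsLiteralOf p α w) :
    AllSym (fun a => a ≤ 8) w := by
  rw [isLiteralOf_iff] at h
  subst h
  rw [allSym_cat]
  refine ⟨allSym_symbol (signSym_pos _) (signSym_lt _) ?_, α.allSym_pieces (fun a => a ≤ 8) zero_le ?_ ?_⟩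
  · cases p <;> simp only [signSym] <;> norm_num
  · norm_num
  · exact fun a _ h => h

theorem IsLiteral.marked {r k w : M} {d : ℕ} (h : IsLiteral r k d w) : Marked IsSign w := by
  obtain ⟨p, α, -, h⟩ := h
  exact h.marked

theorem IsLiteral.allSym {r k w : M} {d : ℕ} (h : IsLiteral r k d w) :
    AllSym (fun a => a ≤ 8) w := by
  obtain ⟨p, α, -, h⟩ := h
  exact h.allSym

instance isPred_le (c : M) : IsPred (fun a => a ≤ c) := ⟨inferInstance⟩

instance isPred_eq (c : M) : IsPred (fun a => a = c) := ⟨inferInstance⟩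

theorem allSym_le_of_le {c c' w : M} (h : c ≤ c') (hw : AllSym (fun a => a ≤ c) w) :
    AllSym (fun a => a ≤ c') w := hw.mono fun _ ha => ha.trans h

theorem allSym_ne_of_lt {c c' w : M} (h : c < c') (hw : AllSym (fun a => a ≤ c) w) :
    AllSym (fun a => ¬ a = c') w := hw.mono fun _ ha => (ha.trans_lt h).ne

theorem nine_pos : (0 : M) < 9 := by norm_num
theorem nine_lt : (9 : M) < 16 := by norm_num

theorem isClause_iff {r k w : M} {d : ℕ} :
    IsClause r k d w ↔ ∃ v, Built (IsLiteral r k d) v ∧ w = cat 9 v := by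
  simp [IsClause, concat_iff, concat_cons, concat_nil, cat_zero, nat_eq_cast]

theorem isClause_concat {r k : M} {d : ℕ} {l : List M} (h : ∀ x ∈ l, IsLiteral r k d x) :
    IsClause r k d (cat 9 (concat l)) :=
  isClause_iff.2 ⟨_, .concat h, rfl⟩

theorem marked_clause {v : M} (hv : AllSym (fun a => a ≤ 8) v) :
    Marked (fun a => a = 9) (cat 9 v) :=
  Marked.cat_symbol nine_pos nine_lt rfl (allSym_ne_of_lt (by norm_num) hv)

theorem IsClause.allSym {r k w : M} {d : ℕ} (h : IsClause r k d w) :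
    AllSym (fun a => a ≤ 9) w := by
  obtain ⟨v, hv, rfl⟩ := isClause_iff.1 h
  exact allSym_cat.2 ⟨allSym_symbol nine_pos nine_lt le_rfl,
    allSym_le_of_le (by norm_num) (hv.allSym _ fun _ => IsLiteral.allSym)⟩

theorem IsMatrix.allSym {r k w : M} {d : ℕ} (h : IsMatrix r k d w) : AllSym (fun a => a ≤ 9) w :=
  Built.allSym h _ fun _ => IsClause.allSym

theorem sym_le_of_allSym {c w : M} (h : AllSym (fun a => a ≤ c) w) (k : M) : sym w k ≤ c := by
  rcases lt_or_ge k (len w) with hk | hk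
  · exact h k hk
  · rw [sym_of_len_le hk]; exact zero_le

/-! ### Prenex formulas -/

/-- The symbol for a first-order quantifier. -/
noncomputable def quantSym (p : Bool) : M := if p then 10 else 11

theorem quantSym_bounds (p : Bool) : (10 : M) ≤ quantSym p ∧ (quantSym p : M) ≤ 11 := by
  cases p <;> simp only [quantSym] <;> norm_num

theorem quantSym_pos (p : Bool) : (0 : M) < quantSym p :=
  lt_of_lt_of_le (by norm_num) (quantSym_bounds p).1

theorem quantSym_lt (p : Bool) : (quantSym p : M) < 16 :=
  lt_of_le_of_lt (quantSym_bounds p).2 (by norm_num)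

theorem quantSym_inj {p q : Bool} (h : (quantSym p : M) = quantSym q) : p = q := by
  cases p <;> cases q <;> simp only [quantSym] at h <;> first | rfl | norm_num at h

theorem sym_of_nine_lt {w a : M} (hw : AllSym (fun a => a ≤ 9) w) (ha : 10 ≤ a) : sym w 0 ≠ a := by
  rintro rfl
  exact absurd (ha.trans (sym_le_of_allSym hw 0)) (not_le.2 (by norm_num))

/-- `us` are the strings for the blocks of quantifiers. -/
abbrev BlockStrings (L : List (Bool × M)) (us : List M) : Prop :=
  List.Forall₂ (fun (p : Bool × M) (y : M) => Repeat (quantSym p.1) p.2 y) L us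

theorem BlockStrings.sym_zero {p : Bool × M} {L : List (Bool × M)} {us : List M} (v : M)
    (h : BlockStrings (p :: L) us) (hp : p.2 ≠ 0) :
    sym (cat (concat us) v) 0 = quantSym p.1 := by
  obtain ⟨y, us, hy, -, rfl⟩ := List.forall₂_cons_left_iff.1 h
  have hy0 : y ≠ 0 := by
    rw [← len_pos, hy.len (quantSym_pos _) (quantSym_lt _)]
    exact pos_iff_ne_zero.2 hp
  rw [concat_cons, cat_assoc, sym_cat_zero _ hy0, hy.sym_zero (quantSym_pos _) (quantSym_lt _) hp]

/-- Blocks are nonempty, neighbouring blocks have different quantifiers, and matrices contain no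
symbol above `9`. So each block is a maximal run of one quantifier symbol. There are standardly many
blocks, which allows induction on the list. -/
theorem BlockStrings.unique {L L' : List (Bool × M)} {us us' : List M} {m m' : M}
    (h : BlockStrings L us) (h' : BlockStrings L' us')
    (hc : L.IsChain (fun p q => p.1 ≠ q.1)) (hc' : L'.IsChain (fun p q => p.1 ≠ q.1))
    (h0 : ∀ p ∈ L, p.2 ≠ 0) (h0' : ∀ p ∈ L', p.2 ≠ 0)
    (hm : AllSym (fun a => a ≤ 9) m) (hm' : AllSym (fun a => a ≤ 9) m')
    (he : cat (concat us) m = cat (concat us') m') : L = L' ∧ m = m' := by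
  have next : ∀ (p : Bool × M) (L : List (Bool × M)) (us : List M) (m : M), BlockStrings L us →
      (p :: L).IsChain (fun p q => p.1 ≠ q.1) → (∀ p ∈ L, p.2 ≠ 0) → AllSym (fun a => a ≤ 9) m →
      sym (cat (concat us) m) 0 ≠ quantSym p.1 := by
    intro p L us m h hc h0 hm
    obtain _ | ⟨q, L⟩ := L
    · obtain rfl := List.forall₂_nil_left_iff.1 h
      rw [concat_nil, zero_cat]
      exact sym_of_nine_lt hm (quantSym_bounds _).1
    · rw [h.sym_zero m (h0 q (by simp))]
      exact fun h => (List.isChain_cons_cons.1 hc).1 (quantSym_inj h.symm)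
  induction L generalizing L' us us' with
  | nil =>
    obtain rfl := List.forall₂_nil_left_iff.1 h
    obtain _ | ⟨q, L'⟩ := L'
    · obtain rfl := List.forall₂_nil_left_iff.1 h'
      rw [concat_nil, zero_cat, zero_cat] at he
      exact ⟨rfl, he⟩
    · have := h'.sym_zero m' (h0' q (by simp))
      rw [← he, concat_nil, zero_cat] at this
      exact absurd this (sym_of_nine_lt hm (quantSym_bounds _).1)
  | cons p L ih =>
    obtain _ | ⟨q, L'⟩ := L'
    · obtain rfl := List.forall₂_nil_left_iff.1 h'
      have := h.sym_zero m (h0 p (by simp))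
      rw [he, concat_nil, zero_cat] at this
      exact absurd this (sym_of_nine_lt hm' (quantSym_bounds _).1)
    · have h1 := h.sym_zero m (h0 p (by simp))
      rw [he, h'.sym_zero m' (h0' q (by simp))] at h1
      have hpq : q.1 = p.1 := quantSym_inj h1
      obtain ⟨y, us, hy, hus, rfl⟩ := List.forall₂_cons_left_iff.1 h
      obtain ⟨y', us', hy', hus', rfl⟩ := List.forall₂_cons_left_iff.1 h'
      rw [hpq] at hy'
      rw [concat_cons, concat_cons, cat_assoc, cat_assoc] at he
      obtain ⟨hk, -, he⟩ := hy.cat_inj (quantSym_pos _) (quantSym_lt _) hy'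
        (next p L us m hus hc (fun r hr => h0 r (by simp [hr])) hm)
        (hpq ▸ next q L' us' m' hus' hc' (fun r hr => h0' r (by simp [hr])) hm') he
      obtain ⟨rfl, rfl⟩ := ih hus hus' (List.IsChain.of_cons hc) (List.IsChain.of_cons hc')
        (fun r hr => h0 r (by simp [hr])) (fun r hr => h0' r (by simp [hr])) he
      exact ⟨by rw [Prod.ext hpq.symm hk], rfl⟩

theorem Prenex.isCode_iff {Q : M} {φ : Prenex M} {w : M} : φ.IsCode Q w ↔
    ∃ x us, Repeat Q φ.rels x ∧ BlockStrings φ.blocks us ∧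
      w = cat x (cat (concat us) φ.matrix) := by
  simp only [Prenex.IsCode, concat_iff, List.cons_append, concat_cons, concat_append, concat_nil,
    cat_zero, nat_eq_cast]
  rfl

theorem Prenex.IsCode.sym_ne {φ : Prenex M} {n d : ℕ} {Q : M} {us : List M} (hQ : 12 ≤ Q)
    (hφ : φ.IsWF n d) (h : BlockStrings φ.blocks us) :
    sym (cat (concat us) φ.matrix) 0 ≠ Q := by
  obtain ⟨-, -, h0, hm⟩ := hφ
  have hm := hm.allSym
  have hQ10 : 10 ≤ Q := le_trans (by norm_num) hQ
  rcases hb : φ.blocks with _ | ⟨p, L⟩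
  · rw [hb] at h
    obtain rfl := List.forall₂_nil_left_iff.1 h
    rw [concat_nil, zero_cat]
    exact sym_of_nine_lt hm hQ10
  · rw [hb] at h
    rw [h.sym_zero _ (h0 p (by simp [hb]))]
    rintro rfl
    exact absurd (hQ.trans (quantSym_bounds p.1).2) (not_le.2 (by norm_num))

theorem Prenex.IsCode.unique {φ ψ : Prenex M} {n d : ℕ} {Q w : M} (hQ : 12 ≤ Q) (hQ' : Q < 16)
    (hφ : φ.IsWF n d) (hψ : ψ.IsWF n d) (h : φ.IsCode Q w) (h' : ψ.IsCode Q w) : φ = ψ := by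
  obtain ⟨x, us, hx, hus, rfl⟩ := isCode_iff.1 h
  obtain ⟨x', us', hx', hus', he⟩ := isCode_iff.1 h'
  obtain ⟨hr, -, he⟩ := hx.cat_inj (lt_of_lt_of_le (by norm_num) hQ) hQ' hx'
    (Prenex.IsCode.sym_ne hQ hφ hus) (Prenex.IsCode.sym_ne hQ hψ hus') he
  obtain ⟨hb, hm⟩ := hus.unique hus' hφ.2.1 hψ.2.1 hφ.2.2.1 hψ.2.2.1 hφ.2.2.2.allSym
    hψ.2.2.2.allSym he
  cases φ; cases ψ
  simp_all

theorem Prenex.IsCode.allSym {φ : Prenex M} {n d : ℕ} {w : M}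
    (hφ : φ.IsWF n d) (h : φ.IsCode 12 w) : AllSym (fun a => a ≤ 13) w := by
  obtain ⟨x, us, hx, hus, rfl⟩ := isCode_iff.1 h
  rw [allSym_cat, allSym_cat]
  refine ⟨(hx.allSym (by norm_num) (by norm_num)).mono ?_, AllSym.concat fun u hu => ?_,
    allSym_le_of_le (by norm_num) hφ.2.2.2.allSym⟩
  · rintro a rfl
    norm_num
  · obtain ⟨p, -, hp⟩ : ∃ p ∈ φ.blocks, Repeat (quantSym p.1) p.2 u := by
      generalize φ.blocks = L at hus
      clear h
      induction hus with
      | nil => simp at hu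
      | cons hab _ ih =>
        rcases List.mem_cons.1 hu with rfl | hu
        · exact ⟨_, List.mem_cons_self, hab⟩
        · obtain ⟨p, hp, h⟩ := ih hu
          exact ⟨p, by simp [hp], h⟩
    refine (hp.allSym (quantSym_pos _) (quantSym_lt _)).mono ?_
    rintro a rfl
    exact (quantSym_bounds p.1).2.trans (by norm_num)

theorem isConjCode_iff {n d : ℕ} {σ π : Prenex M} {ξ : M} : IsConjCode n d σ π ξ ↔
    σ.IsWF n d ∧ π.IsWF n d ∧ ∃ u v, σ.IsCode 12 u ∧ π.IsCode 13 v ∧ ξ = cat u (cat 14 v) := by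
  simp [IsConjCode, concat_iff, concat_cons, concat_nil, cat_zero, nat_eq_cast]

/-- The symbol `14` does not occur in the first part, so its first occurrence separates the two
parts. Hence the existential quantifier over parsings in `Struct.Sat` has at most one witness. -/
theorem IsConjCode.unique {n d : ℕ} {σ π σ' π' : Prenex M} {ξ : M} (h : IsConjCode n d σ π ξ)
    (h' : IsConjCode n d σ' π' ξ) : σ = σ' ∧ π = π' := by
  obtain ⟨hσ, hπ, u, v, hu, hv, rfl⟩ := isConjCode_iff.1 h
  obtain ⟨hσ', hπ', u', v', hu', hv', he⟩ := isConjCode_iff.1 h'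
  have h14 : (0 : M) < 14 := by norm_num
  have h14' : (14 : M) < 16 := by norm_num
  have key : ∀ {u v u' v' : M}, AllSym (fun a => a ≤ 13) u' →
      cat u (cat 14 v) = cat u' (cat 14 v') → ¬ len u < len u' := by
    intro u v u' v' hu' he hlt
    have h1 : sym (cat u (cat 14 v)) (len u) = 14 := by
      rw [sym_cat_len, sym_cat_zero _ h14.ne', sym_symbol h14']
    rw [he, sym_cat_lt _ hlt] at h1
    exact absurd (h1 ▸ hu' _ hlt) (not_le.2 (by norm_num))
  obtain ⟨rfl, he'⟩ := cat_inj (le_antisymm (not_lt.1 (key (hu.allSym hσ) he.symm))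
    (not_lt.1 (key (hu'.allSym hσ') he))) he
  obtain rfl := cat_left_cancel he'
  exact ⟨hu.unique le_rfl (by norm_num) hσ hσ' hu', hv.unique (by norm_num) (by norm_num) hπ hπ' hv'⟩

/-! ## Truth -/

namespace Struct

variable {𝒳 : Set (Set M)} (𝔸 : Struct M 𝒳) {r k : M} {d : ℕ} {Z : Set M} {b s : M}

theorem literalTrue_iff {p : Bool} {α : Atom M} {w : M} (hα : α.Fits r k d)
    (hw : IsLiteralOf p α w) :
    𝔸.LiteralTrue r k d Z b s w ↔ (p = true ↔ 𝔸.AtomTrue Z b s α) := by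
  constructor
  · rintro ⟨p', α', hα', hw', h⟩
    obtain ⟨rfl, rfl⟩ := hw.unique hα hα' hw'
    exact h
  · exact fun h => ⟨p, α, hα, hw, h⟩

variable {𝔸} in
theorem LiteralTrue.isLiteral {w : M} (h : 𝔸.LiteralTrue r k d Z b s w) : IsLiteral r k d w := by
  obtain ⟨p, α, hα, hw, -⟩ := h
  exact ⟨p, α, hα, hw⟩

theorem clauseTrue_iff {w : M} : 𝔸.ClauseTrue r k d Z b s w ↔ ∃ u x v, Built (IsLiteral r k d) u ∧
    𝔸.LiteralTrue r k d Z b s x ∧ Built (IsLiteral r k d) v ∧ w = cat 9 (cat u (cat x v)) := by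
  simp [ClauseTrue, concat_iff, concat_cons, concat_nil, cat_zero, nat_eq_cast]

variable {𝔸} in
theorem ClauseTrue.marked {w : M} (h : 𝔸.ClauseTrue r k d Z b s w) :
    Marked (fun a => a = 9) w := by
  obtain ⟨u, x, v, hu, hx, hv, rfl⟩ := 𝔸.clauseTrue_iff.1 h
  refine marked_clause ?_
  rw [allSym_cat, allSym_cat]
  exact ⟨hu.allSym _ fun _ => IsLiteral.allSym, hx.isLiteral.allSym,
    hv.allSym _ fun _ => IsLiteral.allSym⟩

theorem _root_.RCAStar.Built.starts {P : M → Prop} {Q : M → Prop} [IsPred Q]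
    (hP : ∀ x, P x → Marked Q x) {w : M} (hw : Built P w) : Starts Q w := by
  have : IsPred (Starts Q) := ⟨by unfold Starts; infer_instance⟩
  refine hw.induct (Starts Q) (.inl rfl) fun u x hu hx => ?_
  rcases eq_or_ne u 0 with rfl | h0
  · rw [zero_cat]
    exact .inr (hP x hx).2.1
  · rcases hu with h | h
    · exact absurd h h0
    · exact .inr (by rw [sym_cat_zero _ h0]; exact h)

/-- For a standard list, unique decomposition identifies a marked segment with a member of the list
itself, which is more than `Built.of_piece` gives. -/
theorem _root_.RCAStar.mem_of_concat_eq {Q : M → Prop} {l : List M} (hl : ∀ x ∈ l, Marked Q x)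
    {u x v : M} (hx : Marked Q x) (hv : Starts Q v) (h : concat l = cat u (cat x v)) : x ∈ l := by
  have starts : ∀ l : List M, (∀ x ∈ l, Marked Q x) → Starts Q (concat l) := by
    intro l hl
    obtain _ | ⟨y, l⟩ := l
    · exact .inl rfl
    · exact (hl y (by simp)).starts_cat _
  induction l generalizing u with
  | nil =>
    rw [concat_nil] at h
    exact absurd (cat_eq_zero.1 (cat_eq_zero.1 h.symm).2).1 hx.1
  | cons y l ih =>
    have hy := hl y (by simp)
    have hl' : ∀ x ∈ l, Marked Q x := fun x hx => hl x (by simp [hx])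
    rw [concat_cons] at h
    rcases eq_or_ne u 0 with rfl | hu
    · rw [zero_cat] at h
      obtain ⟨rfl, -⟩ := hy.unique hx (starts l hl') hv h
      exact List.mem_cons_self
    · have hle : len y ≤ len u := by
        refine not_lt.1 fun hlt => hy.2.2 _ (len_pos.2 hu) hlt ?_
        rw [← sym_cat_lt (concat l) hlt, h, sym_cat_len, sym_cat_zero v hx.1]
        exact hx.2.1
      obtain ⟨u', rfl, h'⟩ := cat_prefix h.symm hle
      exact List.mem_cons_of_mem _ (ih hl' h')

theorem clauseTrue_concat_iff {l : List M} (hl : ∀ x ∈ l, IsLiteral r k d x) :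
    𝔸.ClauseTrue r k d Z b s (cat 9 (concat l)) ↔ ∃ x ∈ l, 𝔸.LiteralTrue r k d Z b s x := by
  rw [clauseTrue_iff]
  constructor
  · rintro ⟨u, x, v, -, hx, hv, h⟩
    exact ⟨x, mem_of_concat_eq (fun x hx => (hl x hx).marked) hx.isLiteral.marked
      (hv.starts fun _ => IsLiteral.marked) (cat_left_cancel h), hx⟩
  · rintro ⟨x, hx, hT⟩
    obtain ⟨l₁, l₂, rfl⟩ := List.append_of_mem hx
    refine ⟨concat l₁, x, concat l₂, .concat fun y hy => hl y (by simp [hy]), hT,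
      .concat fun y hy => hl y (by simp [hy]), ?_⟩
    rw [concat_append, concat_cons]

variable {𝔸} in
theorem MatrixTrue.clauseTrue {u x v : M} (h : 𝔸.MatrixTrue r k d Z b s (cat u (cat x v)))
    (hx : Marked (fun a => a = 9) x) (hv : Starts (fun a => a = 9) v) :
    𝔸.ClauseTrue r k d Z b s x :=
  Built.of_piece (fun a => a = 9) (fun _ => ClauseTrue.marked) h hx hv

end Struct

end RCAStar

namespace RCAStar

variable {M : Type u} [Model M]

/-! ## Pairs -/

/-- The pair lies between `(x + y)²` and `(x + y + 1)²`, the latter excluded, so it determines `x +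
y`. -/
theorem pair_inj {x y x' y' : M} (h : pair x y = pair x' y') : x = x' ∧ y = y' := by
  have key : ∀ {x y x' y' : M}, pair x y = pair x' y' → ¬ x + y < x' + y' := by
    intro x y x' y' h hlt
    obtain ⟨z, hz⟩ := lt_iff_exists_add_one.1 hlt
    have : pair x y < pair x' y' := by
      rw [pair, pair, hz]
      calc (x + y) * (x + y) + x ≤ (x + y) * (x + y) + (x + y) := by gcongr; exact le_self_add
        _ < (x + y) * (x + y) + (x + y) + 1 := lt_add_one _
        _ ≤ (x + y) * (x + y) + (x + y) + 1 + ((x + y) + 2 * (x + y) * z + z * z + 2 * z + x') :=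
          le_self_add
        _ = (x + y + (z + 1)) * (x + y + (z + 1)) + x' := by ring
    exact this.ne h
  have hs : x + y = x' + y' := le_antisymm (not_lt.1 (key h.symm)) (not_lt.1 (key h))
  rw [pair, pair, hs] at h
  obtain rfl := add_left_cancel h
  exact ⟨rfl, add_left_cancel hs⟩

theorem le_pair_left (x y : M) : x ≤ pair x y := le_add_self

theorem le_pair_right (x y : M) : y ≤ pair x y := by
  rcases (zero_le : 0 ≤ y).eq_or_lt with rfl | hy
  · exact zero_le
  · have : y ≤ x + y := le_add_self
    calc y ≤ (x + y) * (x + y) :=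
          this.trans (le_mul_of_one_le_right' ((one_le_of_pos hy).trans this))
      _ ≤ pair x y := le_self_add

theorem Struct.mem_of_pair {𝒳 : Set (Set M)} (𝔸 : Struct M 𝒳) {a b : M} (h : pair a b ∈ 𝔸.F) :
    a ∈ 𝔸.A ∧ b ∈ 𝔸.A := by
  obtain ⟨a', ha, b', hb, he⟩ := 𝔸.F_sub _ h
  obtain ⟨rfl, rfl⟩ := pair_inj he
  exact ⟨ha, hb⟩

/-! ## Sentences that express the existence of an iterate -/

/-- The clause `f(vᵢ) = vᵢ₊₁`. -/
noncomputable def stepClause (i : M) : M :=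
  cat 9 (concat [cat 3 (cat 7 (concat [index i, index (i + 1)]))])

/-- The clause `v₀ = c`. -/
noncomputable def baseClause : M := cat 9 (concat [cat 3 (cat 6 (concat [index 0]))])

/-- The position of the clause `f(vᵢ) = vᵢ₊₁`. -/
noncomputable def pos (i : M) : M := i * i + 5 * i

theorem pos_zero : pos (0 : M) = 0 := by simp [pos]

theorem pos_succ (i : M) : pos (i + 1) = pos i + (6 + 2 * i) := by rw [pos, pos]; ring

instance {n : ℕ} (i : (Fin n → M) → M) [IsFn i] : IsFn (fun e => pos (i e)) := by
  unfold pos; infer_instance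

/-- The number for the clause `f(vᵢ) = vᵢ₊₁` in terms of `s = 16 ^ i`. -/
noncomputable def stepValue (s : M) : M := 1849 + 8192 * s + 2097152 * (s * s)

instance {n : ℕ} (i : (Fin n → M) → M) [IsFn i] : IsFn (fun e => stepValue (i e)) := by
  unfold stepValue; infer_instance

/-- Three symbols `9, 3, 7` and two indices, of lengths `i + 1` and `i + 2`. Summing over smaller
indices gives the polynomial `pos i`. -/
theorem len_stepClause (i : M) : len (stepClause i) = 6 + 2 * i := by
  simp only [stepClause, concat_cons, concat_nil, cat_zero, len_cat, len_index]
  rw [len_symbol (a := 9), len_symbol (a := 3), len_symbol (a := 7)] <;> norm_num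
  ring

/-- The symbols `9, 3, 7` contribute `9 + 3 * 16 + 7 * 16²`, which is `1849`. The indices end with
the symbol `2` at the positions `3 + i` and `5 + 2 * i`, which gives the coefficients `2 * 16³` and
`2 * 16⁵`. -/
theorem stepClause_eq (i : M) : stepClause i = stepValue (16 ^ i) := by
  simp only [stepClause, concat_cons, concat_nil, cat_zero]
  rw [cat, cat, cat, cat, len_index, len_symbol (a := 9), len_symbol (a := 3),
    len_symbol (a := 7)] <;> try norm_num
  rw [index_eq, index_eq, exp_one, exp_succ, stepValue]
  ring

theorem len_baseClause : len (baseClause : M) = 4 := by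
  simp only [baseClause, concat_cons, concat_nil, cat_zero, len_cat, len_index]
  rw [len_symbol (a := 9), len_symbol (a := 3), len_symbol (a := 6)] <;> norm_num

/-- The symbols `9, 3, 6, 2` as digits in base sixteen. -/
theorem baseClause_eq : (baseClause : M) = 9785 := by
  simp only [baseClause, concat_cons, concat_nil, cat_zero]
  rw [cat, cat, cat, len_symbol (a := 9), len_symbol (a := 3),
    len_symbol (a := 6)] <;> try norm_num
  rw [index_eq, exp_one, exp_zero]
  norm_num

theorem isLiteralOf_step (i : M) :
    IsLiteralOf true (.fn i (i + 1)) (cat 3 (cat 7 (concat [index i, index (i + 1)]))) :=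
  isLiteralOf_iff.2 rfl

theorem isLiteralOf_base :
    IsLiteralOf true (.const 0) (cat 3 (cat 6 (concat [index (0 : M)]))) :=
  isLiteralOf_iff.2 rfl

theorem marked_stepClause (i : M) : Marked (fun a => a = 9) (stepClause i) := by
  rw [stepClause, concat_cons, concat_nil, cat_zero]
  exact marked_clause (isLiteralOf_step i).allSym

theorem marked_baseClause : Marked (fun a => a = 9) (baseClause : M) := by
  rw [baseClause, concat_cons, concat_nil, cat_zero]
  exact marked_clause isLiteralOf_base.allSym

/-- `m` is the conjunction of the clauses `f(vᵢ) = vᵢ₊₁` for `i < x` and of the clause `v₀ = c`. -/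
def IsBody (x m : M) : Prop :=
  m = m % 16 ^ pos x + 9785 * 16 ^ pos x ∧
    ∀ i, i < x → m % 16 ^ pos (i + 1) = m % 16 ^ pos i + stepValue (16 ^ i) * 16 ^ pos i

theorem mod_mod_exp {k l : M} (h : k ≤ l) (m : M) : m % 16 ^ l % 16 ^ k = m % 16 ^ k := by
  obtain ⟨z, rfl⟩ := exists_add_of_le' h
  conv_rhs => rw [← div_add_mod m (16 ^ (k + z)), exp_add, mul_assoc, add_comm, add_mul_mod]
  rw [exp_add]

theorem mod_add_exp {k w : M} (v : M) (h : w < 16 ^ k) : (w + v * 16 ^ k) % 16 ^ k = w := by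
  rw [mul_comm, add_mul_mod, mod_of_lt h]

/-- The residues modulo `16 ^ pos i` are the initial parts of the string, so the string is its own
record of the construction. The induction for the step clauses is bounded by `16 ^ pos x`; the base
clause is appended at the end. -/
theorem exists_body (x : M) : ∃ m, IsBody x m := by
  obtain ⟨w, hw, h⟩ : ∃ w : M, w < 16 ^ pos x ∧ ∀ i, i < x →
      w % 16 ^ pos (i + 1) = w % 16 ^ pos i + stepValue (16 ^ i) * 16 ^ pos i := by
    refine induct (P := fun x : M => ∃ w : M, w < 16 ^ pos x ∧ ∀ i, i < x →
      w % 16 ^ pos (i + 1) = w % 16 ^ pos i + stepValue (16 ^ i) * 16 ^ pos i) ?_ ?_ x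
    · exact ⟨0, exp_sixteen_pos _, fun i hi => absurd hi not_lt_zero⟩
    · rintro x ⟨w, hw, h⟩
      have hle : ∀ i j : M, i ≤ j → pos i ≤ pos j := by
        intro i j hij; rw [pos, pos]; gcongr
      have hlt : w + stepValue (16 ^ x) * 16 ^ pos x < 16 ^ pos (x + 1) := by
        rw [pos_succ, exp_add, ← len_stepClause, ← stepClause_eq]
        calc w + stepClause x * 16 ^ pos x < 16 ^ pos x + stepClause x * 16 ^ pos x := by gcongr
          _ = 16 ^ pos x * (stepClause x + 1) := by ring
          _ ≤ _ := by gcongr; exact Order.add_one_le_of_lt (lt_exp_len _)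
      have hmod : ∀ i, i ≤ x →
          (w + stepValue (16 ^ x) * 16 ^ pos x) % 16 ^ pos i = w % 16 ^ pos i := by
        intro i hi
        rw [← mod_mod_exp (hle i x hi), mod_add_exp _ hw]
      refine ⟨w + stepValue (16 ^ x) * 16 ^ pos x, hlt, fun i hi => ?_⟩
      have hi := lt_add_one_iff'.1 hi
      rw [hmod i hi]
      rcases hi.lt_or_eq with hi' | rfl
      · rw [hmod _ (Order.add_one_le_of_lt hi'), h i hi']
      · rw [mod_of_lt hlt, mod_of_lt hw]
  have hle : ∀ i j : M, i ≤ j → pos i ≤ pos j := by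
    intro i j hij; rw [pos, pos]; gcongr
  refine ⟨w + 9785 * 16 ^ pos x, by rw [mod_add_exp _ hw], fun i hi => ?_⟩
  rw [← mod_mod_exp (hle _ _ (Order.add_one_le_of_lt hi)), ← mod_mod_exp (hle _ _ hi.le),
    mod_add_exp _ hw, h i hi]

namespace IsBody

variable {x m : M} (h : IsBody x m)
include h

theorem len_prefix : ∀ {i : M}, i ≤ x → len (m % 16 ^ pos i) = pos i := by
  intro i
  refine induct (P := fun i => i ≤ x → len (m % 16 ^ pos i) = pos i) (fun _ => ?_)
    (fun i ih hi => ?_) i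
  · have : m % 1 = 0 := by simpa using mod_lt m (zero_lt_one' M)
    rw [pos_zero, exp_zero, this, len_zero]
  · have hi : i < x := (lt_add_one i).trans_le hi
    rw [h.2 i hi, ← stepClause_eq]
    have h2 := len_cat (m % 16 ^ pos i) (stepClause i)
    rw [cat, ih hi.le] at h2
    rw [h2, pos_succ, len_stepClause]

theorem eq_cat {i : M} (hi : i ≤ x) : m = cat (m % 16 ^ pos i) (m / 16 ^ pos i) := by
  rw [cat, h.len_prefix hi, mul_comm, add_comm, div_add_mod]

theorem prefix_succ {i : M} (hi : i < x) :
    m % 16 ^ pos (i + 1) = cat (m % 16 ^ pos i) (stepClause i) := by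
  rw [cat, h.len_prefix hi.le, h.2 i hi, stepClause_eq]

theorem div_last : m / 16 ^ pos x = baseClause :=
  div_eq (mod_lt m (exp_sixteen_pos _)) (by
    conv_lhs => rw [h.1]
    rw [baseClause_eq]; ring)

theorem div_eq_cat {i : M} (hi : i < x) :
    m / 16 ^ pos i = cat (stepClause i) (m / 16 ^ pos (i + 1)) := by
  have h1 := h.eq_cat (Order.add_one_le_of_lt hi)
  rw [h.prefix_succ hi, cat_assoc] at h1
  exact cat_left_cancel ((h.eq_cat hi.le).symm.trans h1)

theorem starts {i : M} (hi : i ≤ x) : Starts (fun a => a = 9) (m / 16 ^ pos i) := by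
  rcases hi.lt_or_eq with hi | rfl
  · rw [h.div_eq_cat hi]
    exact (marked_stepClause i).starts_cat _
  · rw [h.div_last]
    exact .inr marked_baseClause.2.1

theorem built {P : M → Prop} (hP : ∀ i, i < x → P (stepClause i)) (h0 : P baseClause) :
    Built P m := by
  rw [h.eq_cat le_rfl, h.div_last]
  refine Built.snoc ?_ h0
  have : IsRel (fun i y : M => y = m % 16 ^ pos i) := ⟨inferInstance⟩
  refine Built.of_fun (fun i => m % 16 ^ pos i) x m (fun i _ => mod_le _ _) ?_
    (fun i hi => ⟨_, hP i hi, h.prefix_succ hi⟩)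
  have := h.len_prefix (i := 0) zero_le
  exact len_eq_zero.1 (this.trans pos_zero)

theorem isMatrix {r k : M} {d : ℕ} (hk : k = x + 1) : IsMatrix r k d m := by
  subst hk
  refine h.built (fun i hi => ?_) ?_
  · refine isClause_concat fun y hy => ?_
    rw [List.mem_singleton.1 hy]
    exact ⟨true, .fn i (i + 1), ⟨hi.trans (lt_add_one _), by gcongr⟩, isLiteralOf_step i⟩
  · refine isClause_concat fun y hy => ?_
    rw [List.mem_singleton.1 hy]
    exact ⟨true, .const 0, pos_add_one _, isLiteralOf_base⟩

/-- In one direction unique decomposition isolates the clause at each position, nonstandard ones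
included. In the other the sequence of residues witnesses that the matrix is built from true
clauses. -/
theorem matrixTrue_iff {𝒳 : Set (Set M)} (𝔸 : Struct M 𝒳) {r k : M} {d : ℕ} {Z : Set M} {b s : M}
    (hk : k = x + 1) : 𝔸.MatrixTrue r k d Z b s m ↔ Entry b s 0 𝔸.c ∧ ∀ i, i < x →
      ∃ a a', Entry b s i a ∧ Entry b s (i + 1) a' ∧ pair a a' ∈ 𝔸.F := by
  subst hk
  have step : ∀ i, i < x → (𝔸.ClauseTrue r (x + 1) d Z b s (stepClause i) ↔
      ∃ a a', Entry b s i a ∧ Entry b s (i + 1) a' ∧ pair a a' ∈ 𝔸.F) := by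
    intro i hi
    have hfit : Atom.Fits r (x + 1) d (.fn i (i + 1)) := ⟨hi.trans (lt_add_one _), by gcongr⟩
    rw [stepClause, 𝔸.clauseTrue_concat_iff]
    · simp [𝔸.literalTrue_iff hfit (isLiteralOf_step i), Struct.AtomTrue]
    · intro y hy
      rw [List.mem_singleton.1 hy]
      exact ⟨true, _, hfit, isLiteralOf_step i⟩
  have base : 𝔸.ClauseTrue r (x + 1) d Z b s baseClause ↔ Entry b s 0 𝔸.c := by
    have hfit : Atom.Fits r (x + 1) d (.const 0) := pos_add_one _
    rw [baseClause, 𝔸.clauseTrue_concat_iff]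
    · simp [𝔸.literalTrue_iff hfit isLiteralOf_base, Struct.AtomTrue]
    · intro y hy
      rw [List.mem_singleton.1 hy]
      exact ⟨true, _, hfit, isLiteralOf_base⟩
  constructor
  · intro hm
    refine ⟨base.1 ?_, fun i hi => (step i hi).1 ?_⟩
    · rw [h.eq_cat le_rfl, h.div_last, ← cat_zero baseClause] at hm
      exact hm.clauseTrue marked_baseClause (.inl rfl)
    · rw [h.eq_cat hi.le, h.div_eq_cat hi] at hm
      exact hm.clauseTrue (marked_stepClause i) (h.starts (Order.add_one_le_of_lt hi))
  · exact fun ⟨h0, hs⟩ => h.built (fun i hi => (step i hi).2 (hs i hi)) (base.2 h0)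

end IsBody

/-- `ξ` is the sentence which expresses that `f^x(c)` exists. -/
def IsIterCode (x ξ : M) : Prop :=
  ∃ r m, Repeat 10 (x + 1) r ∧ IsBody x m ∧ ξ = cat (cat r m) 14

theorem exists_iterCode (x : M) : ∃ ξ, IsIterCode x ξ := by
  obtain ⟨m, hm⟩ := exists_body x
  obtain ⟨r, hr, -⟩ := exists_repeat (a := (10 : M)) (by norm_num) (by norm_num) (x + 1)
  exact ⟨_, r, m, hr, hm, rfl⟩

/-- The `Σ¹₁` part has no second-order quantifier, and the `Π¹₁` part is the empty conjunction, with
empty string. Therefore the code ends with the separating symbol `14`. -/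
theorem isConjCode_iter {n d : ℕ} (hn : 1 ≤ n) {x r m : M} (hr : Repeat 10 (x + 1) r)
    (hm : IsBody x m) :
    IsConjCode n d ⟨0, [(true, x + 1)], m⟩ ⟨0, [], 0⟩ (cat (cat r m) 14) := by
  refine isConjCode_iff.2 ⟨⟨hn, ?_, ?_, ?_⟩, ⟨zero_le, ?_, ?_, ?_⟩, cat r m, 0, ?_, ?_, ?_⟩
  · exact List.isChain_singleton _
  · intro p hp
    rw [List.mem_singleton.1 hp]
    exact (pos_add_one x).ne'
  · exact hm.isMatrix (zero_add _)
  · exact List.isChain_nil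
  · simp
  · exact Built.nil
  · refine Prenex.isCode_iff.2 ⟨0, [r], repeat_iff.2 (by simp [exp_zero]), ?_, ?_⟩
    · exact List.forall₂_cons.2 ⟨hr, .nil⟩
    · rw [zero_cat, concat_cons, concat_nil, cat_zero]
  · exact Prenex.isCode_iff.2 ⟨0, [], repeat_iff.2 (by simp [exp_zero]), .nil,
      by simp [concat_nil, zero_cat]⟩
  · rw [cat_zero]

theorem IsIterCode.isSentence {n d : ℕ} (hn : 1 ≤ n) {x ξ : M} (h : IsIterCode x ξ) :
    IsSentence n d ξ := by
  obtain ⟨r, m, hr, hm, rfl⟩ := h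
  exact ⟨_, _, isConjCode_iter hn hr hm⟩

theorem empty_mem_sets : (∅ : Set M) ∈ Model.sets := by
  have := isSet_of_bdd (P := fun x : M => x < x)
  simpa using this.mem

theorem IsIterCode.sat_iff {n d : ℕ} (hn : 1 ≤ n) {x ξ : M} (h : IsIterCode x ξ)
    (𝔸 : Struct M Model.sets) : 𝔸.Sat n d ξ ↔ 𝔸.IterExists x := by
  obtain ⟨r, m, hr, hm, rfl⟩ := h
  have hc := isConjCode_iter (d := d) hn hr hm
  have key : ∀ Z, 𝔸.KernelTrue d Z ⟨0, [(true, x + 1)], m⟩ ↔ 𝔸.IterExists x := by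
    intro Z
    simp only [Struct.KernelTrue, Struct.FirstOrderTrue, Struct.IterExists,
      hm.matrixTrue_iff 𝔸 (zero_add _)]
    refine exists_congr fun b => exists_congr fun s => ?_
    -- The requirement that the entries lie in `A` is automatic: each of them is `c` or a value of
    -- `f`.
    refine and_iff_right_of_imp fun ⟨h0, hs⟩ => ⟨fun l hl => ?_, fun l hl => absurd hl not_lt_zero⟩
    rw [zero_add] at hl
    rcases (zero_le : 0 ≤ l).eq_or_lt with rfl | hl0
    · exact ⟨_, 𝔸.c_mem, h0⟩
    · obtain ⟨j, rfl⟩ := lt_iff_exists_add_one.1 hl0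
      rw [zero_add] at hl ⊢
      obtain ⟨a, a', -, h2, h3⟩ := hs j (lt_of_add_lt_add_right hl)
      exact ⟨a', (𝔸.mem_of_pair h3).2, h2⟩
  constructor
  · rintro ⟨σ, π, hσ, ⟨Z, -, hZ⟩, -⟩
    obtain ⟨rfl, rfl⟩ := hc.unique hσ
    exact (key Z).1 hZ
  · intro hx
    exact ⟨_, _, hc, ⟨∅, empty_mem_sets, (key _).2 hx⟩, fun Z _ => Built.nil⟩

end RCAStar

namespace RCAStar

variable {M : Type u} [Model M]

/-! ## Strings of standard length -/

theorem natCast_exp (a n : ℕ) : ((a ^ n : ℕ) : M) = (a : M) ^ (n : M) := by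
  induction n with
  | zero => simp [exp_zero]
  | succ n ih => rw [pow_succ, Nat.cast_mul, ih, Nat.cast_succ, exp_succ]

theorem natCast_lt {a b : ℕ} : (a : M) < b ↔ a < b := Nat.cast_lt

theorem exists_of_lt_natCast {x : M} {k : ℕ} (h : x < k) : ∃ j < k, x = j := by
  induction k with
  | zero => simp at h
  | succ k ih =>
    rw [Nat.cast_succ, lt_add_one_iff'] at h
    rcases h.lt_or_eq with h | rfl
    · obtain ⟨j, hj, rfl⟩ := ih h
      exact ⟨j, hj.trans k.lt_succ_self, rfl⟩
    · exact ⟨k, k.lt_succ_self, rfl⟩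

/-- The list consists of symbols and does not end in `0`. -/
def GoodSyms (l : List ℕ) : Prop := (∀ a ∈ l, a < 16) ∧ ∀ h, l.getLast h ≠ 0

theorem GoodSyms.nil : GoodSyms [] := ⟨by simp, by simp⟩

theorem GoodSyms.append {l l' : List ℕ} (h : GoodSyms l) (h' : GoodSyms l') :
    GoodSyms (l ++ l') := by
  refine ⟨fun a ha => (List.mem_append.1 ha).elim (h.1 a) (h'.1 a), fun hn => ?_⟩
  by_cases hl : l' = []
  · subst hl
    simpa using h.2 (by simpa using hn)
  · rw [List.getLast_append_of_right_ne_nil _ _ hl]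
    exact h'.2 hl

theorem GoodSyms.flatten {L : List (List ℕ)} (h : ∀ l ∈ L, GoodSyms l) : GoodSyms L.flatten := by
  induction L with
  | nil => exact .nil
  | cons l L ih => exact (h l (by simp)).append (ih fun l hl => h l (by simp [hl]))

theorem GoodSyms.replicate {a : ℕ} (k : ℕ) (h : a ≠ 0) (h' : a < 16) :
    GoodSyms (List.replicate k a) := by
  refine ⟨fun b hb => (List.eq_of_mem_replicate hb) ▸ h', fun hn => ?_⟩
  rw [List.getLast_replicate]
  exact h

/-- The symbols of an index. -/
def indexSyms (i : ℕ) : List ℕ := List.replicate i 0 ++ [2]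

theorem GoodSyms.index (i : ℕ) : GoodSyms (indexSyms i) := by
  refine ⟨fun a ha => ?_, fun hn => by simp [indexSyms]⟩
  rcases List.mem_append.1 ha with ha | ha
  · rw [List.eq_of_mem_replicate ha]; norm_num
  · rw [List.mem_singleton.1 ha]; norm_num

theorem GoodSyms.symbol {a : ℕ} (h : a ≠ 0) (h' : a < 16) : GoodSyms [a] :=
  GoodSyms.replicate 1 h h'

/-- The string with the given list of symbols. -/
noncomputable def str (l : List ℕ) : M := (Nat.ofDigits 16 l : ℕ)

theorem str_nil : (str [] : M) = 0 := by simp [str]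

theorem str_symbol (a : ℕ) : (str [a] : M) = a := by simp [str]

theorem len_str {l : List ℕ} (h : GoodSyms l) : len (str l : M) = l.length := by
  rcases l.eq_nil_or_concat with rfl | ⟨l', a, rfl⟩
  · simp [str, len_zero]
  · rw [List.concat_eq_append] at h ⊢
    have h1 := Nat.ofDigits_lt_base_pow_length (by norm_num : 1 < 16) h.1
    -- This inequality is stated for the base `b + 2`, whence `14`.
    have h2 := Nat.pow_length_le_mul_ofDigits (b := 14) (l := l' ++ [a]) (by simp) (h.2 _)
    rw [List.length_append, List.length_singleton] at h1 h2 ⊢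
    rw [Nat.cast_add, Nat.cast_one]
    have h16 : ((16 : ℕ) : M) = 16 := by norm_num
    refine len_eq ?_ ?_
    · rw [str, ← h16, ← natCast_exp, Nat.cast_le]
      rw [pow_succ, mul_comm] at h2
      exact Nat.le_of_mul_le_mul_left h2 (by norm_num)
    · rw [str, ← h16, ← Nat.cast_one (R := M), ← Nat.cast_add, ← natCast_exp, Nat.cast_lt]
      exact h1

theorem str_append {l : List ℕ} (h : GoodSyms l) (l' : List ℕ) :
    (str (l ++ l') : M) = cat (str l) (str l') := by
  have h16 : ((16 : ℕ) : M) = 16 := by norm_num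
  rw [cat, len_str h, ← h16, ← natCast_exp, str, str, str, Nat.ofDigits_append]
  push_cast
  ring

theorem str_cons {a : ℕ} (h : a ≠ 0) (h' : a < 16) (l : List ℕ) :
    (str (a :: l) : M) = cat (a : M) (str l) := by
  rw [← List.singleton_append, str_append (.symbol h h'), str_symbol]

theorem str_flatten {L : List (List ℕ)} (h : ∀ l ∈ L, GoodSyms l) :
    (str L.flatten : M) = concat (L.map str) := by
  induction L with
  | nil => exact str_nil
  | cons l L ih =>
    rw [List.flatten_cons, str_append (h l (by simp)), ih fun l hl => h l (by simp [hl]),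
      List.map_cons, concat_cons]

theorem str_index (i : ℕ) : (str (indexSyms i) : M) = index (i : M) := by
  have h16 : ((16 : ℕ) : M) = 16 := by norm_num
  rw [index_eq, ← h16, ← natCast_exp, str, indexSyms, Nat.ofDigits_append,
    Nat.ofDigits_replicate_zero]
  simp [mul_comm]

theorem repeat_str (a k : ℕ) : Repeat (a : M) k (str (List.replicate k a)) := by
  have h16 : ((16 : ℕ) : M) = 16 := by norm_num
  have : Nat.ofDigits 16 (List.replicate k a) * 15 + a = a * 16 ^ k := by
    induction k with
    | zero => simp
    | succ k ih =>
      rw [List.replicate_succ, Nat.ofDigits_cons, pow_succ, ← mul_assoc, ← ih]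
      ring
  rw [repeat_iff, ← h16, ← natCast_exp, ← Nat.cast_mul, ← this, str]
  push_cast
  rfl

/-! ## Standard formulas -/

/-- A quantifier-free formula of standard length in conjunctive normal form. -/
abbrev StdMatrix : Type := List (List (Bool × Atom ℕ))

namespace Atom

/-- The atomic formula with standard indices as an atomic formula of the model. -/
noncomputable def std : Atom ℕ → Atom M
  | .eq i j => .eq i j
  | .const i => .const i
  | .fn i j => .fn i j
  | .rel X args => .rel X (args.map (fun i : ℕ => (i : M)))

/-- The symbols of an atomic formula. -/
def syms : Atom ℕ → List ℕ
  | .eq i j => 5 :: (indexSyms i ++ indexSyms j)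
  | .const i => 6 :: indexSyms i
  | .fn i j => 7 :: (indexSyms i ++ indexSyms j)
  | .rel X args => 8 :: (indexSyms X ++ (args.map indexSyms).flatten)

/-- The first-order variables are below `k`, the relation variables are below `r` and have
arity `d`. -/
def StdFits (r k d : ℕ) : Atom ℕ → Prop
  | .eq i j => i < k ∧ j < k
  | .const i => i < k
  | .fn i j => i < k ∧ j < k
  | .rel X args => X < r ∧ args.length = d ∧ ∀ i ∈ args, i < k

instance (r k d : ℕ) (α : Atom ℕ) : Decidable (α.StdFits r k d) := by
  cases α <;> unfold StdFits <;> infer_instance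

theorem StdFits.fits {r k d : ℕ} {α : Atom ℕ} (h : α.StdFits r k d) :
    (α.std : Atom M).Fits (r : M) k d := by
  cases α <;> simp_all [StdFits, Fits, std]

theorem goodSyms (α : Atom ℕ) : GoodSyms α.syms := by
  have key : ∀ a l, a ≠ 0 → a < 16 → GoodSyms l → GoodSyms (a :: l) :=
    fun a l h h' hl => (GoodSyms.symbol h h').append hl
  cases α <;> refine key _ _ (by norm_num) (by norm_num) ?_
  · exact (GoodSyms.index _).append (GoodSyms.index _)
  · exact GoodSyms.index _
  · exact (GoodSyms.index _).append (GoodSyms.index _)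
  · refine (GoodSyms.index _).append (GoodSyms.flatten fun l hl => ?_)
    obtain ⟨i, -, rfl⟩ := List.mem_map.1 hl
    exact GoodSyms.index i

theorem str_syms (α : Atom ℕ) :
    (str α.syms : M) = cat (α.std : Atom M).tag (concat ((α.std : Atom M).indices.map index)) := by
  cases α <;> simp only [syms, std, tag, indices, List.map_cons, List.map_nil, concat_cons,
    concat_nil, cat_zero] <;>
    rw [str_cons (by norm_num) (by norm_num)]
  · rw [str_append (.index _), str_index, str_index]; norm_num
  · rw [str_index]; norm_num
  · rw [str_append (.index _), str_index, str_index]; norm_num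
  · rw [str_append (.index _), str_index, str_flatten]
    · congr 1
      simp [str_index, Function.comp_def]
    · intro l hl
      obtain ⟨i, -, rfl⟩ := List.mem_map.1 hl
      exact GoodSyms.index i

end Atom

/-- The symbols of a literal. -/
def literalSyms (l : Bool × Atom ℕ) : List ℕ := (if l.1 then 3 else 4) :: l.2.syms

theorem GoodSyms.literal (l : Bool × Atom ℕ) : GoodSyms (literalSyms l) :=
  (GoodSyms.symbol (by split <;> norm_num) (by split <;> norm_num)).append l.2.goodSyms

theorem isLiteralOf_str (l : Bool × Atom ℕ) :
    IsLiteralOf l.1 (l.2.std : Atom M) (str (literalSyms l)) := by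
  rw [isLiteralOf_iff, literalSyms, str_cons (by split <;> norm_num) (by split <;> norm_num),
    Atom.str_syms, signSym]
  congr 1
  split <;> norm_num

/-- The symbols of a clause. -/
def clauseSyms (L : List (Bool × Atom ℕ)) : List ℕ := 9 :: (L.map literalSyms).flatten

theorem GoodSyms.clause (L : List (Bool × Atom ℕ)) : GoodSyms (clauseSyms L) := by
  refine (GoodSyms.symbol (by norm_num) (by norm_num)).append (GoodSyms.flatten fun l hl => ?_)
  obtain ⟨x, -, rfl⟩ := List.mem_map.1 hl
  exact .literal x

theorem str_clauseSyms (L : List (Bool × Atom ℕ)) :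
    (str (clauseSyms L) : M) = cat 9 (concat (L.map fun l => str (literalSyms l))) := by
  rw [clauseSyms, str_cons (by norm_num) (by norm_num), str_flatten, List.map_map]
  · norm_num; rfl
  · intro l hl
    obtain ⟨x, -, rfl⟩ := List.mem_map.1 hl
    exact .literal x

/-- The symbols of a quantifier-free formula. -/
def matrixSyms (m : StdMatrix) : List ℕ := (m.map clauseSyms).flatten

theorem GoodSyms.matrix (m : StdMatrix) : GoodSyms (matrixSyms m) := by
  refine GoodSyms.flatten fun l hl => ?_
  obtain ⟨x, -, rfl⟩ := List.mem_map.1 hl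
  exact .clause x

theorem str_matrixSyms (m : StdMatrix) :
    (str (matrixSyms m) : M) = concat (m.map fun L => str (clauseSyms L)) := by
  rw [matrixSyms, str_flatten, List.map_map]
  · rfl
  · intro l hl
    obtain ⟨x, -, rfl⟩ := List.mem_map.1 hl
    exact .clause x

/-- The indices of the variables in the formula are bounded. -/
def StdMatrix.Fits (r k d : ℕ) (m : StdMatrix) : Prop := ∀ L ∈ m, ∀ l ∈ L, l.2.StdFits r k d

instance (r k d : ℕ) (m : StdMatrix) : Decidable (m.Fits r k d) := by
  unfold StdMatrix.Fits; infer_instance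

theorem isMatrix_str {r k d : ℕ} {m : StdMatrix} (h : m.Fits r k d) :
    IsMatrix (r : M) k d (str (matrixSyms m)) := by
  rw [str_matrixSyms]
  refine Built.concat fun x hx => ?_
  obtain ⟨L, hL, rfl⟩ := List.mem_map.1 hx
  rw [str_clauseSyms]
  refine isClause_concat fun y hy => ?_
  obtain ⟨l, hl, rfl⟩ := List.mem_map.1 hy
  exact ⟨l.1, l.2.std, (h L hL l hl).fits, isLiteralOf_str l⟩

/-! ### Truth of standard formulas -/

namespace Struct

variable {𝒳 : Set (Set M)} (𝔸 : Struct M 𝒳)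

/-- Truth of an atomic formula when `e` gives the values of the variables. -/
def StdAtomTrue (Z : Set M) (e : ℕ → M) : Atom ℕ → Prop
  | .eq i j => e i = e j
  | .const i => e i = 𝔸.c
  | .fn i j => pair (e i) (e j) ∈ 𝔸.F
  | .rel X args => pair (X : M) (tuple (args.map e)) ∈ Z

/-- Truth of a quantifier-free formula when `e` gives the values of the variables. -/
def StdMatrixTrue (Z : Set M) (e : ℕ → M) (m : StdMatrix) : Prop :=
  ∀ L ∈ m, ∃ l ∈ L, (l.1 = true ↔ 𝔸.StdAtomTrue Z e l.2)

theorem atomTrue_std {r k d : ℕ} {Z : Set M} {b s : M} {e : ℕ → M} {α : Atom ℕ}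
    (hα : α.StdFits r k d) (he : ∀ j < k, Entry b s (j : M) (e j)) :
    𝔸.AtomTrue Z b s α.std ↔ 𝔸.StdAtomTrue Z e α := by
  have key : ∀ {j a}, j < k → (Entry b s (j : M) a ↔ e j = a) := fun {j a} hj =>
    ⟨fun h => (he j hj).unique h, fun h => h ▸ he j hj⟩
  cases α with
  | eq i j =>
    simp only [AtomTrue, StdAtomTrue, Atom.std, key hα.1, key hα.2]
    exact ⟨fun ⟨a, h, h'⟩ => h.trans h'.symm, fun h => ⟨_, rfl, h.symm⟩⟩
  | const i => exact key hα
  | fn i j =>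
    simp only [AtomTrue, StdAtomTrue, Atom.std, key hα.1, key hα.2]
    exact ⟨fun ⟨a, a', h, h', hF⟩ => h ▸ h' ▸ hF, fun h => ⟨_, _, rfl, rfl, h⟩⟩
  | rel X args =>
    have hargs : ∀ (args : List ℕ) (as : List M), (∀ i ∈ args, i < k) →
        (List.Forall₂ (Entry b s) (args.map fun i : ℕ => (i : M)) as ↔ as = args.map e) := by
      intro args
      induction args with
      | nil => intro as _; simp
      | cons i args ih =>
        intro as h
        rw [List.map_cons, List.forall₂_cons_left_iff]
        constructor
        · rintro ⟨a, as, ha, has, rfl⟩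
          rw [(ih as fun j hj => h j (by simp [hj])).1 has, List.map_cons,
            (key (h i (by simp))).1 ha]
        · rintro rfl
          exact ⟨_, _, (key (h i (by simp))).2 rfl, (ih _ fun j hj => h j (by simp [hj])).2 rfl, rfl⟩
    simp only [AtomTrue, StdAtomTrue, Atom.std, hargs args _ hα.2.2]
    exact ⟨fun ⟨as, h, h'⟩ => h ▸ h', fun h => ⟨_, rfl, h⟩⟩

theorem matrixTrue_str {r k d : ℕ} {Z : Set M} {b s : M} {e : ℕ → M} {m : StdMatrix}
    (hm : m.Fits r k d) (he : ∀ j < k, Entry b s (j : M) (e j)) :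
    𝔸.MatrixTrue r k d Z b s (str (matrixSyms m)) ↔ 𝔸.StdMatrixTrue Z e m := by
  have clause : ∀ L ∈ m, 𝔸.ClauseTrue r k d Z b s (str (clauseSyms L)) ↔
      ∃ l ∈ L, (l.1 = true ↔ 𝔸.StdAtomTrue Z e l.2) := by
    intro L hL
    rw [str_clauseSyms, 𝔸.clauseTrue_concat_iff]
    · simp only [List.mem_map, exists_exists_and_eq_and]
      refine exists_congr fun l => and_congr_right fun hl => ?_
      rw [𝔸.literalTrue_iff (hm L hL l hl).fits (isLiteralOf_str l),
        𝔸.atomTrue_std (hm L hL l hl) he]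
    · intro y hy
      obtain ⟨l, hl, rfl⟩ := List.mem_map.1 hy
      exact ⟨l.1, l.2.std, (hm L hL l hl).fits, isLiteralOf_str l⟩
  have marked : ∀ L ∈ m, Marked (fun a : M => a = 9) (str (clauseSyms L)) := by
    intro L hL
    rw [str_clauseSyms]
    refine marked_clause (AllSym.concat fun y hy => ?_)
    obtain ⟨l, -, rfl⟩ := List.mem_map.1 hy
    exact (isLiteralOf_str l).allSym
  rw [str_matrixSyms]
  constructor
  · intro h L hL
    refine (clause L hL).1 ?_
    obtain ⟨l₁, l₂, rfl⟩ := List.append_of_mem hL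
    rw [List.map_append, List.map_cons, concat_append, concat_cons] at h
    refine h.clauseTrue (marked L hL) ?_
    obtain _ | ⟨L', l₂⟩ := l₂
    · exact .inl rfl
    · exact (marked L' (by simp)).starts_cat _
  · intro h
    refine Built.concat fun x hx => ?_
    obtain ⟨L, hL, rfl⟩ := List.mem_map.1 hx
    exact (clause L hL).2 (h L hL)

/-- Truth of a first-order formula in prenex form whose free variables are below `i`. -/
def StdTrue (Z : Set M) (m : StdMatrix) : List (Bool × ℕ) → ℕ → (ℕ → M) → Prop
  | [], _, e => 𝔸.StdMatrixTrue Z e m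
  | (true, k) :: L, i, e => ∃ e' : ℕ → M, (∀ l < i + k, e' l ∈ 𝔸.A) ∧ (∀ l < i, e' l = e l) ∧
      StdTrue Z m L (i + k) e'
  | (false, k) :: L, i, e => ∀ e' : ℕ → M, (∀ l < i + k, e' l ∈ 𝔸.A) → (∀ l < i, e' l = e l) →
      StdTrue Z m L (i + k) e'

end Struct

/-- The blocks of quantifiers in the model. -/
noncomputable def stdBlocks (L : List (Bool × ℕ)) : List (Bool × M) := L.map fun p => (p.1, (p.2 : M))

/-- The number of variables in the blocks. -/
def stdWidth (L : List (Bool × ℕ)) : ℕ := (L.map Prod.snd).sum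

theorem width_stdBlocks (L : List (Bool × ℕ)) (i : ℕ) :
    width (stdBlocks L) (i : M) = ((i + stdWidth L : ℕ) : M) := by
  induction L generalizing i with
  | nil => simp [stdBlocks, width, stdWidth]
  | cons p L ih =>
    have := ih (i + p.2)
    simp only [stdBlocks, stdWidth, List.map_cons, width, List.sum_cons] at this ⊢
    rw [← Nat.cast_add, this, add_assoc]

/-- Induction on the standard number `k` in the metatheory, so `e` need not be definable in the
model. -/
theorem exists_std_code (e : ℕ → M) (k : ℕ) : ∃ b s : M, ∀ j < k, Entry b s (j : M) (e j) := by
  induction k with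
  | zero => exact ⟨0, 0, fun j hj => absurd hj (Nat.not_lt_zero j)⟩
  | succ k ih =>
    obtain ⟨b, s, h⟩ := ih
    obtain ⟨b', s', hb, hk, hlt⟩ := exists_append b s (k : M) (e k)
    refine ⟨b', s', fun j hj => ?_⟩
    rcases (Nat.lt_succ_iff.1 hj).lt_or_eq with hj | rfl
    · exact entry_iff.2 ⟨hb, hlt j (natCast_lt.2 hj) _ (h j hj)⟩
    · exact entry_iff.2 ⟨hb, hk⟩

namespace Struct

variable {𝒳 : Set (Set M)} (𝔸 : Struct M 𝒳)

/-- Up to a standard index, coded assignments and external assignments are the same thing, since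
numbers below a standard number are standard. So each block of quantifiers over codes can be
exchanged for one over functions. -/
theorem firstOrderTrue_std {r d : ℕ} {Z : Set M} {m : StdMatrix} (L : List (Bool × ℕ)) {i : ℕ}
    {b s : M} {e : ℕ → M} (hm : m.Fits r (i + stdWidth L) d)
    (he : ∀ j < i, Entry b s (j : M) (e j)) :
    𝔸.FirstOrderTrue r d Z (str (matrixSyms m)) (stdBlocks L) i b s ↔ 𝔸.StdTrue Z m L i e := by
  induction L generalizing i b s e with
  | nil => exact 𝔸.matrixTrue_str hm he
  | cons p L ih =>
    have hm' : m.Fits r (i + p.2 + stdWidth L) d := by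
      rw [add_assoc]; exact hm
    have to_std : ∀ b' s', 𝔸.Extends b s i b' s' (i + p.2 : ℕ) → ∃ e' : ℕ → M,
        (∀ l < i + p.2, e' l ∈ 𝔸.A) ∧ (∀ l < i, e' l = e l) ∧
          ∀ j < i + p.2, Entry b' s' (j : M) (e' j) := by
      intro b' s' h
      have hE : ∀ j < i + p.2, digit b' s' (j : M) ∈ 𝔸.A ∧ Entry b' s' (j : M) (digit b' s' j) := by
        intro j hj
        obtain ⟨a, ha, hE⟩ := h.1 j (natCast_lt.2 hj)
        rw [(entry_iff.1 hE).2]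
        exact ⟨ha, hE⟩
      refine ⟨fun j => digit b' s' j, fun l hl => (hE l hl).1, fun l hl => ?_,
        fun j hj => (hE j hj).2⟩
      exact (entry_iff.1 (h.2 l (natCast_lt.2 hl) _ (he l hl))).2
    have of_std : ∀ e' : ℕ → M, (∀ l < i + p.2, e' l ∈ 𝔸.A) → (∀ l < i, e' l = e l) → ∃ b' s',
        𝔸.Extends b s i b' s' (i + p.2 : ℕ) ∧ ∀ j < i + p.2, Entry b' s' (j : M) (e' j) := by
      intro e' hA heq
      obtain ⟨b', s', h⟩ := exists_std_code e' (i + p.2)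
      refine ⟨b', s', ⟨fun l hl => ?_, fun l hl a ha => ?_⟩, h⟩
      · obtain ⟨j, hj, rfl⟩ := exists_of_lt_natCast hl
        exact ⟨_, hA j hj, h j hj⟩
      · obtain ⟨j, hj, rfl⟩ := exists_of_lt_natCast hl
        rw [ha.unique (he j hj), ← heq j hj]
        exact h j (by omega)
    obtain ⟨p, k⟩ := p
    cases p
    · simp only [stdBlocks, List.map_cons, FirstOrderTrue, StdTrue, ← Nat.cast_add]
      constructor
      · intro h e' hA heq
        obtain ⟨b', s', hx, hE⟩ := of_std e' hA heq
        exact (ih hm' hE).1 (h b' s' hx)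
      · intro h b' s' hx
        obtain ⟨e', hA, heq, hE⟩ := to_std b' s' hx
        exact (ih hm' hE).2 (h e' hA heq)
    · simp only [stdBlocks, List.map_cons, FirstOrderTrue, StdTrue, ← Nat.cast_add]
      constructor
      · rintro ⟨b', s', hx, h⟩
        obtain ⟨e', hA, heq, hE⟩ := to_std b' s' hx
        exact ⟨e', hA, heq, (ih hm' hE).1 h⟩
      · rintro ⟨e', hA, heq, h⟩
        obtain ⟨b', s', hx, hE⟩ := of_std e' hA heq
        exact ⟨b', s', hx, (ih hm' hE).2 h⟩

end Struct

/-- A second-order formula of standard length in prenex form. -/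
structure StdPrenex where
  rels : ℕ
  blocks : List (Bool × ℕ)
  matrix : StdMatrix

namespace StdPrenex

/-- The formula in the model. -/
noncomputable def toPrenex (φ : StdPrenex) : Prenex M :=
  ⟨φ.rels, stdBlocks φ.blocks, str (matrixSyms φ.matrix)⟩

/-- The symbols of a formula whose second-order quantifiers are written as `Q`. -/
def syms (Q : ℕ) (φ : StdPrenex) : List ℕ :=
  List.replicate φ.rels Q ++ ((φ.blocks.map fun p => List.replicate p.2 (if p.1 then 10 else 11)).flatten
    ++ matrixSyms φ.matrix)

/-- The formula is a sentence with relation variables of arity `d` and at most `n` blocks of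
first-order quantifiers. -/
def IsWF (n d : ℕ) (φ : StdPrenex) : Prop :=
  φ.blocks.length ≤ n ∧ φ.blocks.IsChain (fun p q => p.1 ≠ q.1) ∧ (∀ p ∈ φ.blocks, p.2 ≠ 0) ∧
    φ.matrix.Fits φ.rels (stdWidth φ.blocks) d

instance (n d : ℕ) (φ : StdPrenex) : Decidable (φ.IsWF n d) := by
  unfold IsWF; infer_instance

theorem IsWF.toPrenex {n d : ℕ} {φ : StdPrenex} (h : φ.IsWF n d) :
    (φ.toPrenex : Prenex M).IsWF n d := by
  obtain ⟨h1, h2, h3, h4⟩ := h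
  refine ⟨by simpa [StdPrenex.toPrenex, stdBlocks] using h1, ?_, ?_, ?_⟩
  · exact (List.isChain_map _).2 h2
  · intro p hp
    obtain ⟨q, hq, rfl⟩ := List.mem_map.1 hp
    exact Nat.cast_ne_zero.2 (h3 q hq)
  · have := width_stdBlocks (M := M) φ.blocks 0
    rw [Nat.cast_zero, zero_add] at this
    simp only [StdPrenex.toPrenex]
    rw [this]
    exact isMatrix_str h4

theorem goodSyms_blocks (L : List (Bool × ℕ)) : GoodSyms
    (L.map fun p => List.replicate p.2 (if p.1 then 10 else 11)).flatten := by
  refine GoodSyms.flatten fun l hl => ?_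
  obtain ⟨p, -, rfl⟩ := List.mem_map.1 hl
  exact .replicate _ (by split <;> norm_num) (by split <;> norm_num)

theorem goodSyms {Q : ℕ} (hQ : Q ≠ 0) (hQ' : Q < 16) (φ : StdPrenex) : GoodSyms (φ.syms Q) :=
  (GoodSyms.replicate _ hQ hQ').append ((goodSyms_blocks _).append (.matrix _))

theorem isCode {Q : ℕ} (hQ : Q ≠ 0) (hQ' : Q < 16) (φ : StdPrenex) :
    (φ.toPrenex : Prenex M).IsCode (Q : M) (str (φ.syms Q)) := by
  refine Prenex.isCode_iff.2 ⟨_, φ.blocks.map fun p =>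
    str (List.replicate p.2 (if p.1 then 10 else 11)), repeat_str Q φ.rels, ?_, ?_⟩
  · simp only [BlockStrings, StdPrenex.toPrenex, stdBlocks, List.forall₂_map_left_iff,
      List.forall₂_map_right_iff, List.forall₂_same]
    intro p _
    have := repeat_str (M := M) (if p.1 then 10 else 11) p.2
    convert this using 1
    rw [quantSym]
    split <;> norm_num
  · rw [syms, str_append (.replicate _ hQ hQ'), str_append (goodSyms_blocks _), str_flatten,
      List.map_map]
    · rfl
    · intro l hl
      obtain ⟨p, -, rfl⟩ := List.mem_map.1 hl
      exact .replicate _ (by split <;> norm_num) (by split <;> norm_num)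

theorem kernelTrue_iff {𝒳 : Set (Set M)} (𝔸 : Struct M 𝒳) {n d : ℕ} {φ : StdPrenex}
    (h : φ.IsWF n d) (Z : Set M) : 𝔸.KernelTrue d Z φ.toPrenex ↔
      𝔸.StdTrue Z φ.matrix φ.blocks 0 (fun _ => 0) := by
  have := 𝔸.firstOrderTrue_std (Z := Z) (b := 0) (s := 0) (i := 0) (e := fun _ => 0) φ.blocks
    (by rw [zero_add]; exact h.2.2.2) (fun j hj => absurd hj (Nat.not_lt_zero j))
  rw [Nat.cast_zero] at this
  exact this

end StdPrenex

/-- The symbols of the conjunction of two sentences. -/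
def conjSyms (σ π : StdPrenex) : List ℕ := σ.syms 12 ++ 14 :: π.syms 13

theorem isConjCode_str {n d : ℕ} {σ π : StdPrenex} (hσ : σ.IsWF n d) (hπ : π.IsWF n d) :
    IsConjCode n d (σ.toPrenex : Prenex M) π.toPrenex (str (conjSyms σ π)) := by
  have h1 := σ.isCode (M := M) (Q := 12) (by norm_num) (by norm_num)
  have h2 := π.isCode (M := M) (Q := 13) (by norm_num) (by norm_num)
  refine isConjCode_iff.2 ⟨hσ.toPrenex, hπ.toPrenex, _, _, by simpa using h1, by simpa using h2, ?_⟩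
  rw [conjSyms, str_append (σ.goodSyms (by norm_num) (by norm_num)),
    str_cons (by norm_num) (by norm_num)]
  norm_num

theorem Struct.sat_str {𝒳 : Set (Set M)} (𝔸 : Struct M 𝒳) {n d : ℕ} {σ π : StdPrenex}
    (hσ : σ.IsWF n d) (hπ : π.IsWF n d) : 𝔸.Sat n d (str (conjSyms σ π)) ↔
      (∃ Z ∈ 𝒳, 𝔸.StdTrue Z σ.matrix σ.blocks 0 (fun _ => 0)) ∧
        ∀ Z ∈ 𝒳, 𝔸.StdTrue Z π.matrix π.blocks 0 (fun _ => 0) := by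
  simp only [← StdPrenex.kernelTrue_iff 𝔸 hσ, ← StdPrenex.kernelTrue_iff 𝔸 hπ]
  have hc := isConjCode_str (M := M) hσ hπ
  constructor
  · rintro ⟨σ', π', h, h1, h2⟩
    obtain ⟨rfl, rfl⟩ := hc.unique h
    exact ⟨h1, h2⟩
  · exact fun ⟨h1, h2⟩ => ⟨_, _, hc, h1, h2⟩

end RCAStar

namespace RCAStar

variable {M : Type u} [Model M]

/-! ## A sentence which, with the existence of iterates, characterizes the natural numbers -/

/-- In conjunctive normal form, where `R` is the relation variable `0`: if `f(v₁) = v₂` then the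
predecessors of `v₂` are `v₁` and its predecessors, and no element is between `v₁` and `v₂`;
`c` is the least element; `R` is irreflexive. -/
def orderMatrix : StdMatrix :=
  [[(false, .const 1), (false, .rel 0 [0, 1])],
   [(false, .fn 1 2), (false, .rel 0 [0, 2]), (true, .rel 0 [0, 1]), (true, .eq 0 1)],
   [(false, .fn 1 2), (false, .rel 0 [0, 1]), (true, .rel 0 [0, 2])],
   [(false, .fn 1 2), (true, .rel 0 [1, 2])],
   [(true, .const 0), (false, .const 1), (true, .rel 0 [1, 0])],
   [(false, .fn 1 2), (false, .rel 0 [1, 0]), (true, .rel 0 [2, 0]), (true, .eq 2 0)],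
   [(false, .rel 0 [0, 0])]]

/-- In disjunctive normal form, where `R` and `H` are the relation variables `0` and `1`: the
relation `R` does not satisfy the first two clauses of `orderMatrix`, or `H` is not injective, or it
is not a total relation from `A` to the set of `R`-predecessors of `v₀`. -/
def boundCases : StdMatrix :=
  [[(true, .const 1), (true, .rel 0 [2, 1])],
   [(true, .fn 1 2), (true, .rel 0 [3, 2]), (false, .rel 0 [3, 1]), (false, .eq 3 1)],
   [(true, .rel 1 [1, 3]), (true, .rel 1 [2, 3]), (false, .eq 1 2)],
   [(false, .rel 1 [1, 4])],
   [(false, .rel 0 [4, 0])]]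

/-- There is a strict order as described by `orderMatrix`. -/
def orderSentence : StdPrenex := ⟨1, [(false, 3)], orderMatrix⟩

/-- There is no relation that maps `A` injectively to a set of predecessors. -/
def boundSentence : StdPrenex :=
  ⟨2, [(false, 1), (true, 3), (false, 1)], boundCases.sections⟩

theorem orderSentence_isWF : orderSentence.IsWF 3 2 := by decide

theorem boundSentence_isWF : boundSentence.IsWF 3 2 := by decide

/-- The distributive law that turns a disjunctive into a conjunctive normal form. If every disjunct
contains a false literal, then choosing one from each gives a clause without true literals. It is
needed because `boundCases` lists the ways to fail, whereas matrices are conjunctions of clauses. -/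
theorem sections_iff {α : Type*} (T : α → Prop) (D : List (List α)) :
    (∀ L ∈ D.sections, ∃ l ∈ L, T l) ↔ ∃ L ∈ D, ∀ l ∈ L, T l := by
  simp only [List.mem_sections]
  induction D with
  | nil => simp
  | cons C D ih =>
    constructor
    · intro h
      by_cases hC : ∀ l ∈ C, T l
      · exact ⟨C, by simp, hC⟩
      · push Not at hC
        obtain ⟨x, hx, hT⟩ := hC
        have : ∀ L, List.Forall₂ (· ∈ ·) L D → ∃ l ∈ L, T l := by
          intro L hL
          obtain ⟨l, hl, hl'⟩ := h (x :: L) (.cons hx hL)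
          rcases List.mem_cons.1 hl with rfl | hl
          · exact absurd hl' hT
          · exact ⟨l, hl, hl'⟩
        obtain ⟨L, hL, h⟩ := ih.1 this
        exact ⟨L, by simp [hL], h⟩
    · rintro ⟨C', hC', h⟩ L hL
      obtain ⟨x, L, hx, hL', rfl⟩ := List.forall₂_cons_right_iff.1 hL
      rcases List.mem_cons.1 hC' with rfl | hC'
      · exact ⟨x, by simp, h x hx⟩
      · obtain ⟨l, hl, hl'⟩ := ih.2 ⟨C', hC', h⟩ L hL'
        exact ⟨l, by simp [hl], hl'⟩

namespace Struct

variable {𝒳 : Set (Set M)} (𝔸 : Struct M 𝒳) (Z : Set M)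

theorem orderSentence_true : 𝔸.StdTrue Z orderSentence.matrix orderSentence.blocks 0 (fun _ => 0) ↔
    ∀ a ∈ 𝔸.A, ∀ b ∈ 𝔸.A, ∀ b' ∈ 𝔸.A,
      (b = 𝔸.c → pair 0 (tuple [a, b]) ∉ Z) ∧
      (pair b b' ∈ 𝔸.F → pair 0 (tuple [a, b']) ∈ Z → pair 0 (tuple [a, b]) ∈ Z ∨ a = b) ∧
      (pair b b' ∈ 𝔸.F → pair 0 (tuple [a, b]) ∈ Z → pair 0 (tuple [a, b']) ∈ Z) ∧
      (pair b b' ∈ 𝔸.F → pair 0 (tuple [b, b']) ∈ Z) ∧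
      (b = 𝔸.c → a = 𝔸.c ∨ pair 0 (tuple [b, a]) ∈ Z) ∧
      (pair b b' ∈ 𝔸.F → pair 0 (tuple [b, a]) ∈ Z → pair 0 (tuple [b', a]) ∈ Z ∨ b' = a) ∧
      pair 0 (tuple [a, a]) ∉ Z := by
  have key : ∀ e : ℕ → M, 𝔸.StdMatrixTrue Z e orderMatrix ↔
      (e 1 = 𝔸.c → pair 0 (tuple [e 0, e 1]) ∉ Z) ∧
      (pair (e 1) (e 2) ∈ 𝔸.F → pair 0 (tuple [e 0, e 2]) ∈ Z →
        pair 0 (tuple [e 0, e 1]) ∈ Z ∨ e 0 = e 1) ∧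
      (pair (e 1) (e 2) ∈ 𝔸.F → pair 0 (tuple [e 0, e 1]) ∈ Z → pair 0 (tuple [e 0, e 2]) ∈ Z) ∧
      (pair (e 1) (e 2) ∈ 𝔸.F → pair 0 (tuple [e 1, e 2]) ∈ Z) ∧
      (e 1 = 𝔸.c → e 0 = 𝔸.c ∨ pair 0 (tuple [e 1, e 0]) ∈ Z) ∧
      (pair (e 1) (e 2) ∈ 𝔸.F → pair 0 (tuple [e 1, e 0]) ∈ Z →
        pair 0 (tuple [e 2, e 0]) ∈ Z ∨ e 2 = e 0) ∧
      pair 0 (tuple [e 0, e 0]) ∉ Z := by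
    intro e
    simp [StdMatrixTrue, orderMatrix, StdAtomTrue]
    grind
  simp only [orderSentence, StdTrue, key]
  constructor
  · intro h a ha b hb b' hb'
    refine h (fun l => if l = 0 then a else if l = 1 then b else b') (fun l _ => ?_) (by simp)
    split_ifs <;> assumption
  · intro h e he _
    exact h _ (he 0 (by norm_num)) _ (he 1 (by norm_num)) _ (he 2 (by norm_num))

theorem boundSentence_true : 𝔸.StdTrue Z boundSentence.matrix boundSentence.blocks 0 (fun _ => 0) ↔
    ∀ a ∈ 𝔸.A, ∃ x ∈ 𝔸.A, ∃ y ∈ 𝔸.A, ∃ z ∈ 𝔸.A, ∀ b ∈ 𝔸.A,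
      (x = 𝔸.c ∧ pair 0 (tuple [y, x]) ∈ Z) ∨
      (pair x y ∈ 𝔸.F ∧ pair 0 (tuple [z, y]) ∈ Z ∧ pair 0 (tuple [z, x]) ∉ Z ∧ z ≠ x) ∨
      (pair 1 (tuple [x, z]) ∈ Z ∧ pair 1 (tuple [y, z]) ∈ Z ∧ x ≠ y) ∨
      pair 1 (tuple [x, b]) ∉ Z ∨ pair 0 (tuple [b, a]) ∉ Z := by
  have key : ∀ e : ℕ → M, 𝔸.StdMatrixTrue Z e boundCases.sections ↔
      (e 1 = 𝔸.c ∧ pair 0 (tuple [e 2, e 1]) ∈ Z) ∨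
      (pair (e 1) (e 2) ∈ 𝔸.F ∧ pair 0 (tuple [e 3, e 2]) ∈ Z ∧ pair 0 (tuple [e 3, e 1]) ∉ Z ∧
        e 3 ≠ e 1) ∨
      (pair 1 (tuple [e 1, e 3]) ∈ Z ∧ pair 1 (tuple [e 2, e 3]) ∈ Z ∧ e 1 ≠ e 2) ∨
      pair 1 (tuple [e 1, e 4]) ∉ Z ∨ pair 0 (tuple [e 4, e 0]) ∉ Z := by
    intro e
    rw [StdMatrixTrue, sections_iff (fun l : Bool × Atom ℕ => (l.1 = true ↔ 𝔸.StdAtomTrue Z e l.2))]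
    simp [boundCases, StdAtomTrue]
    grind
  simp only [boundSentence, StdTrue, key]
  constructor
  · intro h a ha
    obtain ⟨e, he, he0, h⟩ := h (fun _ => a) (fun _ _ => ha) (by simp)
    refine ⟨e 1, he 1 (by norm_num), e 2, he 2 (by norm_num), e 3, he 3 (by norm_num), fun b hb => ?_⟩
    have h0 : e 0 = a := he0 0 (by norm_num)
    have := h (fun l => if l = 4 then b else e l) (fun l hl => ?_) (fun l hl => ?_)
    · simpa [h0] using this
    · split_ifs with h4
      · exact hb
      · exact he l (by omega)
    · exact if_neg (by omega)
  · intro h e he _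
    obtain ⟨x, hx, y, hy, z, hz, h⟩ := h (e 0) (he 0 (by norm_num))
    refine ⟨fun l => if l = 0 then e 0 else if l = 1 then x else if l = 2 then y else z,
      fun l _ => ?_, fun l hl => ?_, fun e' he' heq => ?_⟩
    · dsimp only
      split_ifs <;> first | assumption | exact he 0 (by norm_num)
    · obtain rfl : l = 0 := by omega
      rfl
    · have := h (e' 4) (he' 4 (by norm_num))
      have h0 := heq 0 (by norm_num)
      have h1 := heq 1 (by norm_num)
      have h2 := heq 2 (by norm_num)
      have h3 := heq 3 (by norm_num)
      simp at h0 h1 h2 h3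
      rwa [← h0, ← h1, ← h2, ← h3] at this

end Struct

/-- The code of the conjunction of `orderSentence` and `boundSentence`. -/
@[irreducible] def orderBoundCode : ℕ := Nat.ofDigits 16 (conjSyms orderSentence boundSentence)

theorem nat_ofDigits (l : List ℕ) : (nat (Nat.ofDigits 16 l) : M) = str l := nat_eq_cast _

theorem orderBoundCode_eq :
    (nat orderBoundCode : M) = str (conjSyms orderSentence boundSentence) := by
  unfold orderBoundCode
  exact nat_ofDigits _

theorem isSentence_orderBound : IsSentence 3 2 (nat orderBoundCode : M) := by
  rw [orderBoundCode_eq]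
  exact ⟨_, _, isConjCode_str orderSentence_isWF boundSentence_isWF⟩

end RCAStar

namespace RCAStar

variable {M : Type u} [Model M]

/-! ## Functions of the model -/

/-- The graph of a function. -/
def graph (g : M → M) : Set M := {z | ∃ x, z = pair x (g x)}

theorem pair_mem_graph {g : M → M} {x a : M} : pair x a ∈ graph g ↔ a = g x := by
  constructor
  · rintro ⟨x', h⟩
    obtain ⟨rfl, rfl⟩ := pair_inj h
    rfl
  · rintro rfl
    exact ⟨x, rfl⟩

theorem isSet_pairs {R : M → M → Prop} [IsRel R] : IsSet {z | ∃ a b, z = pair a b ∧ R a b} := by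
  have := isSet_of_bdd (P := fun z : M => ∃ a, a ≤ z ∧ ∃ b, b ≤ z ∧ z = pair a b ∧ R a b)
  convert this using 3 with z
  constructor
  · rintro ⟨a, b, rfl, h⟩
    exact ⟨a, le_pair_left _ _, b, le_pair_right _ _, rfl, h⟩
  · rintro ⟨a, -, b, -, h⟩
    exact ⟨a, b, h⟩

/-- A function of the model need not be dominated by a term, so `R (g i) (g j)` is not a bounded
formula as it stands. It is `Δ⁰₁`, with a search for the pair of values, and so defines a set.
Membership in this set is a legitimate atomic formula for later inductions. -/
theorem IsRel.comp {g : M → M} (hg : IsSet (graph g)) (R : M → M → Prop) [IsRel R] :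
    ∃ T, IsRel T ∧ ∀ i j, T i j ↔ R (g i) (g j) := by
  obtain ⟨W, hW, h⟩ : ∃ W, IsSet W ∧ W = {z | ∃ i j, z = pair i j ∧ R (g i) (g j)} := by
    refine ⟨_, ?_, rfl⟩
    refine isSet_of_delta
      (fun z y => ∃ i, i ≤ z ∧ ∃ j, j ≤ z ∧ z = pair i j ∧ ∃ a, a ≤ y ∧ ∃ b, b ≤ y ∧ y = pair a b ∧
        pair i a ∈ graph g ∧ pair j b ∈ graph g ∧ R a b)
      (fun z y => ∃ i, i ≤ z ∧ ∃ j, j ≤ z ∧ z = pair i j ∧ ∀ a, a ≤ y → ∀ b, b ≤ y → y = pair a b →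
        pair i a ∈ graph g → pair j b ∈ graph g → R a b) (fun z => ?_) (fun z => ?_)
    · constructor
      · rintro ⟨i, j, rfl, h⟩
        exact ⟨pair (g i) (g j), i, le_pair_left _ _, j, le_pair_right _ _, rfl, _, le_pair_left _ _,
          _, le_pair_right _ _, rfl, ⟨i, rfl⟩, ⟨j, rfl⟩, h⟩
      · rintro ⟨y, i, -, j, -, rfl, a, -, b, -, rfl, h1, h2, h⟩
        rw [pair_mem_graph] at h1 h2
        subst h1 h2
        exact ⟨i, j, rfl, h⟩
    · constructor
      · rintro ⟨i, j, rfl, h⟩ y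
        refine ⟨i, le_pair_left _ _, j, le_pair_right _ _, rfl, fun a _ b _ _ h1 h2 => ?_⟩
        rw [pair_mem_graph] at h1 h2
        subst h1 h2
        exact h
      · intro h
        -- Any instance shows that `z` is a pair. The instance at the pair of values then gives the
        -- relation.
        obtain ⟨i, -, j, -, rfl, -⟩ := h 0
        obtain ⟨i', -, j', -, he, h⟩ := h (pair (g i) (g j))
        obtain ⟨rfl, rfl⟩ := pair_inj he
        exact ⟨i, j, rfl, h _ (le_pair_left _ _) _ (le_pair_right _ _) rfl ⟨i, rfl⟩ ⟨j, rfl⟩⟩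
  refine ⟨fun i j => pair i j ∈ W, ⟨inferInstance⟩, fun i j => ?_⟩
  rw [h]
  constructor
  · rintro ⟨i, j, h, hR⟩
    obtain ⟨h1, h2⟩ := pair_inj h
    rwa [h1, h2]
  · exact fun h => ⟨_, _, rfl, h⟩

theorem IsPred.comp {g : M → M} (hg : IsSet (graph g)) (P : M → Prop) [IsPred P] :
    ∃ T, IsPred T ∧ ∀ i, T i ↔ P (g i) := by
  have : IsRel (fun i _ : M => P i) := ⟨inferInstance⟩
  obtain ⟨T, hT, h⟩ := IsRel.comp hg (fun i _ => P i)
  exact ⟨fun i => T i i, ⟨inferInstance⟩, fun i => h i i⟩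

/-- The induction does not speak about the bound, which would be an unbounded quantifier, but about
an argument `i < m` at which `g` is maximal. Comparison of values is definable by `IsRel.comp`. -/
theorem exists_bound {g : M → M} (hg : IsSet (graph g)) (n : M) : ∃ B, ∀ i, i < n → g i < B := by
  have : IsRel (fun i j : M => i < j) := ⟨inferInstance⟩
  obtain ⟨T, hT, hTg⟩ := IsRel.comp hg (fun i j => i < j)
  have := induct (P := fun m : M => 0 < m → ∃ i, i < m ∧ ∀ j, j < m → ¬ T i j)
    (fun h => absurd h (lt_irrefl _)) (fun m ih _ => ?_) n
  all_goals simp only [hTg] at *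
  · rcases (zero_le : 0 ≤ n).eq_or_lt with rfl | hn
    · exact ⟨0, fun i hi => absurd hi not_lt_zero⟩
    · obtain ⟨i, -, h⟩ := this hn
      exact ⟨g i + 1, fun j hj => lt_add_one_iff'.2 (not_lt.1 (h j hj))⟩
  · rcases (zero_le : 0 ≤ m).eq_or_lt with rfl | hm
    · refine ⟨0, lt_add_one 0, fun j hj => ?_⟩
      rw [le_antisymm (lt_add_one_iff'.1 hj) zero_le]
      exact lt_irrefl _
    · obtain ⟨i, hi, h⟩ := ih hm
      by_cases hlt : g i < g m
      · refine ⟨m, lt_add_one m, fun j hj => ?_⟩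
        rcases (lt_add_one_iff'.1 hj).lt_or_eq with hj | rfl
        · exact fun h' => h j hj (hlt.trans h')
        · exact lt_irrefl _
      · refine ⟨i, hi.trans (lt_add_one m), fun j hj => ?_⟩
        rcases (lt_add_one_iff'.1 hj).lt_or_eq with hj | rfl
        · exact h j hj
        · exact hlt

theorem isSet_of_mem {X : Set M} (h : X ∈ Model.sets) : IsSet X := ⟨h⟩

/-! ## Categoricity -/

namespace Struct

variable (𝔸 : Struct M Model.sets)

/-- The function is an isomorphism from the numbers onto the structure. -/
structure IsIso (g : M → M) : Prop where
  isSet : IsSet (graph g)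
  inj : ∀ {x y}, g x = g y → x = y
  mem : ∀ x, g x ∈ 𝔸.A
  surj : ∀ a ∈ 𝔸.A, ∃ x, a = g x
  zero : g 0 = 𝔸.c
  succ : ∀ x, pair (g x) (g (x + 1)) ∈ 𝔸.F

theorem isoNat_iff : 𝔸.IsoNat ↔ ∃ g, 𝔸.IsIso g := by
  constructor
  · rintro ⟨G, hG, hsub, hfun, hinj, h0, hs⟩
    choose g hg hgu using hfun
    have hG' : graph g = G := by
      ext z
      constructor
      · rintro ⟨x, rfl⟩
        exact hg x
      · intro hz
        obtain ⟨x, a, -, rfl⟩ := hsub z hz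
        exact ⟨x, by rw [hgu x a hz]⟩
    have mem : ∀ x, g x ∈ 𝔸.A := by
      intro x
      obtain ⟨x', a, ha, h⟩ := hsub _ (hg x)
      rw [(pair_inj h).2]
      exact ha
    refine ⟨g, ⟨hG'.symm ▸ hG⟩, fun {x y} h => ?_, mem, fun a ha => ?_, (hgu _ _ h0).symm,
      fun x => ?_⟩
    · exact (hinj _ (mem x)).unique (hg x) (h ▸ hg y)
    · obtain ⟨x, hx, -⟩ := hinj a ha
      exact ⟨x, hgu _ _ hx⟩
    · obtain ⟨b, hb, -⟩ := 𝔸.F_fun _ (mem x)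
      have := hgu _ _ (hs x _ b (hg x) hb)
      exact this ▸ hb
  · rintro ⟨g, h⟩
    refine ⟨graph g, h.isSet.mem, ?_, fun x => ⟨g x, ⟨x, rfl⟩, fun a ha => pair_mem_graph.1 ha⟩,
      fun a ha => ?_, pair_mem_graph.2 h.zero.symm, fun x a b ha hb => ?_⟩
    · rintro z ⟨x, rfl⟩
      exact ⟨x, _, h.mem x, rfl⟩
    · obtain ⟨x, rfl⟩ := h.surj a ha
      exact ⟨x, pair_mem_graph.2 rfl, fun y hy => h.inj (pair_mem_graph.1 hy).symm⟩
    · rw [pair_mem_graph] at ha ⊢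
      subst ha
      exact (𝔸.F_fun _ (h.mem x)).unique hb (h.succ x)

theorem mem_rel_iff {k : M} {R : M → M → Prop} {a b : M} :
    pair k (tuple [a, b]) ∈ {z | ∃ a b, z = pair k (tuple [a, b]) ∧ R a b} ↔ R a b := by
  constructor
  · rintro ⟨a', b', h, hR⟩
    obtain ⟨rfl, h'⟩ := pair_inj (pair_inj h).2
    obtain ⟨rfl, -⟩ := pair_inj h'
    exact hR
  · exact fun h => ⟨a, b, rfl, h⟩

theorem isSet_rel (k : M) {R : M → M → Prop} [IsRel R] :
    IsSet {z | ∃ a b, z = pair k (tuple [a, b]) ∧ R a b} := by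
  have := isSet_of_bdd (P := fun z : M => ∃ a, a ≤ z ∧ ∃ b, b ≤ z ∧
    z = pair k (pair a (pair b 0)) ∧ R a b)
  convert this using 3 with z
  constructor
  · rintro ⟨a, b, rfl, h⟩
    exact ⟨a, (le_pair_left _ _).trans (le_pair_right _ _), b,
      (le_pair_left _ _).trans ((le_pair_right _ _).trans (le_pair_right _ _)), rfl, h⟩
  · rintro ⟨a, -, b, -, h⟩
    exact ⟨a, b, h⟩

theorem isRel_mem (k : M) (Z : Set M) [IsSet Z] : IsRel (fun a b => pair k (tuple [a, b]) ∈ Z) :=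
  ⟨by simp only [tuple]; infer_instance⟩

/-! ### Truth of the sentences in copies of the natural numbers, and the converse -/

variable {𝔸} {g : M → M}

/-- The values of `g` up to `x` have a common bound, which serves as the base of a code for them. -/
theorem IsIso.iterExists (h : 𝔸.IsIso g) (x : M) : 𝔸.IterExists x := by
  obtain ⟨B, hB⟩ := exists_bound h.isSet (x + 1)
  have := h.isSet
  have : IsRel (fun i a : M => pair i a ∈ graph g) := ⟨inferInstance⟩
  obtain ⟨s, -, hs⟩ := exists_code (fun i a : M => pair i a ∈ graph g) B (x + 1)
    (fun i hi => ⟨g i, hB i hi, i, rfl⟩)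
  have hB0 : 0 < B := lt_of_le_of_lt zero_le (hB x (lt_add_one x))
  have key : ∀ i, i ≤ x → Entry B s i (g i) := fun i hi =>
    entry_iff.2 ⟨hB0, pair_mem_graph.1 (hs i (lt_add_one_iff'.2 hi))⟩
  exact ⟨B, s, h.zero ▸ key 0 zero_le, fun i hi =>
    ⟨_, _, key i hi.le, key _ (Order.add_one_le_of_lt hi), h.succ i⟩⟩

theorem IsIso.eq_succ (h : 𝔸.IsIso g) {x y : M} (hF : pair (g x) (g y) ∈ 𝔸.F) : y = x + 1 :=
  h.inj ((𝔸.F_fun _ (h.mem x)).unique hF (h.succ x))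

/-- The witness is the order of the numbers, transported by comparing preimages under `g`. For this
the inverse of `g` has to be a function of the model. -/
theorem IsIso.orderSentence (h : 𝔸.IsIso g) : ∃ Z ∈ Model.sets,
    𝔸.StdTrue Z orderSentence.matrix orderSentence.blocks 0 (fun _ => 0) := by
  -- The inverse is made total by the value `0` outside `A`.
  have hinv : ∀ a : M, ∃ x, a ∈ 𝔸.A ∧ a = g x ∨ a ∉ 𝔸.A ∧ x = 0 := by
    intro a
    by_cases ha : a ∈ 𝔸.A
    · obtain ⟨x, hx⟩ := h.surj a ha
      exact ⟨x, .inl ⟨ha, hx⟩⟩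
    · exact ⟨0, .inr ⟨ha, rfl⟩⟩
  choose v hv using hinv
  have hvg : ∀ x, v (g x) = x := by
    intro x
    rcases hv (g x) with ⟨-, h1⟩ | ⟨h1, -⟩
    · exact (h.inj h1).symm
    · exact absurd (h.mem x) h1
  have hset : IsSet (graph v) := by
    have := h.isSet
    have := isSet_of_mem 𝔸.A_mem
    have : IsRel (fun a x : M => a ∈ 𝔸.A ∧ pair x a ∈ graph g ∨ a ∉ 𝔸.A ∧ x = 0) := ⟨inferInstance⟩
    convert isSet_pairs (R := fun a x : M => a ∈ 𝔸.A ∧ pair x a ∈ graph g ∨ a ∉ 𝔸.A ∧ x = 0)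
    ext z
    constructor
    · rintro ⟨a, rfl⟩
      exact ⟨a, v a, rfl, by simpa only [pair_mem_graph] using hv a⟩
    · rintro ⟨a, x, rfl, hx⟩
      refine pair_mem_graph.2 ?_
      rw [pair_mem_graph] at hx
      rcases hx with ⟨h1, rfl⟩ | ⟨h1, rfl⟩
      · exact (hvg x).symm
      · rcases hv a with ⟨h2, -⟩ | ⟨-, h2⟩
        · exact absurd h2 h1
        · exact h2.symm
  have : IsRel (fun i j : M => i < j) := ⟨inferInstance⟩
  obtain ⟨T, hT, hTv⟩ := IsRel.comp hset (fun i j => i < j)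
  refine ⟨_, (isSet_rel 0 (R := T)).mem, (𝔸.orderSentence_true _).2 ?_⟩
  intro a ha b hb b' hb'
  obtain ⟨x, rfl⟩ := h.surj a ha
  obtain ⟨y, rfl⟩ := h.surj b hb
  obtain ⟨z, rfl⟩ := h.surj b' hb'
  simp only [mem_rel_iff, hTv, hvg, lt_irrefl, not_false_eq_true, and_true]
  have hinj : ∀ x y, g x = g y ↔ x = y := fun x y => ⟨h.inj, fun h => h ▸ rfl⟩
  simp only [← h.zero, hinj]
  refine ⟨?_, fun hF => ?_, fun hF => ?_, fun hF => ?_, ?_, fun hF => ?_⟩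
  · rintro rfl
    exact not_lt_zero
  all_goals try rw [h.eq_succ hF]
  · rw [lt_add_one_iff']
    exact fun h => h.lt_or_eq
  · exact fun h => h.trans (lt_add_one _)
  · exact lt_add_one _
  · rintro rfl
    exact (zero_le : 0 ≤ x).eq_or_lt.imp_left Eq.symm
  · exact fun h => (Order.add_one_le_of_lt h).lt_or_eq

/-- In a counterexample at `g n`, the predecessors of `g n` would be among the `g j` with `j < n`.
Pulled back along `g`, the relation `H` would then map all numbers injectively below `n`. -/
theorem IsIso.boundSentence (h : 𝔸.IsIso g) (Z : Set M) [IsSet Z] :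
    𝔸.StdTrue Z boundSentence.matrix boundSentence.blocks 0 (fun _ => 0) := by
  refine (𝔸.boundSentence_true Z).2 fun a ha => ?_
  obtain ⟨n, rfl⟩ := h.surj a ha
  by_contra hne
  push Not at hne
  -- The relation `R` is contained in the order of the indices. If `g j` were below `g (x + 1)`, it
  -- would be below `g x` or equal to it. The first is excluded by induction, the second by `x + 1 ≤
  -- j`.
  have hR : ∀ j x, x ≤ j → pair 0 (tuple [g j, g x]) ∉ Z := by
    intro j x
    have : IsPred (fun a => pair 0 (tuple [g j, a]) ∈ Z) :=
      ⟨by simp only [tuple]; infer_instance⟩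
    obtain ⟨T, hT, hTg⟩ := IsPred.comp h.isSet (fun a => pair 0 (tuple [g j, a]) ∈ Z)
    rw [← hTg]
    refine induct (P := fun x => x ≤ j → ¬ T x) (fun _ => ?_) (fun x ih hx hmem => ?_) x
    all_goals rw [hTg] at *
    · rw [h.zero]
      obtain ⟨b, -, h1, -⟩ := hne _ 𝔸.c_mem _ (h.mem j) _ (h.mem j)
      exact h1 rfl
    · obtain ⟨b, -, -, h2, -⟩ := hne _ (h.mem x) _ (h.mem (x + 1)) _ (h.mem j)
      have := h2 (h.succ x) hmem (ih ((lt_add_one x).le.trans hx))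
      exact absurd ((lt_add_one x).trans_le hx) (h.inj this ▸ lt_irrefl _)
  have := isRel_mem 1 Z
  obtain ⟨T, hT, hTg⟩ := IsRel.comp h.isSet (fun a b => pair 1 (tuple [a, b]) ∈ Z)
  refine pigeonhole T n (fun i => ?_) fun i j k hi hj => ?_
  all_goals simp only [hTg] at *
  · obtain ⟨b, hb, -, -, -, h4, h5⟩ := hne _ (h.mem i) _ (h.mem i) _ (h.mem i)
    obtain ⟨j, rfl⟩ := h.surj b hb
    exact ⟨j, not_le.1 fun hle => hR j n hle h5, h4⟩
  · obtain ⟨b, -, -, -, h3, -⟩ := hne _ (h.mem i) _ (h.mem j) _ (h.mem k)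
    exact h.inj (h3 hi hj)

/-- The sequence coded by `b, s` begins with `c, f(c), …, f^x(c)`. -/
def IsIter (𝔸 : Struct M Model.sets) (b s x : M) : Prop :=
  0 < b ∧ digit b s 0 = 𝔸.c ∧ ∀ i, i < x → pair (digit b s i) (digit b s (i + 1)) ∈ 𝔸.F

instance {n : ℕ} (b s x : (Fin n → M) → M) [IsFn b] [IsFn s] [IsFn x] :
    IsBdd (fun e => 𝔸.IsIter (b e) (s e) (x e)) := by
  have := isSet_of_mem 𝔸.F_mem
  have := IsFn.weaken b
  have := IsFn.weaken s
  unfold IsIter; infer_instance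

theorem iterExists_iff {x : M} : 𝔸.IterExists x ↔ ∃ b s, 𝔸.IsIter b s x := by
  refine exists_congr fun b => exists_congr fun s => ?_
  simp only [entry_iff]
  constructor
  · rintro ⟨⟨hb, h0⟩, h⟩
    refine ⟨hb, h0, fun i hi => ?_⟩
    obtain ⟨a, a', ⟨-, rfl⟩, ⟨-, rfl⟩, hF⟩ := h i hi
    exact hF
  · rintro ⟨hb, h0, h⟩
    exact ⟨⟨hb, h0⟩, fun i hi => ⟨_, _, ⟨hb, rfl⟩, ⟨hb, rfl⟩, h i hi⟩⟩

/-- With both codes as parameters, agreement at an index is a bounded property. Uniqueness is what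
makes the graph of `x ↦ f^x(c)` also `Π⁰₁`. -/
theorem IsIter.unique {b s b' s' x : M} (h : 𝔸.IsIter b s x) (h' : 𝔸.IsIter b' s' x) {i : M}
    (hi : i ≤ x) : digit b s i = digit b' s' i := by
  refine induct (P := fun i => i ≤ x → digit b s i = digit b' s' i) (fun _ => ?_)
    (fun i ih hi => ?_) i hi
  · rw [h.2.1, h'.2.1]
  · have hi : i < x := (lt_add_one i).trans_le hi
    have h1 := h.2.2 i hi
    have h2 := h'.2.2 i hi
    rw [ih hi.le] at h1
    exact (𝔸.F_fun _ (𝔸.mem_of_pair h1).1).unique h1 h2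

theorem IsIter.mono {b s x y : M} (h : 𝔸.IsIter b s x) (hy : y ≤ x) : 𝔸.IsIter b s y :=
  ⟨h.1, h.2.1, fun i hi => h.2.2 i (hi.trans_le hy)⟩

/-- The map `x ↦ f^x(c)` is a homomorphism by construction. The `Σ¹₁` part makes it injective, and
the two parts together make it surjective. -/
theorem exists_iso (hi : ∀ x, 𝔸.IterExists x)
    (hσ : ∃ Z ∈ Model.sets, 𝔸.StdTrue Z orderSentence.matrix orderSentence.blocks 0 (fun _ => 0))
    (hπ : ∀ Z ∈ Model.sets, 𝔸.StdTrue Z boundSentence.matrix boundSentence.blocks 0 (fun _ => 0)) :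
    ∃ g, 𝔸.IsIso g := by
  choose b s hbs using fun x => iterExists_iff.1 (hi x)
  obtain ⟨Z, hZ, hσ⟩ := hσ
  have := isSet_of_mem hZ
  have := isSet_of_mem 𝔸.F_mem
  rw [𝔸.orderSentence_true] at hσ
  set g : M → M := fun x => digit (b x) (s x) x with hg
  have hval : ∀ {b' s' x}, 𝔸.IsIter b' s' x → digit b' s' x = g x :=
    fun h => h.unique (hbs _) le_rfl
  have hzero : g 0 = 𝔸.c := (hbs 0).2.1
  have hsucc : ∀ x, pair (g x) (g (x + 1)) ∈ 𝔸.F := by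
    intro x
    have := (hbs (x + 1)).2.2 x (lt_add_one x)
    rwa [hval ((hbs (x + 1)).mono (lt_add_one x).le)] at this
  have hmem : ∀ x, g x ∈ 𝔸.A := fun x => (𝔸.mem_of_pair (hsucc x)).1
  -- The value at `x` is `a` iff some code of an iteration of length `x` ends in `a`, and iff all
  -- such codes do.
  have hset : IsSet (graph g) := by
    refine isSet_of_delta
      (fun z y => ∃ b, b ≤ y ∧ ∃ s, s ≤ y ∧ y = pair b s ∧ ∃ x, x ≤ z ∧ ∃ a, a ≤ z ∧ z = pair x a ∧
        𝔸.IsIter b s x ∧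
          digit b s x = a)
      (fun z y => ∃ x, x ≤ z ∧ ∃ a, a ≤ z ∧ z = pair x a ∧ ∀ b, b ≤ y → ∀ s, s ≤ y → y = pair b s →
        𝔸.IsIter b s x →
          digit b s x = a) (fun z => ?_) (fun z => ?_)
    · constructor
      · rintro ⟨x, rfl⟩
        exact ⟨pair (b x) (s x), _, le_pair_left _ _, _, le_pair_right _ _, rfl, x, le_pair_left _ _,
          _, le_pair_right _ _, rfl, hbs x, rfl⟩
      · rintro ⟨y, b, -, s, -, -, x, -, a, -, rfl, h, ha⟩
        exact pair_mem_graph.2 (ha.symm.trans (hval h))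
    · constructor
      · rintro ⟨x, rfl⟩ y
        exact ⟨x, le_pair_left _ _, _, le_pair_right _ _, rfl, fun b _ s _ _ h => hval h⟩
      · intro h
        obtain ⟨x, -, a, -, rfl, -⟩ := h 0
        obtain ⟨x', -, a', -, he, h⟩ := h (pair (b x) (s x))
        obtain ⟨rfl, rfl⟩ := pair_inj he
        exact pair_mem_graph.2 (h _ (le_pair_left _ _) _ (le_pair_right _ _) rfl (hbs x)).symm
  -- Predecessors of `b` remain predecessors of `f(b)`, and `b` itself precedes `f(b)`.
  have hlt : ∀ i x, i < x → pair 0 (tuple [g i, g x]) ∈ Z := by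
    intro i x
    have : IsPred (fun a => pair 0 (tuple [g i, a]) ∈ Z) :=
      ⟨by simp only [tuple]; infer_instance⟩
    obtain ⟨T, hT, hTg⟩ := IsPred.comp hset (fun a => pair 0 (tuple [g i, a]) ∈ Z)
    rw [← hTg]
    refine induct (P := fun x => i < x → T x) (fun h => absurd h not_lt_zero) (fun x ih hx => ?_) x
    rw [hTg] at *
    obtain ⟨-, -, h3, h4, -⟩ := hσ _ (hmem i) _ (hmem x) _ (hmem (x + 1))
    rcases (lt_add_one_iff'.1 hx).lt_or_eq with hx | rfl
    · exact h3 (hsucc x) (ih hx)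
    · exact h4 (hsucc i)
  have hne : ∀ i x, i < x → g i ≠ g x := by
    intro i x hx he
    have := hlt i x hx
    rw [← he] at this
    exact (hσ _ (hmem i) _ (hmem i) _ (hmem i)).2.2.2.2.2.2 this
  have hinj : ∀ {x y}, g x = g y → x = y := by
    intro x y h
    rcases lt_trichotomy x y with hxy | hxy | hxy
    · exact absurd h (hne _ _ hxy)
    · exact hxy
    · exact absurd h.symm (hne _ _ hxy)
  refine ⟨g, hset, hinj, hmem, fun a ha => ?_, hzero, hsucc⟩
  by_contra hsurj
  push Not at hsurj
  -- Here `c` is least, and no element lies between `b` and `f(b)`. As `a` is not in the range,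
  -- equality never occurs, and the induction passes through all `g x`.
  have hbelow : ∀ x, pair 0 (tuple [g x, a]) ∈ Z := by
    intro x
    have : IsPred (fun b => pair 0 (tuple [b, a]) ∈ Z) :=
      ⟨by simp only [tuple]; infer_instance⟩
    obtain ⟨T, hT, hTg⟩ := IsPred.comp hset (fun b => pair 0 (tuple [b, a]) ∈ Z)
    rw [← hTg]
    refine induct (P := T) ?_ (fun x ih => ?_) x
    all_goals rw [hTg] at *
    · have := (hσ _ ha _ (hmem 0) _ (hmem 0)).2.2.2.2.1 hzero
      exact this.resolve_left (hzero ▸ hsurj 0)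
    · have := (hσ _ ha _ (hmem x) _ (hmem (x + 1))).2.2.2.2.2.1 (hsucc x) ih
      exact this.resolve_right (hsurj _).symm
  -- The graph of `g` itself is taken as `H`. Its arguments are numbers, and `A` is a set of
  -- numbers, so `H` restricts to an injection of `A` below `a`.
  have : IsRel (fun x a : M => pair x a ∈ graph g) := ⟨inferInstance⟩
  have := isSet_rel 1 (R := fun x a : M => pair x a ∈ graph g)
  set H := {z : M | ∃ x a, z = pair 1 (tuple [x, a]) ∧ pair x a ∈ graph g} with hH
  -- One set codes both relations: index `0` keeps `R` from `Z`, and index `1` holds `H`.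
  have hW := isSet_of_bdd (P := fun z : M => (z ∈ Z ∧ ∃ y, y ≤ z ∧ z = pair 0 y) ∨ z ∈ H)
  set W := {z : M | (z ∈ Z ∧ ∃ y, y ≤ z ∧ z = pair 0 y) ∨ z ∈ H} with hWdef
  have h0 : ∀ y, pair 0 y ∈ W ↔ pair 0 y ∈ Z := by
    intro y
    constructor
    · rintro (⟨h, -⟩ | ⟨x, a, h, -⟩)
      · exact h
      · exact absurd (pair_inj h).1 zero_ne_one
    · exact fun h => .inl ⟨h, y, le_pair_right _ _, rfl⟩
  have h1 : ∀ x a, pair 1 (tuple [x, a]) ∈ W ↔ a = g x := by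
    intro x a
    rw [← pair_mem_graph, ← mem_rel_iff (k := (1 : M)) (R := fun x a => pair x a ∈ graph g)]
    constructor
    · rintro (⟨-, y, -, h⟩ | h)
      · exact absurd (pair_inj h).1 one_ne_zero
      · exact h
    · exact .inr
  obtain ⟨x, hx, y, hy, z, hz, h⟩ := (𝔸.boundSentence_true W).1 (hπ W hW.mem) a ha
  -- The choice `b = g x` rules out the last two alternatives. The other three contradict the
  -- properties of `R` and the injectivity of `g`.
  have := h (g x) (hmem x)
  simp only [h0, h1, hbelow, not_true_eq_false, or_false] at this
  rcases this with ⟨rfl, h⟩ | ⟨hF, h, h', hne⟩ | ⟨h, h', hne⟩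
  · exact (hσ _ hy _ hx _ hx).1 rfl h
  · rcases (hσ _ hz _ hx _ hy).2.1 hF h with h | h
    · exact h' h
    · exact hne h
  · exact hne (hinj (h.symm.trans h'))

variable (𝔸) in
theorem isoNat_iff_sat : 𝔸.IsoNat ↔
    (∀ x, 𝔸.IterExists x) ∧ 𝔸.Sat 3 2 (nat orderBoundCode : M) := by
  rw [isoNat_iff, orderBoundCode_eq, 𝔸.sat_str orderSentence_isWF boundSentence_isWF]
  constructor
  · rintro ⟨g, h⟩
    refine ⟨h.iterExists, h.orderSentence, fun Z hZ => ?_⟩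
    have := isSet_of_mem hZ
    exact h.boundSentence Z
  · rintro ⟨hi, hσ, hπ⟩
    exact exists_iso hi hσ hπ

end Struct

end RCAStar

namespace RCAStar

variable {M : Type u} [Model M]

/-! ## Powers without exponentiation -/

/-- `q` is a power of two: every divisor is one or even. -/
def PowTwo (q : M) : Prop :=
  0 < q ∧ ∀ d, d < q + 1 → (∃ w, w < q + 1 ∧ d * w = q) → d = 1 ∨ ∃ w, w < q + 1 ∧ d = w + w

theorem even_or_odd (d : M) : ∃ w, d = w + w ∨ d = w + w + 1 := by
  have h := div_add_mod d 2
  have h2 := mod_lt d (b := 2) (by norm_num)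
  refine ⟨d / 2, ?_⟩
  rcases (zero_le : 0 ≤ d % 2).eq_or_lt with h0 | h0
  · left; rw [← h0] at h; grind
  · right
    have h2' : d % 2 ≤ 1 := lt_add_one_iff'.1 (h2.trans_eq one_add_one_eq_two.symm)
    rw [le_antisymm h2' (one_le_of_pos h0)] at h
    rw [← two_mul, h]

theorem add_self_ne (a b : M) : a + a ≠ b + b + 1 := by
  intro h
  rcases le_or_gt a b with hab | hab
  · exact (lt_of_le_of_lt (add_le_add hab hab) (lt_add_one _)).ne h
  · have := Order.add_one_le_of_lt hab
    refine (lt_of_lt_of_le ?_ (add_le_add this this)).ne' h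
    rw [← add_assoc, add_right_comm b 1 b]
    exact lt_add_one _

/-- Such a `q` is a divisor of itself, hence `1` or even. Divisors of its half divide `q`, so strong
induction applies. Conversely, the cofactor of an odd divisor of `2 ^ (k + 1)` is even, so the
divisor already divides `2 ^ k`. -/
theorem powTwo_iff {q : M} : PowTwo q ↔ ∃ k : M, q = 2 ^ k := by
  constructor
  · have hP : IsPred (PowTwo : M → Prop) := ⟨by unfold PowTwo; infer_instance⟩
    have := strong_induct (P := fun q : M => PowTwo q → ∃ k : M, k ≤ q ∧ q = 2 ^ k)
      (fun q ih hq => ?_) q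
    · exact fun h => (this h).imp fun k hk => hk.2
    rcases hq.2 q (lt_add_one q) ⟨1, by grind [hq.1, one_le_of_pos hq.1], mul_one q⟩ with
      rfl | ⟨w, hw, rfl⟩
    · exact ⟨0, zero_le, (exp_zero _).symm⟩
    · have hw0 : 0 < w := by
        refine pos_iff_ne_zero.2 fun h => ?_
        subst h
        exact absurd hq.1 (by simp)
      have hlt : w < w + w := lt_add_of_pos_right w hw0
      obtain ⟨k, -, hk⟩ := ih w hlt ⟨hw0, fun d hd ⟨v, hv, h⟩ => by
        rcases hq.2 d (hd.trans (by gcongr)) ⟨v + v, by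
          rw [lt_add_one_iff'] at hv ⊢; gcongr, by rw [mul_add, h]⟩ with h1 | ⟨e, he, rfl⟩
        · exact .inl h1
        · exact .inr ⟨e, lt_of_le_of_lt le_self_add hd, rfl⟩⟩
      have : w + w = 2 ^ (k + 1) := by rw [exp_succ, ← hk]; ring
      exact ⟨k + 1, by rw [this]; exact (lt_exp_self (by norm_num) _).le, this⟩
  · rintro ⟨k, rfl⟩
    refine ⟨exp_pos (by norm_num), ?_⟩
    have := induct (P := fun k : M => ∀ d : M, d < 2 ^ k + 1 → ∀ w : M, w < 2 ^ k + 1 → d * w = 2 ^ k →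
      d = 1 ∨ ∃ w : M, w < 2 ^ k + 1 ∧ d = w + w) ?_ (fun k ih d hd w hw h => ?_) k
    · exact fun d hd ⟨w, hw, h⟩ => this d hd w hw h
    · intro d hd w hw h
      left
      rw [exp_zero, lt_add_one_iff'] at hd
      rcases hd.lt_or_eq with hd | hd
      · rw [← zero_add (1 : M), lt_add_one_iff'] at hd
        rw [le_antisymm hd zero_le, exp_zero, zero_mul] at h
        exact absurd h zero_ne_one
      · exact hd
    · obtain ⟨a, ha⟩ := even_or_odd d
      obtain ⟨b, hb⟩ := even_or_odd w
      rcases ha with rfl | rfl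
      · exact .inr ⟨a, lt_of_le_of_lt le_self_add hd, rfl⟩
      · rcases hb with rfl | rfl
        · have h' : (a + a + 1) * b = 2 ^ k := by
            have : ((a + a + 1) * b) * 2 = 2 ^ k * 2 := by rw [← exp_succ, ← h]; ring
            exact mul_right_cancel₀ (by norm_num) this
          have hk : (0 : M) < 2 ^ k := exp_pos (by norm_num)
          have hb0 : 0 < b := pos_iff_ne_zero.2 fun h0 => by
            rw [h0, mul_zero] at h'; exact hk.ne h'
          have h1 : a + a + 1 ≤ 2 ^ k := h' ▸ le_mul_of_one_le_right' (one_le_of_pos hb0)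
          have h2 : b ≤ 2 ^ k := h' ▸ le_mul_of_one_le_left' (one_le_of_pos (pos_add_one _))
          rcases ih _ (lt_add_one_iff'.2 h1) b (lt_add_one_iff'.2 h2) h' with h3 | ⟨e, -, he⟩
          · exact .inl h3
          · exact absurd he.symm (add_self_ne e a)
        · exfalso
          refine add_self_ne (2 ^ k) (2 * a * b + a + b) ?_
          calc (2 : M) ^ k + 2 ^ k = 2 ^ (k + 1) := by rw [exp_succ]; ring
            _ = _ := by rw [← h]; ring

/-- `p` is a power of sixteen. -/
def PowSixteen (p : M) : Prop := ∃ q, q < p + 1 ∧ p = q * q * (q * q) ∧ PowTwo q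

/-- Powers of sixteen are the fourth powers of powers of two, and the fourth power is a term without
exponentiation. -/
theorem powSixteen_iff {p : M} : PowSixteen p ↔ ∃ k : M, p = 16 ^ k := by
  have h16 : ∀ k : M, (2 : M) ^ k * 2 ^ k * (2 ^ k * 2 ^ k) = 16 ^ k := by
    intro k
    rw [← mul_exp, ← mul_exp]
    norm_num
  constructor
  · rintro ⟨q, -, rfl, hq⟩
    obtain ⟨k, rfl⟩ := powTwo_iff.1 hq
    exact ⟨k, h16 k⟩
  · rintro ⟨k, rfl⟩
    refine ⟨2 ^ k, lt_add_one_iff'.2 (exp_le_exp_left (by norm_num)), (h16 k).symm,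
      powTwo_iff.2 ⟨k, rfl⟩⟩

/-! ## A local description of the codes of the sentences for iterates -/

/-- The string `S` begins with the clause given by `s`, where `s < t` and `s, t` are powers of
sixteen, or it is the end of a sentence and `s = t`. -/
def Next (S s t : M) : Prop :=
  (s = t ∧ S = 927289) ∨ (s < t ∧ ∃ S', S' < S + 1 ∧ S = stepValue s + 16777216 * (s * s) * S')

/-- `ξ` begins with a block of quantifiers and a clause, and every clause is followed by the
correct one. -/
def IterShape (ξ : M) : Prop :=
  ∃ t, t < 15 * ξ + 11 ∧ ∃ r, r < ξ + 1 ∧ ∃ S, S < ξ + 1 ∧ PowSixteen t ∧ 15 * r + 10 = 160 * t ∧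
    ξ = r + 16 * t * S ∧ Next S 1 t ∧
    ∀ p, p < S + 1 → ∀ s, s < t → ∀ q, q < p → ∀ S', S' < S + 1 → PowSixteen p → PowSixteen s →
      S = q + p * (stepValue s + 16777216 * (s * s) * S') → Next S' (16 * s) t

theorem exp_len_stepClause (i : M) : (16 : M) ^ (6 + 2 * i) = 16777216 * (16 ^ i * 16 ^ i) := by
  have h6 : (16 : M) ^ (6 : M) = 16777216 := by
    have := natCast_exp (M := M) 16 6
    norm_num at this
    exact this.symm
  rw [exp_add, h6, two_mul, exp_add]

theorem stepValue_cat (i v : M) :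
    stepValue (16 ^ i) + 16777216 * (16 ^ i * 16 ^ i) * v = cat (stepClause i) v := by
  rw [cat, len_stepClause, ← stepClause_eq, exp_len_stepClause]
  ring

theorem baseClause_cat : cat baseClause 14 = (927289 : M) := by
  have h4 : (16 : M) ^ (4 : M) = 65536 := by
    have := natCast_exp (M := M) 16 4
    norm_num at this
    exact this.symm
  rw [cat, len_baseClause, h4, baseClause_eq]
  norm_num

/-- Multiplication by `16777216 * (s * s)`, with `s = 16 ^ i`, is a shift by `6 + 2 * i`, the length
of the clause. The number `927289` stands for the symbols `9, 3, 6, 2, 14`. -/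
theorem next_iff {S i x : M} : Next S (16 ^ i) (16 ^ x) ↔
    (i = x ∧ S = cat baseClause 14) ∨ (i < x ∧ ∃ v, S = cat (stepClause i) v) := by
  simp only [Next, exp_inj one_lt_sixteen, exp_lt_exp_iff one_lt_sixteen, stepValue_cat,
    baseClause_cat]
  refine or_congr Iff.rfl (and_congr_right fun _ => exists_congr fun v =>
    and_iff_right_of_imp fun h => ?_)
  rw [h, lt_add_one_iff']
  exact le_cat_right _ _

theorem stepClause_cat_inj {i j v w : M} (h : cat (stepClause i) v = cat (stepClause j) w) :
    i = j ∧ v = w := by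
  have key : ∀ i v : M, cat (stepClause i) v =
      cat 9 (cat 3 (cat 7 (cat (index i) (cat (index (i + 1)) v)))) := by
    intro i v
    simp only [stepClause, concat_cons, concat_nil, cat_zero, cat_assoc]
  have h' := h
  rw [key, key] at h'
  have := (index_cat_inj (cat_left_cancel (cat_left_cancel (cat_left_cancel h')))).1
  subst this
  exact ⟨rfl, cat_left_cancel h⟩

theorem stepClause_cat_ne {i v w : M} : cat (stepClause i) v ≠ cat baseClause w := by
  simp only [stepClause, baseClause, concat_cons, concat_nil, cat_zero, cat_assoc]
  intro h
  have := (symbol_cat_inj (a := 7) (a' := 6) (by norm_num) (by norm_num) (by norm_num) (by norm_num)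
    (cat_left_cancel (cat_left_cancel h))).1
  norm_num at this

theorem eq_cat_of_repr {S q a v : M} (hq : q < 16 ^ a) (h : S = q + 16 ^ a * v) :
    S / 16 ^ a = v :=
  div_eq hq (by rw [h, add_comm])

namespace IsBody

variable {x m : M} (h : IsBody x m)
include h

theorem len_eq : len m = pos x + 4 := by
  conv_lhs => rw [h.eq_cat le_rfl, h.div_last, len_cat, h.len_prefix le_rfl, len_baseClause]

theorem cat_div {i : M} (hi : i ≤ x) :
    cat m 14 / 16 ^ pos i = cat (m / 16 ^ pos i) 14 := by
  have h1 := h.eq_cat hi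
  refine eq_cat_of_repr (q := m % 16 ^ pos i) (mod_lt _ (exp_sixteen_pos _)) ?_
  conv_lhs => rw [h1, cat_assoc, cat, h.len_prefix hi, mul_comm]

theorem next {i : M} (hi : i ≤ x) : Next (cat (m / 16 ^ pos i) 14) (16 ^ i) (16 ^ x) := by
  rw [next_iff]
  rcases hi.lt_or_eq with hi | rfl
  · exact .inr ⟨hi, _, by rw [h.div_eq_cat hi, cat_assoc]⟩
  · exact .inl ⟨rfl, by rw [h.div_last]⟩

/-- Clauses begin only at the expected positions. -/
theorem eq_pos {a : M} (ha : sym (cat m 14) a = 9) : ∃ i, i ≤ x ∧ a = pos i := by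
  have ha' : a < len m := by
    refine not_le.1 fun hle => ?_
    obtain ⟨z, rfl⟩ := exists_add_of_le' hle
    rw [sym_cat_ge] at ha
    rcases (zero_le : 0 ≤ z).eq_or_lt with rfl | hz
    · rw [sym_symbol (by norm_num)] at ha
      norm_num at ha
    · rw [sym_of_len_le] at ha
      · norm_num at ha
      · rw [len_symbol (by norm_num) (by norm_num)]
        exact one_le_of_pos hz
  rw [sym_cat_lt _ ha'] at ha
  by_cases hx : pos x ≤ a
  · obtain ⟨z, rfl⟩ := exists_add_of_le' hx
    refine ⟨x, le_rfl, ?_⟩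
    have hcat := sym_cat_ge (m % 16 ^ pos x) (m / 16 ^ pos x) z
    rw [h.len_prefix le_rfl, ← h.eq_cat le_rfl, h.div_last] at hcat
    rw [hcat] at ha
    rcases (zero_le : 0 ≤ z).eq_or_lt with rfl | hz
    · rw [add_zero]
    · rw [h.len_eq] at ha'
      exact absurd ha (marked_baseClause.2.2 z hz
        (by rw [len_baseClause]; exact lt_of_add_lt_add_left ha'))
  · obtain ⟨j, hj, hmin⟩ := exists_least (P := fun j : M => a < pos j) ⟨x, not_le.1 hx⟩
    have hjx : j ≤ x := not_lt.1 fun hlt => hmin x hlt (not_le.1 hx)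
    have hj0 : 0 < j := pos_iff_ne_zero.2 fun h0 => by
      rw [h0, pos_zero] at hj; exact not_lt_zero hj
    obtain ⟨i, rfl⟩ := lt_iff_exists_add_one.1 hj0
    rw [zero_add] at hj hjx hmin
    have hi : i < x := (lt_add_one i).trans_le hjx
    refine ⟨i, hi.le, ?_⟩
    obtain ⟨z, rfl⟩ := exists_add_of_le' (not_lt.1 (hmin i (lt_add_one i)))
    rcases (zero_le : 0 ≤ z).eq_or_lt with rfl | hz
    · rw [add_zero]
    · rw [pos_succ] at hj
      have hz' : z < len (stepClause i) := by
        rw [len_stepClause]; exact lt_of_add_lt_add_left hj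
      have hcat := sym_cat_ge (m % 16 ^ pos i) (m / 16 ^ pos i) z
      rw [h.len_prefix hi.le, ← h.eq_cat hi.le, h.div_eq_cat hi, sym_cat_lt _ hz'] at hcat
      rw [hcat] at ha
      exact absurd ha ((marked_stepClause i).2.2 z hz hz')

end IsBody

/-- A step clause found anywhere in the string begins with the symbol `9`, which occurs only at the
positions `pos i`. So it is the clause with index `i`, and the remainder is what should follow. -/
theorem iterShape_of_isIterCode {x ξ : M} (h : IsIterCode x ξ) : IterShape ξ := by
  obtain ⟨r, m, hr, hm, rfl⟩ := h
  rw [cat_assoc]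
  have hlen : len r = x + 1 := hr.len (by norm_num) (by norm_num)
  have heq : cat r (cat m 14) = r + 16 * 16 ^ x * cat m 14 := by
    rw [cat, hlen, exp_succ]; ring
  have hr' := repeat_iff.1 hr
  have hr1 : 15 * r + 10 = 160 * 16 ^ x := by
    rw [mul_comm, hr', exp_succ]; ring
  have hrle : r ≤ cat r (cat m 14) := by rw [heq]; exact le_self_add
  have h0 : cat m 14 / 16 ^ pos (0 : M) = cat m 14 := by
    rw [pos_zero, exp_zero, div_one']
  refine ⟨16 ^ x, ?_, r, lt_add_one_iff'.2 hrle, cat m 14, lt_add_one_iff'.2 (le_cat_right _ _),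
    powSixteen_iff.2 ⟨x, rfl⟩, hr1, heq, ?_, ?_⟩
  · calc (16 : M) ^ x ≤ 160 * 16 ^ x := le_mul_of_one_le_left' (by norm_num)
      _ = 15 * r + 10 := hr1.symm
      _ < 15 * cat r (cat m 14) + 11 := by
        apply add_lt_add_of_le_of_lt
        · gcongr
        · norm_num
  · have := hm.next (i := 0) zero_le
    rwa [← hm.cat_div zero_le, h0, exp_zero] at this
  · intro p _ s hs q hq S' _ hp hs' he
    obtain ⟨a, rfl⟩ := powSixteen_iff.1 hp
    obtain ⟨j, rfl⟩ := powSixteen_iff.1 hs'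
    rw [stepValue_cat] at he
    have hdiv := eq_cat_of_repr hq he
    obtain ⟨i, hi, rfl⟩ := hm.eq_pos (a := a) (by
      rw [sym, digit, hdiv]
      have := sym_cat_zero (u := stepClause j) S' (marked_stepClause j).1
      rw [(marked_stepClause j).2.1, sym, digit, exp_zero, div_one'] at this
      exact this)
    rw [hm.cat_div hi] at hdiv
    rcases hi.lt_or_eq with hi | rfl
    · rw [hm.div_eq_cat hi, cat_assoc] at hdiv
      obtain ⟨rfl, rfl⟩ := stepClause_cat_inj hdiv
      have := hm.next (Order.add_one_le_of_lt hi)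
      rwa [exp_succ, mul_comm] at this
    · rw [hm.div_last] at hdiv
      exact absurd hdiv.symm stepClause_cat_ne

/-- Induction on `i ≤ x`: the part of the string from position `pos i` on begins with the clause of
index `i`, or is the end if `i = x`. The local condition carries this from one clause to the next.
-/
theorem isIterCode_of_iterShape {ξ : M} (h : IterShape ξ) : ∃ x, IsIterCode x ξ := by
  obtain ⟨t, -, r, -, S, -, ht, hr, hξ, h1, hs⟩ := h
  obtain ⟨x, rfl⟩ := powSixteen_iff.1 ht
  have hR : Repeat 10 (x + 1) r := by
    rw [repeat_iff, mul_comm, hr, exp_succ]; ring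
  have hnext : ∀ i, i ≤ x → Next (S / 16 ^ pos i) (16 ^ i) (16 ^ x) := by
    intro i
    refine induct (P := fun i => i ≤ x → Next (S / 16 ^ pos i) (16 ^ i) (16 ^ x))
      (hP := by unfold Next; infer_instance) (fun _ => ?_) (fun i ih hi => ?_) i
    · rwa [pos_zero, exp_zero, div_one']
    · have hi : i < x := (lt_add_one i).trans_le hi
      rcases next_iff.1 (ih hi.le) with ⟨rfl, -⟩ | ⟨-, v, hv⟩
      · exact absurd hi (lt_irrefl _)
      · have hS := div_add_mod S (16 ^ pos i)
        rw [hv, add_comm] at hS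
        have hp := exp_sixteen_pos (pos i)
        have hle : cat (stepClause i) v ≤ S := hv ▸ div_le _ _
        have hcat : cat (stepClause i) v ≠ 0 := fun h0 =>
          (marked_stepClause i).1 (cat_eq_zero.1 h0).1
        have := hs (16 ^ pos i) (lt_add_one_iff'.2 (by
            conv_rhs => rw [← hS]
            exact le_trans (le_mul_of_one_le_right' (one_le_of_pos (pos_iff_ne_zero.2 hcat)))
              le_add_self))
          (16 ^ i) (exp_lt_exp one_lt_sixteen hi) (S % 16 ^ pos i) (mod_lt _ hp) v
          (lt_add_one_iff'.2 ((le_cat_right _ _).trans hle)) (powSixteen_iff.2 ⟨_, rfl⟩)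
          (powSixteen_iff.2 ⟨_, rfl⟩) (by rw [stepValue_cat, hS])
        rw [pos_succ, exp_add, ← div_div, hv, exp_succ, mul_comm (16 ^ i : M)]
        rwa [eq_cat_of_repr (q := stepClause i) (v := v)]
        · rw [← len_stepClause]; exact lt_exp_len _
        · rw [cat, len_stepClause, mul_comm]
  have hmod : ∀ i, i < x → S % 16 ^ pos (i + 1) =
      S % 16 ^ pos i + stepValue (16 ^ i) * 16 ^ pos i := by
    intro i hi
    rcases next_iff.1 (hnext i hi.le) with ⟨rfl, -⟩ | ⟨-, v, hv⟩
    · exact absurd hi (lt_irrefl _)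
    · have hS := div_add_mod S (16 ^ pos i)
      rw [hv, add_comm] at hS
      have hlt := lt_exp_len (stepClause i)
      rw [len_stepClause] at hlt
      refine mod_eq (q := v) ?_ ?_
      · rw [pos_succ, exp_add, ← stepClause_eq]
        calc S % 16 ^ pos i + stepClause i * 16 ^ pos i
            < 16 ^ pos i + stepClause i * 16 ^ pos i := by
              gcongr; exact mod_lt _ (exp_sixteen_pos _)
          _ = 16 ^ pos i * (stepClause i + 1) := by ring
          _ ≤ _ := by gcongr; exact Order.add_one_le_of_lt hlt
      · conv_lhs => rw [← hS, cat, len_stepClause]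
        rw [pos_succ, exp_add (y := pos i), stepClause_eq]
        ring
  have hlast : S / 16 ^ pos x = cat baseClause 14 := by
    rcases next_iff.1 (hnext x le_rfl) with ⟨-, h⟩ | ⟨h, -⟩
    · exact h
    · exact absurd h (lt_irrefl _)
  -- This is `S` without its last symbol `14`.
  set m := S % 16 ^ pos x + 9785 * 16 ^ pos x with hm
  have hlt : S % 16 ^ pos x < 16 ^ pos x := mod_lt _ (exp_sixteen_pos _)
  have hle : ∀ i j : M, i ≤ j → pos i ≤ pos j := by
    intro i j hij; rw [pos, pos]; gcongr
  have hmS : ∀ i, i ≤ x → m % 16 ^ pos i = S % 16 ^ pos i := by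
    intro i hi
    rw [← mod_mod_exp (hle i x hi) m, hm, mod_add_exp _ hlt, mod_mod_exp (hle i x hi)]
  have hbody : IsBody x m := by
    refine ⟨by rw [hmS x le_rfl], fun i hi => ?_⟩
    rw [hmS i hi.le, hmS _ (Order.add_one_le_of_lt hi), hmod i hi]
  have hS : S = cat m 14 := by
    have := div_add_mod S (16 ^ pos x)
    rw [hlast, cat, len_baseClause, baseClause_eq] at this
    rw [cat, hbody.len_eq, exp_add, hm]
    conv_lhs => rw [← this]
    ring
  refine ⟨x, r, m, hR, hbody, ?_⟩
  rw [cat_assoc, ← hS, hξ, cat, hR.len (by norm_num) (by norm_num), exp_succ]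
  ring

theorem iterShape_iff {ξ : M} : IterShape ξ ↔ ∃ x, IsIterCode x ξ :=
  ⟨isIterCode_of_iterShape, fun ⟨_, h⟩ => iterShape_of_isIterCode h⟩

end RCAStar

namespace RCAStar

/-! ## The formula -/

/-- The closed term for a standard number. -/
def Trm.num {n : ℕ} : ℕ → Trm n
  | 0 => .zero
  | k + 1 => .add (.num k) .one

/-- A new variable `0` is introduced. -/
def Trm.shift {n : ℕ} (t : Trm n) : Trm (n + 1) := t.rename Fin.succ

namespace Bdd

variable {n : ℕ}

/-- Bounded existential quantification. -/
def bex (t : Trm n) (φ : Bdd 0 (n + 1)) : Bdd 0 n := .not (.ball t (.not φ))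

/-- Disjunction. -/
def or (φ ψ : Bdd 0 n) : Bdd 0 n := .not (.and (.not φ) (.not ψ))

/-- Implication. -/
def imp (φ ψ : Bdd 0 n) : Bdd 0 n := .not (.and φ (.not ψ))

/-- The formula for `PowTwo`. -/
def powTwo (q : Trm n) : Bdd 0 n :=
  .and (.lt .zero q)
    (.ball (.add q .one) (.imp
      (.bex (.add q.shift .one) (.eq (.mul (.var 1) (.var 0)) q.shift.shift))
      (.or (.eq (.var 0) .one)
        (.bex (.add q.shift .one) (.eq (.var 1) (.add (.var 0) (.var 0)))))))

/-- The formula for `PowSixteen`. -/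
def powSixteen (p : Trm n) : Bdd 0 n :=
  .bex (.add p .one) (.and
    (.eq p.shift (.mul (.mul (.var 0) (.var 0)) (.mul (.var 0) (.var 0)))) (powTwo (.var 0)))

/-- The term for `stepValue`. -/
def _root_.RCAStar.Trm.stepValue (s : Trm n) : Trm n :=
  .add (.add (.num 1849) (.mul (.num 8192) s)) (.mul (.num 2097152) (.mul s s))

/-- The term for the clause given by `s`, followed by `S`. -/
def _root_.RCAStar.Trm.stepCat (s S : Trm n) : Trm n :=
  .add s.stepValue (.mul (.mul (.num 16777216) (.mul s s)) S)

/-- The formula for `Next`. -/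
def next (S s t : Trm n) : Bdd 0 n :=
  .or (.and (.eq s t) (.eq S (.num 927289)))
    (.and (.lt s t) (.bex (.add S .one) (.eq S.shift (.stepCat s.shift (.var 0)))))

/-- The formula for `IterShape`. -/
def iterShape (ξ : Trm n) : Bdd 0 n :=
  .bex (.add (.mul (.num 15) ξ) (.num 11)) <| .bex (.add ξ.shift .one) <|
  .bex (.add ξ.shift.shift .one) <|
  .and (powSixteen (.var 2)) <| .and
    (.eq (.add (.mul (.num 15) (.var 1)) (.num 10)) (.mul (.num 160) (.var 2))) <| .and
    (.eq ξ.shift.shift.shift (.add (.var 1) (.mul (.mul (.num 16) (.var 2)) (.var 0)))) <| .and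
    (next (.var 0) .one (.var 2)) <|
  .ball (.add (.var 0) .one) <| .ball (.var 3) <| .ball (.var 1) <|
  .ball (.add (.var 3) .one) <| .imp (powSixteen (.var 3)) <| .imp (powSixteen (.var 2)) <| .imp
    (.eq (.var 4) (.add (.var 1) (.mul (.var 3) (.stepCat (.var 2) (.var 0)))))
    (next (.var 0) (.mul (.num 16) (.var 2)) (.var 6))

end Bdd

theorem Trm.num_noExp {n : ℕ} (k : ℕ) : (Trm.num k : Trm n).NoExp := by
  induction k with
  | zero => trivial
  | succ k ih => exact ⟨ih, trivial⟩

theorem Trm.noExp_rename {n n' : ℕ} (g : Fin n → Fin n') (t : Trm n) :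
    (t.rename g).NoExp ↔ t.NoExp := by
  induction t <;> simp_all [Trm.rename, Trm.NoExp]

theorem Trm.noExp_shift {n : ℕ} (t : Trm n) : t.shift.NoExp ↔ t.NoExp := t.noExp_rename _

/-- The formula that defines the codes of the sentences. -/
def codes : Delta0 :=
  ⟨.or (.eq (.var 0) (.num orderBoundCode)) (.iterShape (.var 0)), by
    simp [Bdd.NoExp, Trm.NoExp, Bdd.or, Bdd.iterShape, Bdd.bex, Bdd.imp, Bdd.next, Bdd.powSixteen,
      Bdd.powTwo, Trm.stepCat, Trm.stepValue, Trm.num_noExp, Trm.noExp_shift]⟩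

/-! ### Meaning of the formula in a model -/

section Holds

variable {M : Type u} [Model M] {n : ℕ} {S : Fin 0 → Set M} {e : Fin n → M}

theorem Trm.val_num (k : ℕ) : (Trm.num k : Trm n).val e = (k : M) := by
  rw [← nat_eq_cast]
  induction k with
  | zero => rfl
  | succ k ih => rw [Trm.num, Trm.val, ih]; rfl

theorem Trm.val_shift (t : Trm n) (a : M) :
    t.shift.val (Fin.cons a e : Fin (n + 1) → M) = t.val e := by
  rw [Trm.shift, Trm.val_rename]
  congr 1

namespace Bdd

theorem holds_bex {t : Trm n} {φ : Bdd 0 (n + 1)} : (bex t φ).Holds S e ↔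
    ∃ a, a < t.val e ∧ φ.Holds S (Fin.cons a e) := by
  simp [bex, Holds]

theorem holds_or {φ ψ : Bdd 0 n} : (or φ ψ).Holds S e ↔ φ.Holds S e ∨ ψ.Holds S e := by
  simp only [or, Holds]; tauto

theorem holds_imp {φ ψ : Bdd 0 n} : (imp φ ψ).Holds S e ↔ (φ.Holds S e → ψ.Holds S e) := by
  simp only [imp, Holds]; tauto

theorem holds_powTwo {q : Trm n} : (powTwo q).Holds S e ↔ PowTwo (q.val e) := by
  simp only [powTwo, Holds, holds_imp, holds_bex, holds_or, Trm.val, Trm.val_shift]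
  rfl

theorem holds_powSixteen {p : Trm n} : (powSixteen p).Holds S e ↔ PowSixteen (p.val e) := by
  simp only [powSixteen, Holds, holds_bex, Trm.val, Trm.val_shift, holds_powTwo]
  rfl

theorem val_stepCat {s t : Trm n} : (Trm.stepCat s t).val e =
    stepValue (s.val e) + 16777216 * (s.val e * s.val e) * t.val e := by
  simp only [Trm.stepCat, Trm.stepValue, Trm.val, Trm.val_num, stepValue, Nat.cast_ofNat]

theorem holds_next {t s r : Trm n} :
    (next t s r).Holds S e ↔ Next (t.val e) (s.val e) (r.val e) := by
  simp only [next, Holds, holds_bex, holds_or, Trm.val, Trm.val_shift, Trm.val_num, val_stepCat,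
    Nat.cast_ofNat]
  rfl

theorem holds_iterShape {ξ : Trm n} : (iterShape ξ).Holds S e ↔ IterShape (ξ.val e) := by
  simp only [iterShape, Holds, holds_bex, holds_imp, Trm.val, Trm.val_shift, Trm.val_num,
    val_stepCat, Nat.cast_ofNat, holds_powSixteen, holds_next]
  rfl

end Bdd

theorem codes_holds {ξ : M} :
    codes.Holds ξ ↔ ξ = nat orderBoundCode ∨ ∃ x, IsIterCode x ξ := by
  rw [Delta0.Holds, codes, Bdd.holds_or, Bdd.holds_iterShape, Trm.val, iterShape_iff, Bdd.Holds,
    Trm.val, Trm.val_num, nat_eq_cast]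

theorem codes_properties (M : Type u) [Arith M] (𝒳 : Set (Set M)) (h𝒳 : IsModel M 𝒳) :
    (∀ ξ : M, codes.Holds ξ → IsSentence 3 2 ξ) ∧
      (∀ 𝔸 : Struct M 𝒳, 𝔸.IsoNat ↔ ∀ ξ : M, codes.Holds ξ → 𝔸.Sat 3 2 ξ) ∧
      (∀ x : M, ∃ ξ : M, codes.Holds ξ ∧ ∀ 𝔸 : Struct M 𝒳, 𝔸.Sat 3 2 ξ ↔ 𝔸.IterExists x) := by
  let _ : Model M := { sets := 𝒳, isModel := h𝒳 }
  refine ⟨fun ξ hξ => ?_, fun 𝔸 => ?_, fun x => ?_⟩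
  · rcases codes_holds.1 hξ with h | ⟨x, hx⟩
    · exact h ▸ isSentence_orderBound
    · exact hx.isSentence (by norm_num)
  · rw [Struct.isoNat_iff_sat (M := M) 𝔸]
    constructor
    · rintro ⟨h1, h2⟩ ξ hξ
      rcases codes_holds.1 hξ with h | ⟨x, hx⟩
      · exact h ▸ h2
      · exact (hx.sat_iff (by norm_num) 𝔸).2 (h1 x)
    · intro h
      refine ⟨fun x => ?_, h _ (codes_holds.2 (.inl rfl))⟩
      obtain ⟨ξ, hξ⟩ := exists_iterCode x
      exact (hξ.sat_iff (by norm_num) 𝔸).1 (h ξ (codes_holds.2 (.inr ⟨x, hξ⟩)))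
  · obtain ⟨ξ, hξ⟩ := exists_iterCode x
    exact ⟨ξ, codes_holds.2 (.inr ⟨x, hξ⟩), fun 𝔸 => hξ.sat_iff (by norm_num) 𝔸⟩

end Holds

end RCAStar

namespace RCAStar

/-! ## The codes in the standard model -/

/-- The symbols of the clauses `f(vⱼ) = vⱼ₊₁` for `i ≤ j < i + y` and of the end of the sentence,
without the first symbol. -/
def tailSyms : ℕ → ℕ → List ℕ
  | _, 0 => [3, 6, 2, 14]
  | i, y + 1 => 3 :: 7 :: (indexSyms i ++ (indexSyms (i + 1) ++ 9 :: tailSyms (i + 1) y))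

/-- The symbols of the sentence which expresses that `f^x(c)` exists. -/
def iterSyms (x : ℕ) : List ℕ := List.replicate (x + 1) 10 ++ 9 :: tailSyms 0 x

theorem GoodSyms.tail (i y : ℕ) : GoodSyms (tailSyms i y) := by
  induction y generalizing i with
  | zero => constructor <;> simp [tailSyms]
  | succ y ih =>
    have h : ∀ a ≠ 0, a < 16 → GoodSyms [a] := fun a => GoodSyms.symbol
    exact (h 3 (by norm_num) (by norm_num)).append <| (h 7 (by norm_num) (by norm_num)).append <|
      (GoodSyms.index i).append <| (GoodSyms.index (i + 1)).append <|
      (h 9 (by norm_num) (by norm_num)).append (ih (i + 1))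

theorem GoodSyms.iter (x : ℕ) : GoodSyms (iterSyms x) :=
  (GoodSyms.replicate _ (by norm_num) (by norm_num)).append
    ((GoodSyms.symbol (a := 9) (by norm_num) (by norm_num)).append (.tail 0 x))

section

variable {M : Type u} [Model M]

/-- Induction on the number `y` of step clauses that remain, with the index `i` of the next one
varying, as in the recursion for `tailSyms`. The initial `9` is split off there because it also ends
the preceding block or clause. -/
theorem IsBody.str_tail {m : M} (y : ℕ) : ∀ i : ℕ, IsBody ((i + y : ℕ) : M) m →
    cat (m / 16 ^ pos (i : M)) 14 = str (9 :: tailSyms i y) := by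
  induction y with
  | zero =>
    intro i h
    rw [add_zero] at h
    rw [h.div_last, baseClause_cat, str]
    norm_num [tailSyms, Nat.ofDigits]
  | succ y ih =>
    intro i h
    have hi : (i : M) < ((i + (y + 1) : ℕ) : M) := natCast_lt.2 (by omega)
    have := ih (i + 1) (by rw [add_assoc, add_comm 1 y]; exact h)
    rw [h.div_eq_cat hi, cat_assoc]
    push_cast at this
    rw [this]
    simp only [stepClause, concat_cons, concat_nil, cat_zero, cat_assoc, tailSyms]
    rw [str_cons (a := 9) (l := 3 :: _) (by norm_num) (by norm_num), str_cons (a := 3) (by norm_num) (by norm_num), str_cons (a := 7) (by norm_num) (by norm_num),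
      str_append (.index _), str_append (.index _),
      str_index, str_index]
    norm_num

theorem IsIterCode.eq_str {x : ℕ} {ξ : M} (h : IsIterCode (nat x) ξ) : ξ = str (iterSyms x) := by
  obtain ⟨r, m, hr, hm, rfl⟩ := h
  rw [nat_eq_cast] at hr hm
  have h1 : r = str (List.replicate (x + 1) 10) := by
    have := repeat_str (M := M) 10 (x + 1)
    push_cast at this
    exact hr.unique this
  have h2 := IsBody.str_tail (m := m) x 0 (by rwa [zero_add])
  rw [Nat.cast_zero, pos_zero, exp_zero, div_one'] at h2
  rw [cat_assoc, h2, h1, iterSyms, str_append (.replicate _ (by norm_num) (by norm_num))]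

theorem isIterCode_nat_iff {x : ℕ} {ξ : M} :
    IsIterCode (nat x) ξ ↔ ξ = nat (Nat.ofDigits 16 (iterSyms x)) := by
  rw [nat_ofDigits]
  refine ⟨IsIterCode.eq_str, ?_⟩
  rintro rfl
  obtain ⟨ξ, hξ⟩ := exists_iterCode (nat x : M)
  exact hξ.eq_str ▸ hξ

end

/-! ### The standard model -/

theorem isModel_nat : IsModel ℕ Set.univ where
  add_one_ne_zero := Nat.succ_ne_zero
  add_one_inj _ _ h := Nat.succ.inj h
  add_zero _ := rfl
  add_succ _ _ := rfl
  mul_zero _ := rfl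
  mul_succ _ _ := rfl
  exp_zero _ := rfl
  exp_succ _ _ := rfl
  not_lt_zero := Nat.not_lt_zero
  lt_succ _ _ := Nat.lt_succ_iff_lt_or_eq
  induction _ _ _ _ _ _ h0 hs x := by
    induction x with
    | zero => exact h0
    | succ x ih => exact hs x ih
  comprehension _ _ _ _ _ _ _ _ := Set.mem_univ _

theorem nat_nat (k : ℕ) : (nat k : ℕ) = k := by
  induction k with
  | zero => rfl
  | succ k ih => rw [nat, ih]

/-- The standard model. -/
@[reducible] def modelNat : Model ℕ where
  sets := Set.univ
  isModel := isModel_nat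

theorem codes_holds_nat (k : ℕ) : codes.Holds k ↔
    k = Nat.ofDigits 16 (conjSyms orderSentence boundSentence) ∨
      ∃ x, k = Nat.ofDigits 16 (iterSyms x) := by
  refine (@codes_holds ℕ modelNat k).trans (or_congr ?_ (exists_congr fun x => ?_))
  · rw [nat_nat]
    unfold orderBoundCode
    exact Iff.rfl
  · have := @isIterCode_nat_iff ℕ modelNat x k
    rwa [nat_nat, nat_nat] at this

theorem goodSyms_orderBound : GoodSyms (conjSyms orderSentence boundSentence) :=
  (orderSentence.goodSyms (by norm_num) (by norm_num)).append
    ((GoodSyms.symbol (a := 14) (by norm_num) (by norm_num)).append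
      (boundSentence.goodSyms (by norm_num) (by norm_num)))

/-! ## Binary representations and symbols -/

/-- The symbol with the given bits. -/
def symBits (a b c d : Bool) : ℕ := a.toNat + 2 * (b.toNat + 2 * (c.toNat + 2 * d.toNat))

/-- The symbols given by a list of bits. -/
def chunk : List Bool → List ℕ
  | [] => []
  | [a] => [symBits a false false false]
  | [a, b] => [symBits a b false false]
  | [a, b, c] => [symBits a b c false]
  | a :: b :: c :: d :: l => symBits a b c d :: chunk l

theorem symBits_lt (a b c d : Bool) : symBits a b c d < 16 := by
  revert a b c d; decide

/-- The most significant bit is `1`, so the last symbol is not `0`, even if it is completed by zero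
bits. -/
theorem goodSyms_chunk (l : List Bool) (h : ∀ hl, l.getLast hl = true) : GoodSyms (chunk l) := by
  induction l using chunk.induct with
  | case1 => exact .nil
  | case2 a =>
    obtain rfl : a = true := by simpa using h
    exact .symbol (by decide) (by decide)
  | case3 a b =>
    obtain rfl : b = true := by simpa using h
    exact .symbol (by revert a; decide) (symBits_lt _ _ _ _)
  | case4 a b c =>
    obtain rfl : c = true := by simpa using h
    exact .symbol (by revert a b; decide) (symBits_lt _ _ _ _)
  | case5 a b c d l ih =>
    rw [chunk]
    rcases l.eq_nil_or_concat with rfl | ⟨l', e, hl⟩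
    · obtain rfl : d = true := by simpa using h
      exact .symbol (by revert a b c; decide) (symBits_lt _ _ _ _)
    · have hne : l ≠ [] := by rw [hl]; simp
      have ih := ih fun hl' => by simpa [List.getLast_cons, hne] using h (by simp)
      have hc : chunk l ≠ [] := by
        match l, hne with
        | [_], _ => simp [chunk]
        | [_, _], _ => simp [chunk]
        | [_, _, _], _ => simp [chunk]
        | _ :: _ :: _ :: _ :: _, _ => simp [chunk]
      refine ⟨fun x hx => ?_, fun _ => ?_⟩
      · rcases List.mem_cons.1 hx with rfl | hx
        · exact symBits_lt _ _ _ _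
        · exact ih.1 x hx
      · rw [List.getLast_cons hc]
        exact ih.2 hc

/-- The number with the given bits. -/
def ofBits (l : List Bool) : ℕ := l.foldr (fun b n => b.toNat + 2 * n) 0

theorem ofDigits_chunk (l : List Bool) : Nat.ofDigits 16 (chunk l) = ofBits l := by
  induction l using chunk.induct with
  | case5 a b c d l ih =>
    rw [chunk, Nat.ofDigits_cons, ih]
    simp only [ofBits, List.foldr, symBits]
    ring
  | _ => simp [chunk, ofBits, symBits]

theorem ofBits_encodePosNum (n : PosNum) : ofBits (Computability.encodePosNum n) = n := by
  induction n with
  | one => simp [Computability.encodePosNum, ofBits]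
  | bit1 n ih =>
    rw [Computability.encodePosNum, ofBits, List.foldr_cons, ← ofBits, ih, PosNum.cast_bit1]
    simp; ring
  | bit0 n ih =>
    rw [Computability.encodePosNum, ofBits, List.foldr_cons, ← ofBits, ih, PosNum.cast_bit0]
    simp; ring

theorem getLast_encodePosNum (n : PosNum) (h : Computability.encodePosNum n ≠ []) :
    (Computability.encodePosNum n).getLast h = true := by
  have hne : ∀ n, Computability.encodePosNum n ≠ [] := by
    intro n; cases n <;> simp [Computability.encodePosNum]
  induction n with
  | one => rfl
  | bit1 n ih => simp only [Computability.encodePosNum, List.getLast_cons (hne n), ih]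
  | bit0 n ih => simp only [Computability.encodePosNum, List.getLast_cons (hne n), ih]

theorem ofBits_encodeNat (k : ℕ) : ofBits (Computability.encodeNat k) = k := by
  rw [Computability.encodeNat]
  have : ((k : Num) : ℕ) = k := Num.to_of_nat k
  generalize (k : Num) = n at this
  subst this
  cases n with
  | zero => rfl
  | pos n => exact ofBits_encodePosNum n

theorem getLast_encodeNat (k : ℕ) (h : Computability.encodeNat k ≠ []) :
    (Computability.encodeNat k).getLast h = true := by
  unfold Computability.encodeNat at h ⊢
  generalize (k : Num) = n at h ⊢
  cases n with
  | zero => exact absurd rfl h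
  | pos n => exact getLast_encodePosNum n h

theorem GoodSyms.ofDigits_inj {l l' : List ℕ} (h : GoodSyms l) (h' : GoodSyms l') :
    Nat.ofDigits 16 l = Nat.ofDigits 16 l' ↔ l = l' := by
  refine ⟨fun he => ?_, fun he => he ▸ rfl⟩
  rw [← Nat.digits_ofDigits 16 (by norm_num) l h.1 h.2, he,
    Nat.digits_ofDigits 16 (by norm_num) l' h'.1 h'.2]

/-- Lists of symbols without a final `0` are determined by the number they denote. Hence membership
can be decided on the symbols, read off four bits at a time. -/
theorem codes_holds_iff_chunk (k : ℕ) : codes.Holds k ↔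
    chunk (Computability.encodeNat k) = conjSyms orderSentence boundSentence ∨
      ∃ x, chunk (Computability.encodeNat k) = iterSyms x := by
  have hk : k = Nat.ofDigits 16 (chunk (Computability.encodeNat k)) := by
    rw [ofDigits_chunk, ofBits_encodeNat]
  have hg := goodSyms_chunk _ (getLast_encodeNat k)
  rw [codes_holds_nat]
  refine or_congr ?_ (exists_congr fun x => ?_)
  · conv_lhs => rw [hk]
    exact hg.ofDigits_inj goodSyms_orderBound
  · conv_lhs => rw [hk]
    exact hg.ofDigits_inj (.iter x)

end RCAStar

namespace RCAStar

/-! ## An automaton with counters for the codes -/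

namespace CodeAutomaton

/-- The control states of the automaton. -/
inductive Phase
  | start | quants | nine | three | first | second | last | done | six | two | fin | bad
  deriving DecidableEq

instance : Fintype Phase where
  elems := {.start, .quants, .nine, .three, .first, .second, .last, .done, .six, .two, .fin, .bad}
  complete x := by cases x <;> decide

/-- The operations on counters. -/
inductive Op
  | keep | inc | dec
  deriving DecidableEq

/-- The effect of an operation. -/
def Op.app : Op → ℕ → ℕ
  | .keep, n => n
  | .inc, n => n + 1
  | .dec, n => n - 1

/-- The instructions: the next control state and the operations on the counters `y` (number of
clauses still to be read), `c` and `d` (used to compare indices), depending on whether the counters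
are positive. -/
def delta (p : Phase) (y c d : Bool) (a : ℕ) : Phase × Op × Op × Op :=
  match p with
  | .start => if a = 10 then (.quants, .inc, .keep, .keep) else (.bad, .keep, .keep, .keep)
  | .quants =>
    if a = 10 then (.quants, .inc, .keep, .keep)
    else if a = 9 then (.nine, .dec, .keep, .keep) else (.bad, .keep, .keep, .keep)
  | .nine => if a = 3 then (.three, .keep, .keep, .keep) else (.bad, .keep, .keep, .keep)
  | .three =>
    if a = 7 ∧ y = true then (.first, .keep, .keep, .keep)
    else if a = 6 ∧ y = false then (.six, .keep, .keep, .keep) else (.bad, .keep, .keep, .keep)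
  | .first =>
    if a = 0 ∧ c = true then (.first, .keep, .dec, .inc)
    else if a = 2 ∧ c = false then (.second, .keep, .keep, .keep)
    else (.bad, .keep, .keep, .keep)
  | .second =>
    if a = 0 ∧ d = true then (.second, .keep, .inc, .dec)
    else if a = 0 ∧ d = false then (.last, .keep, .inc, .keep)
    else (.bad, .keep, .keep, .keep)
  | .last => if a = 2 then (.done, .keep, .keep, .keep) else (.bad, .keep, .keep, .keep)
  | .done => if a = 9 then (.nine, .dec, .keep, .keep) else (.bad, .keep, .keep, .keep)
  | .six => if a = 2 then (.two, .keep, .keep, .keep) else (.bad, .keep, .keep, .keep)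
  | .two => if a = 14 then (.fin, .keep, .keep, .keep) else (.bad, .keep, .keep, .keep)
  | .fin => (.bad, .keep, .keep, .keep)
  | .bad => (.bad, .keep, .keep, .keep)

/-- The control state and the values of the counters. -/
abbrev Config : Type := Phase × ℕ × ℕ × ℕ

/-- One step of the automaton. -/
def step (s : Config) (a : ℕ) : Config :=
  let r := delta s.1 (s.2.1 ≠ 0) (s.2.2.1 ≠ 0) (s.2.2.2 ≠ 0) a
  (r.1, r.2.1.app s.2.1, r.2.2.1.app s.2.2.1, r.2.2.2.app s.2.2.2)

/-- The automaton accepts the rest of the input. -/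
def Accepts (s : Config) (l : List ℕ) : Prop := (l.foldl step s).1 = .fin

theorem accepts_cons {s : Config} {a : ℕ} {l : List ℕ} :
    Accepts s (a :: l) ↔ Accepts (step s a) l := Iff.rfl

theorem not_accepts_bad {y c d : ℕ} (l : List ℕ) : ¬ Accepts (.bad, y, c, d) l := by
  induction l with
  | nil => simp [Accepts]
  | cons a l ih => exact ih

theorem accepts_fin {y c d : ℕ} {l : List ℕ} : Accepts (.fin, y, c, d) l ↔ l = [] := by
  cases l with
  | nil => simp [Accepts]
  | cons a l => simpa using! not_accepts_bad l

theorem accepts_two {y c d : ℕ} {l : List ℕ} : Accepts (.two, y, c, d) l ↔ l = [14] := by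
  cases l with
  | nil => simp [Accepts]
  | cons a l =>
    rw [accepts_cons, step, delta]
    split_ifs with h
    · simp [h, Op.app, accepts_fin]
    · simp [h, not_accepts_bad]

theorem accepts_six {y c d : ℕ} {l : List ℕ} : Accepts (.six, y, c, d) l ↔ l = [2, 14] := by
  cases l with
  | nil => simp [Accepts]
  | cons a l =>
    rw [accepts_cons, step, delta]
    split_ifs with h
    · simp [h, Op.app, accepts_two]
    · simp [h, not_accepts_bad]

theorem accepts_done {y c d : ℕ} {l : List ℕ} : Accepts (.done, y, c, d) l ↔
    ∃ l', l = 9 :: l' ∧ Accepts (.nine, y - 1, c, d) l' := by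
  cases l with
  | nil => simp [Accepts]
  | cons a l =>
    rw [accepts_cons, step, delta]
    split_ifs with h
    · simp [h, Op.app]
    · simp [h, not_accepts_bad]

theorem accepts_last {y c d : ℕ} {l : List ℕ} : Accepts (.last, y, c, d) l ↔
    ∃ l', l = 2 :: l' ∧ Accepts (.done, y, c, d) l' := by
  cases l with
  | nil => simp [Accepts]
  | cons a l =>
    rw [accepts_cons, step, delta]
    split_ifs with h
    · simp [h, Op.app]
    · simp [h, not_accepts_bad]

/-- The counter `d` is emptied back into `c`, and one further tally is required when `d` has reached
`0`. So the second index exceeds the first by one, and `c` is ready for the next clause. -/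
theorem accepts_second {y c d : ℕ} {l : List ℕ} : Accepts (.second, y, c, d) l ↔
    ∃ l', l = indexSyms (d + 1) ++ l' ∧ Accepts (.done, y, c + d + 1, 0) l' := by
  induction d generalizing c l with
  | zero =>
    cases l with
    | nil => simp [Accepts, indexSyms]
    | cons a l =>
      rw [accepts_cons, step, delta]
      by_cases h : a = 0
      · simp [h, Op.app, accepts_last, indexSyms]
      · simp [h, not_accepts_bad, indexSyms]
  | succ d ih =>
    cases l with
    | nil => simp [Accepts, indexSyms]
    | cons a l =>
      rw [accepts_cons, step, delta]
      by_cases h : a = 0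
      · simp only [h, Op.app]
        simp only [ne_eq, Nat.add_eq_zero_iff, one_ne_zero, and_false, not_false_eq_true,
          decide_true, and_self, if_true, Nat.add_sub_cancel, ih]
        simp [indexSyms, List.replicate_succ, add_assoc, add_comm 1]
      · simp [h, not_accepts_bad, indexSyms, List.replicate_succ]

/-- Comparing the index with `c` uses `c` up. Its value is saved in `d`, one unit for each tally. -/
theorem accepts_first {y c d : ℕ} {l : List ℕ} : Accepts (.first, y, c, d) l ↔
    ∃ l', l = indexSyms c ++ l' ∧ Accepts (.second, y, 0, d + c) l' := by
  induction c generalizing d l with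
  | zero =>
    cases l with
    | nil => simp [Accepts, indexSyms]
    | cons a l =>
      rw [accepts_cons, step, delta]
      by_cases h : a = 2
      · simp [h, Op.app, indexSyms]
      · simp [h, not_accepts_bad, indexSyms]
  | succ c ih =>
    cases l with
    | nil => simp [Accepts, indexSyms]
    | cons a l =>
      rw [accepts_cons, step, delta]
      by_cases h : a = 0
      · simp only [h, Op.app]
        simp only [ne_eq, Nat.add_eq_zero_iff, one_ne_zero, and_false, not_false_eq_true,
          decide_true, and_self, if_true, Nat.add_sub_cancel, ih]
        simp [indexSyms, List.replicate_succ, add_assoc, add_comm 1]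
      · simp [h, not_accepts_bad, indexSyms, List.replicate_succ]

/-- The loop invariant at the beginning of a clause: `y` step clauses remain, the counter `c` holds
the index of the next one, and `d` is empty. -/
theorem accepts_nine {i y : ℕ} {l : List ℕ} : Accepts (.nine, y, i, 0) l ↔ l = tailSyms i y := by
  have h3 : ∀ {y i : ℕ} {l : List ℕ}, Accepts (.nine, y, i, 0) l ↔
      ∃ l', l = 3 :: l' ∧ Accepts (.three, y, i, 0) l' := by
    intro y i l
    cases l with
    | nil => simp [Accepts]
    | cons a l =>
      rw [accepts_cons, step, delta]
      split_ifs with h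
      · simp [h, Op.app]
      · simp [h, not_accepts_bad]
  rw [h3]
  induction y generalizing i l with
  | zero =>
    have h6 : ∀ l, Accepts (.three, 0, i, 0) l ↔ ∃ l', l = 6 :: l' ∧ Accepts (.six, 0, i, 0) l' := by
      intro l
      cases l with
      | nil => simp [Accepts]
      | cons a l =>
        rw [accepts_cons, step, delta]
        by_cases h : a = 6
        · simp [h, Op.app]
        · simp [h, not_accepts_bad]
    simp [h6, accepts_six, tailSyms]
  | succ y ih =>
    have h7 : ∀ l, Accepts (.three, y + 1, i, 0) l ↔
        ∃ l', l = 7 :: l' ∧ Accepts (.first, y + 1, i, 0) l' := by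
      intro l
      cases l with
      | nil => simp [Accepts]
      | cons a l =>
        rw [accepts_cons, step, delta]
        by_cases h : a = 7
        · simp [h, Op.app]
        · simp [h, not_accepts_bad]
    have h9 : ∀ l, Accepts (.nine, y, i + 1, 0) l ↔ l = tailSyms (i + 1) y := fun l =>
      h3.trans ih
    simp only [h7, accepts_first, accepts_second, accepts_done, Nat.add_sub_cancel, zero_add, h9,
      tailSyms]
    constructor
    · rintro ⟨_, rfl, _, rfl, _, rfl, _, rfl, _, rfl, rfl⟩
      rfl
    · rintro rfl
      exact ⟨_, rfl, _, rfl, _, rfl, _, rfl, _, rfl, rfl⟩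

/-- There is one quantifier more than there are step clauses. The decrement at the first `9`
accounts for this. -/
theorem accepts_quants {y : ℕ} {l : List ℕ} : Accepts (.quants, y + 1, 0, 0) l ↔
    ∃ n, l = List.replicate n 10 ++ 9 :: tailSyms 0 (y + n) := by
  induction l generalizing y with
  | nil => simp [Accepts]
  | cons a l ih =>
    rw [accepts_cons, step, delta]
    by_cases h : a = 10
    · subst h
      simp only [if_true, Op.app, ih]
      constructor
      · rintro ⟨n, rfl⟩
        exact ⟨n + 1, by rw [List.replicate_succ, add_assoc, add_comm 1]; rfl⟩
      · rintro ⟨n, hn⟩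
        cases n with
        | zero => simp at hn
        | succ n =>
          rw [List.replicate_succ, List.cons_append, List.cons.injEq] at hn
          exact ⟨n, by rw [add_assoc, add_comm 1, ← hn.2]⟩
    · by_cases h' : a = 9
      · subst h'
        simp only [h, if_false, if_true, Op.app, Nat.add_sub_cancel, accepts_nine]
        constructor
        · rintro rfl
          exact ⟨0, by simp⟩
        · rintro ⟨n, hn⟩
          cases n with
          | zero => simpa using hn
          | succ n => simp [List.replicate_succ] at hn
      · simp only [h, h', if_false, Op.app, not_accepts_bad, false_iff]
        rintro ⟨n, hn⟩
        cases n with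
        | zero => simp [h'] at hn
        | succ n => simp [List.replicate_succ, h] at hn

theorem accepts_start {l : List ℕ} : Accepts (.start, 0, 0, 0) l ↔ ∃ x, l = iterSyms x := by
  cases l with
  | nil => simp [Accepts, iterSyms]
  | cons a l =>
    rw [accepts_cons, step, delta]
    by_cases h : a = 10
    · simp only [h, if_true, Op.app, accepts_quants, iterSyms, List.replicate_succ,
        List.cons_append, List.cons.injEq, true_and, zero_add]
    · simp [h, not_accepts_bad, iterSyms, List.replicate_succ]

theorem Op.app_le (o : Op) (n : ℕ) : o.app n ≤ n + 1 := by
  cases o <;> simp only [Op.app] <;> omega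

/-! ### Recognition of a fixed word -/

/-- The rest of the word `F`, if the input read so far is an initial segment of `F`. -/
abbrev Rest (F : List ℕ) : Type := Option {r : List ℕ // r ∈ F.tails}

/-- Reading a symbol of the word. -/
def restStep {F : List ℕ} : Rest F → ℕ → Rest F
  | some ⟨b :: r, h⟩, a => if a = b then
      some ⟨r, (List.mem_tails _ _).2 ((List.suffix_cons b r).trans ((List.mem_tails _ _).1 h))⟩ else none
  | some ⟨[], _⟩, _ => none
  | none, _ => none

/-- Nothing has been read. -/
def restStart (F : List ℕ) : Rest F := some ⟨F, (List.mem_tails _ _).2 (List.suffix_refl F)⟩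

/-- The whole word has been read. -/
def restFin {F : List ℕ} : Rest F → Bool
  | some ⟨[], _⟩ => true
  | _ => false

theorem restFin_foldl_none {F : List ℕ} (l : List ℕ) :
    restFin (l.foldl restStep (none : Rest F)) = false := by
  induction l with
  | nil => rfl
  | cons a l ih => exact ih

theorem restFin_foldl_some {F r : List ℕ} (h : r ∈ F.tails) (l : List ℕ) :
    restFin (l.foldl restStep (some ⟨r, h⟩ : Rest F)) = true ↔ l = r := by
  induction l generalizing r with
  | nil => cases r <;> simp [restFin]
  | cons a l ih =>
    cases r with
    | nil => simp [restStep, restFin_foldl_none]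
    | cons b r =>
      rw [List.foldl_cons, restStep]
      split_ifs with hab
      · simp [ih, hab]
      · simp [hab, restFin_foldl_none]

/-! ### The combined automaton -/

/-- A configuration of the automaton for the codes together with the rest of a fixed word. -/
abbrev FullConfig (F : List ℕ) : Type := (Phase × Rest F) × ℕ × ℕ × ℕ

/-- One step. -/
def fullStep {F : List ℕ} (s : FullConfig F) (a : ℕ) : FullConfig F :=
  let r := delta s.1.1 (s.2.1 ≠ 0) (s.2.2.1 ≠ 0) (s.2.2.2 ≠ 0) a
  ((r.1, restStep s.1.2 a), r.2.1.app s.2.1, r.2.2.1.app s.2.2.1, r.2.2.2.app s.2.2.2)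

/-- The input is accepted. -/
def control {F : List ℕ} (q : Phase × Rest F) : Bool := q.1 = .fin || restFin q.2

theorem foldl_fullStep {F : List ℕ} (l : List ℕ) (p : Phase) (r : Rest F) (n : ℕ × ℕ × ℕ) :
    (l.foldl fullStep ((p, r), n)).1 = ((l.foldl step (p, n)).1, l.foldl restStep r) := by
  induction l generalizing p r n with
  | nil => rfl
  | cons a l ih => exact ih _ _ _

theorem control_foldl {F : List ℕ} (l : List ℕ) :
    control (l.foldl fullStep ((.start, restStart F), 0, 0, 0)).1 = true ↔
      l = F ∨ ∃ x, l = iterSyms x := by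
  rw [foldl_fullStep, control, Bool.or_eq_true, decide_eq_true_iff, restStart, restFin_foldl_some,
    ← accepts_start, or_comm]
  rfl

end CodeAutomaton

end RCAStar

namespace RCAStar

namespace CodeAutomaton

open Turing TM2.Stmt

/-! ## A Turing machine for the automaton -/

/-- The stacks: input, output, and the three counters. -/
inductive Stack
  | inp | out | cy | cc | cd
  deriving DecidableEq

instance : Fintype Stack where
  elems := {.inp, .out, .cy, .cc, .cd}
  complete x := by cases x <;> decide

/-- The labels: reading the input, and emptying the counters. -/
inductive Label
  | scan | clear
  deriving DecidableEq

instance : Fintype Label where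
  elems := {.scan, .clear}
  complete x := by cases x <;> decide

/-- The internal state: the control state of the automaton, the bits of a symbol, and for each
counter whether it is positive. -/
abbrev Memory (F : List ℕ) : Type :=
  (Phase × Rest F) × (Option Bool × Bool × Bool × Bool) × (Bool × Bool × Bool)

/-- The initial state. -/
def Memory.start (F : List ℕ) : Memory F :=
  ((.start, restStart F), (none, false, false, false), (false, false, false))

variable {F : List ℕ}

/-- The symbol that has been read. -/
def Memory.symbol (v : Memory F) : ℕ :=
  symBits (v.2.1.1.getD false) v.2.1.2.1 v.2.1.2.2.1 v.2.1.2.2.2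

/-- The instruction to be executed. -/
def Memory.instr (v : Memory F) : Phase × Op × Op × Op :=
  delta v.1.1 v.2.2.1 v.2.2.2.1 v.2.2.2.2 v.symbol

/-- Statements of the machine. -/
abbrev Stm (F : List ℕ) : Type := TM2.Stmt (fun _ : Stack => Bool) Label (Memory F)

/-- An operation on a counter. -/
def opStm (k : Stack) (f : Memory F → Op) (q : Stm F) : Stm F :=
  branch (fun v => f v = .inc) (push k (fun _ => true) q)
    (branch (fun v => f v = .dec) (pop k (fun v _ => v) q) q)

/-- Read a symbol and execute an instruction. -/
def scanStm : Stm F :=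
  pop .inp (fun v o => (v.1, (o, v.2.1.2), v.2.2)) <|
  pop .inp (fun v o => (v.1, (v.2.1.1, o.getD false, v.2.1.2.2), v.2.2)) <|
  pop .inp (fun v o => (v.1, (v.2.1.1, v.2.1.2.1, o.getD false, v.2.1.2.2.2), v.2.2)) <|
  pop .inp (fun v o => (v.1, (v.2.1.1, v.2.1.2.1, v.2.1.2.2.1, o.getD false), v.2.2)) <|
  peek .cy (fun v o => (v.1, v.2.1, o.isSome, v.2.2.2)) <|
  peek .cc (fun v o => (v.1, v.2.1, v.2.2.1, o.isSome, v.2.2.2.2)) <|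
  peek .cd (fun v o => (v.1, v.2.1, v.2.2.1, v.2.2.2.1, o.isSome)) <|
  branch (fun v => v.2.1.1.isNone) (goto fun _ => .clear) <|
  opStm .cy (fun v => v.instr.2.1) <| opStm .cc (fun v => v.instr.2.2.1) <|
  opStm .cd (fun v => v.instr.2.2.2) <|
  load (fun v => ((v.instr.1, restStep v.1.2 v.symbol), v.2)) <| goto fun _ => .scan

/-- Decrease the counters, and give the answer if they are zero. -/
def clearStm : Stm F :=
  pop .cy (fun v o => (v.1, v.2.1, o.isSome, v.2.2.2)) <|
  pop .cc (fun v o => (v.1, v.2.1, v.2.2.1, o.isSome, v.2.2.2.2)) <|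
  pop .cd (fun v o => (v.1, v.2.1, v.2.2.1, v.2.2.2.1, o.isSome)) <|
  branch (fun v => v.2.2.1 || v.2.2.2.1 || v.2.2.2.2) (goto fun _ => .clear) <|
  push .out (fun v => control v.1) <| load (fun _ => Memory.start F) halt

/-- The program. -/
def program : Label → Stm F
  | .scan => scanStm
  | .clear => clearStm

/-- The contents of the stacks. -/
def stackContents (l o : List Bool) (y c d : ℕ) : Stack → List Bool
  | .inp => l
  | .out => o
  | .cy => List.replicate y true
  | .cc => List.replicate c true
  | .cd => List.replicate d true

theorem update_inp (l l' o : List Bool) (y c d : ℕ) :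
    Function.update (stackContents l o y c d) .inp l' = stackContents l' o y c d := by
  funext k; cases k <;> rfl

theorem update_out (l o o' : List Bool) (y c d : ℕ) :
    Function.update (stackContents l o y c d) .out o' = stackContents l o' y c d := by
  funext k; cases k <;> rfl

theorem update_cy (l o : List Bool) (y y' c d : ℕ) :
    Function.update (stackContents l o y c d) .cy (List.replicate y' true) = stackContents l o y' c d := by
  funext k; cases k <;> rfl

theorem update_cc (l o : List Bool) (y c c' d : ℕ) :
    Function.update (stackContents l o y c d) .cc (List.replicate c' true) = stackContents l o y c' d := by
  funext k; cases k <;> rfl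

theorem update_cd (l o : List Bool) (y c d d' : ℕ) :
    Function.update (stackContents l o y c d) .cd (List.replicate d' true) = stackContents l o y c d' := by
  funext k; cases k <;> rfl

theorem stepAux_opStm (k : Stack) (f : Memory F → Op) (q : Stm F) (v : Memory F)
    (S : Stack → List Bool) (n : ℕ) (hS : S k = List.replicate n true) :
    TM2.stepAux (opStm k f q) v S =
      TM2.stepAux q v (Function.update S k (List.replicate ((f v).app n) true)) := by
  rw [opStm, TM2.stepAux]
  cases h : f v
  · rw [Op.app, ← hS, Function.update_eq_self]; simp [TM2.stepAux, h]
  · simp [TM2.stepAux, hS, Op.app, List.replicate_succ]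
  · simp [TM2.stepAux, h, hS, Op.app]

theorem head?_replicate_isSome (n : ℕ) :
    (List.replicate n true).head?.isSome = decide (n ≠ 0) := by
  cases n <;> simp [List.replicate_succ]

/-- Configurations of the machine. -/
abbrev MCfg (F : List ℕ) : Type := TM2.Cfg (fun _ : Stack => Bool) Label (Memory F)

/-- The machine gets from the first to the second configuration in `n` steps. -/
def Reach (n : ℕ) (a b : MCfg F) : Prop :=
  (flip bind (TM2.step program))^[n] (some a) = some b

theorem Reach.head {n : ℕ} {a b c : MCfg F} (h : TM2.step program a = some b) (hb : Reach n b c) :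
    Reach (n + 1) a c := by
  rw [Reach, Function.iterate_succ_apply]
  change (flip bind (TM2.step program))^[n] (TM2.step program a) = some c
  rw [h]
  exact hb

theorem Reach.trans {n m : ℕ} {a b c : MCfg F} (h : Reach n a b) (h' : Reach m b c) :
    Reach (m + n) a c := by
  rw [Reach, Function.iterate_add_apply, h, h']

theorem step_scan_nil (v : Memory F) (y c d : ℕ) : ∃ v' : Memory F, v'.1 = v.1 ∧
    TM2.step program ⟨some .scan, v, stackContents [] [] y c d⟩ =
      some ⟨some .clear, v', stackContents [] [] y c d⟩ := by
  refine ⟨(v.1, (none, false, false, false), (List.replicate y true).head?.isSome,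
    (List.replicate c true).head?.isSome, (List.replicate d true).head?.isSome), rfl, ?_⟩
  simp only [TM2.step, program, scanStm, TM2.stepAux, stackContents, List.head?_nil, List.tail_nil,
    update_inp, Option.isNone_none, cond_true]
  rfl

/-- One step of the machine pops four bits and executes one instruction of the automaton. Bits that
are missing at the end count as `false`, as in `chunk`. -/
theorem step_scan_cons (b : Bool) (l : List Bool) (v : Memory F) (y c d : ℕ) :
    ∃ (a : ℕ) (v' : Memory F), chunk (b :: l) = a :: chunk (l.drop 3) ∧
      let s := fullStep (v.1, y, c, d) a
      v'.1 = s.1 ∧ TM2.step program ⟨some .scan, v, stackContents (b :: l) [] y c d⟩ =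
        some ⟨some .scan, v', stackContents (l.drop 3) [] s.2.1 s.2.2.1 s.2.2.2⟩ := by
  let w : Memory F := (v.1, (some b, l.head?.getD false, l.tail.head?.getD false,
    l.tail.tail.head?.getD false), decide (y ≠ 0), decide (c ≠ 0), decide (d ≠ 0))
  refine ⟨w.symbol, ((w.instr.1, restStep w.1.2 w.symbol), w.2), ?_, rfl, ?_⟩
  rotate_left
  · simp only [TM2.step, program, scanStm, TM2.stepAux, stackContents, List.head?_cons, List.tail_cons,
      update_inp, Option.isNone_some, cond_false, head?_replicate_isSome]
    rw [stepAux_opStm _ _ _ _ _ y rfl, update_cy, stepAux_opStm _ _ _ _ _ c rfl, update_cc,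
      stepAux_opStm _ _ _ _ _ d rfl, update_cd]
    simp only [TM2.stepAux]
    rw [show l.tail.tail.tail = l.drop 3 by rcases l with _ | ⟨_, _ | ⟨_, _ | _⟩⟩ <;> rfl]
    rfl
  · change chunk (b :: l) = symBits b (l.head?.getD false) (l.tail.head?.getD false)
      (l.tail.tail.head?.getD false) :: chunk (l.drop 3)
    clear w
    match l with
    | [] => rfl
    | [_] => rfl
    | [_, _] => rfl
    | _ :: _ :: _ :: _ => rfl

theorem reach_scan : ∀ (n : ℕ) (l : List Bool), l.length ≤ n → ∀ (v : Memory F) (y c d : ℕ),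
    let s := (chunk l).foldl fullStep (v.1, y, c, d)
    ∃ v' : Memory F, v'.1 = s.1 ∧ ∃ m ≤ n + 1, Reach m ⟨some .scan, v, stackContents l [] y c d⟩
      ⟨some .clear, v', stackContents [] [] s.2.1 s.2.2.1 s.2.2.2⟩ := by
  intro n
  induction n with
  | zero =>
    intro l hl v y c d
    obtain rfl := List.length_eq_zero_iff.1 (Nat.le_zero.1 hl)
    obtain ⟨v', hv, h⟩ := step_scan_nil v y c d
    exact ⟨v', hv, 1, le_rfl, Reach.head h rfl⟩
  | succ n ih =>
    intro l hl v y c d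
    cases l with
    | nil =>
      obtain ⟨v', hv, h⟩ := step_scan_nil v y c d
      exact ⟨v', hv, 1, by omega, Reach.head h rfl⟩
    | cons b l =>
      obtain ⟨a, v', ha, hv, h⟩ := step_scan_cons b l v y c d
      obtain ⟨v'', hv'', m, hm, hr⟩ := ih (l.drop 3) (by
        rw [List.length_drop]; rw [List.length_cons] at hl; omega) v'
        (fullStep (v.1, y, c, d) a).2.1 (fullStep (v.1, y, c, d) a).2.2.1
        (fullStep (v.1, y, c, d) a).2.2.2
      rw [hv] at hv'' hr
      rw [ha]
      exact ⟨v'', hv'', m + 1, by omega, Reach.head h hr⟩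

/-- A halting configuration must have the initial memory and empty stacks apart from the output. The
three counters are emptied in parallel, and the control state that decides the answer is kept
meanwhile. -/
theorem reach_clear (n : ℕ) : ∀ (v : Memory F) (y c d : ℕ), y ≤ n → c ≤ n → d ≤ n →
    ∃ m ≤ n + 1, Reach m ⟨some .clear, v, stackContents [] [] y c d⟩
      ⟨none, Memory.start F, stackContents [] [control v.1] 0 0 0⟩ := by
  have key : ∀ (v : Memory F) (y c d : ℕ), TM2.step program
      ⟨some .clear, v, stackContents [] [] y c d⟩ =
      if y = 0 ∧ c = 0 ∧ d = 0 then some ⟨none, Memory.start F, stackContents [] [control v.1] 0 0 0⟩ else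
        some ⟨some .clear, (v.1, v.2.1, decide (y ≠ 0), decide (c ≠ 0), decide (d ≠ 0)),
          stackContents [] [] (y - 1) (c - 1) (d - 1)⟩ := by
    intro v y c d
    simp only [TM2.step, program, clearStm, TM2.stepAux, stackContents, List.tail_replicate, update_cy,
      update_cc, update_cd, update_out, head?_replicate_isSome]
    by_cases h : y = 0 ∧ c = 0 ∧ d = 0
    · obtain ⟨rfl, rfl, rfl⟩ := h
      simp
    · rw [if_neg h]
      have : (decide (y ≠ 0) || decide (c ≠ 0) || decide (d ≠ 0)) = true := by
        simp only [Bool.or_eq_true, decide_eq_true_eq]; omega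
      rw [this]
      rfl
  induction n with
  | zero =>
    intro v y c d hy hc hd
    refine ⟨1, le_rfl, Reach.head ((key v y c d).trans (if_pos ?_)) rfl⟩
    omega
  | succ n ih =>
    intro v y c d hy hc hd
    by_cases h : y = 0 ∧ c = 0 ∧ d = 0
    · exact ⟨1, by omega, Reach.head ((key v y c d).trans (if_pos h)) rfl⟩
    · obtain ⟨m, hm, hr⟩ := ih (v.1, v.2.1, decide (y ≠ 0), decide (c ≠ 0), decide (d ≠ 0))
        (y - 1) (c - 1) (d - 1) (by omega) (by omega) (by omega)
      exact ⟨m + 1, by omega, Reach.head ((key v y c d).trans (if_neg h)) hr⟩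

/-- A symbol increases a counter by at most one, so emptying the counters takes no longer than a
linear number of steps. -/
theorem foldl_fullStep_le (l : List ℕ) (s : FullConfig F) (n : ℕ) (hy : s.2.1 ≤ n)
    (hc : s.2.2.1 ≤ n) (hd : s.2.2.2 ≤ n) : (l.foldl fullStep s).2.1 ≤ n + l.length ∧
      (l.foldl fullStep s).2.2.1 ≤ n + l.length ∧ (l.foldl fullStep s).2.2.2 ≤ n + l.length := by
  induction l generalizing s n with
  | nil => exact ⟨hy, hc, hd⟩
  | cons a l ih =>
    have := ih (fullStep s a) (n + 1) ((Op.app_le _ _).trans (by omega))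
      ((Op.app_le _ _).trans (by omega)) ((Op.app_le _ _).trans (by omega))
    rw [List.length_cons, add_comm l.length 1, ← add_assoc]
    exact this

theorem length_chunk_le (l : List Bool) : (chunk l).length ≤ l.length := by
  induction l using chunk.induct with
  | case5 a b c d l ih => simp only [chunk, List.length_cons]; omega
  | _ => simp [chunk]

/-- The answer of the machine. -/
def answer (F : List ℕ) (l : List Bool) : Bool :=
  control ((chunk l).foldl fullStep ((.start, restStart F), 0, 0, 0)).1

theorem reach_answer (l : List Bool) : ∃ m ≤ 2 * l.length + 2,
    Reach m ⟨some .scan, Memory.start F, stackContents l [] 0 0 0⟩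
      ⟨none, Memory.start F, stackContents [] [answer F l] 0 0 0⟩ := by
  obtain ⟨v, hv, m, hm, hr⟩ := reach_scan l.length l le_rfl (Memory.start F) 0 0 0
  obtain ⟨h1, h2, h3⟩ := foldl_fullStep_le (chunk l) ((Memory.start F).1, 0, 0, 0) 0 le_rfl le_rfl
    le_rfl
  have := length_chunk_le l
  obtain ⟨m', hm', hr'⟩ := reach_clear l.length v _ _ _ (h1.trans (by omega)) (h2.trans (by omega))
    (h3.trans (by omega))
  rw [hv] at hr'
  exact ⟨m' + m, by omega, hr.trans hr'⟩

/-- The machine. -/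
noncomputable def machine (F : List ℕ) : FinTM2 where
  K := Stack
  k₀ := .inp
  k₁ := .out
  Γ _ := Bool
  Λ := Label
  main := .scan
  σ := Memory F
  initialState := Memory.start F
  σFin := Fintype.ofFinite _
  m := program

theorem initList_machine (l : List Bool) :
    initList (machine F) l = ⟨some .scan, Memory.start F, stackContents l [] 0 0 0⟩ := by
  have h : (initList (machine F) l).stk = stackContents l [] 0 0 0 := by
    funext k
    cases k <;> rfl
  exact congrArg (TM2.Cfg.mk (some Label.scan) (Memory.start F)) h

theorem haltList_machine (l : List Bool) :
    haltList (machine F) l = ⟨none, Memory.start F, stackContents [] l 0 0 0⟩ := by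
  have h : (haltList (machine F) l).stk = stackContents [] l 0 0 0 := by
    funext k
    cases k <;> rfl
  exact congrArg (TM2.Cfg.mk none (Memory.start F)) h

theorem polyTime {Ξ : Delta0} (F : List ℕ) (h : ∀ k : ℕ, Ξ.Holds k ↔
    chunk (Computability.encodeNat k) = F ∨ ∃ x, chunk (Computability.encodeNat k) = iterSyms x) :
    Ξ.PolyTime := by
  refine ⟨fun k => answer F (Computability.encodeNat k), fun k => ?_, ⟨?_⟩⟩
  · rw [h]
    exact control_foldl _
  · exact
      { tm := machine F
        inputAlphabet := Equiv.refl Bool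
        outputAlphabet := Equiv.refl Bool
        time := 2 * Polynomial.X + 2
        outputsFun := fun k =>
          { steps := (reach_answer (F := F) (Computability.encodeNat k)).choose
            evals_in_steps := by
              have := (reach_answer (F := F) (Computability.encodeNat k)).choose_spec.2
              exact (congrArg (fun z => (flip bind (machine F).step)^[_] (some z))
                ((congrArg (initList (machine F)) (List.map_id _)).trans (initList_machine _))).trans
                (Eq.trans this (congrArg some (haltList_machine _).symm))
            steps_le_m := by
              have := (reach_answer (F := F) (Computability.encodeNat k)).choose_spec.1
              simpa using this } }

end CodeAutomaton

theorem codes_polyTime : codes.PolyTime := CodeAutomaton.polyTime _ codes_holds_iff_chunk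

end RCAStar

theorem theorem2 :
    ∃ (Ξ : RCAStar.Delta0) (n d : ℕ), Ξ.PolyTime ∧
      ∀ (M : Type u) [RCAStar.Arith M] (𝒳 : Set (Set M)), RCAStar.IsModel M 𝒳 →
        (∀ ξ : M, Ξ.Holds ξ → RCAStar.IsSentence n d ξ) ∧
        (∀ 𝔸 : RCAStar.Struct M 𝒳,
          𝔸.IsoNat ↔ ∀ ξ : M, Ξ.Holds ξ → 𝔸.Sat n d ξ) ∧
        (∀ x : M, ∃ ξ : M, Ξ.Holds ξ ∧
          ∀ 𝔸 : RCAStar.Struct M 𝒳, 𝔸.Sat n d ξ ↔ 𝔸.IterExists x) :=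
  -- Three blocks of first-order quantifiers occur in `boundSentence`, one in the other nontrivial
  -- parts, and all relation variables are binary.
  ⟨RCAStar.codes, 3, 2, RCAStar.codes_polyTime, fun M _ 𝒳 h => RCAStar.codes_properties M 𝒳 h⟩
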